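/- Let $\mathbb{D}=\{z\in\mathbb{C}:|z|<1\}$. For functions $f,g$ analytic in $\mathbb{D}$, write $f\prec g$ if there is an analytic $w:\mathbb{D}\to\mathbb{D}$ with $w(0)=0$ and $f=g\circ w$ on $\mathbb{D}$. Let $\mathcal{A}$ be the set of functions $f$ analytic in $\mathbb{D}$ with $f(0)=0$, $f'(0)=1$, let $\varphi_{Ne}(z)=1+z-z^3/3$, and let $$\mathcal{C}_{Ne}=\Big\{f\in\mathcal{A}:\ 1+\frac{zf''(z)}{f'(z)}\prec\varphi_{Ne}(z)\Big\}.$$ Put $\widehat f_{Ne}(z)=\int_0^z e^{\zeta-\zeta^3/9}\,d\zeta$. Say that $f$ is a rotation of $\widehat f_{Ne}$ if there is $x\in\mathbb{C}$ with $|x|=1$ and $f(z)=x^{-1}\widehat f_{Ne}(xz)$ for all $z\in\mathbb{D}$. The quotients $zf'(z)/f(z)$ and $f(z)/z$ are given the value $1$ at $z=0$. Theorem. Let $f\in\mathcal{C}_{Ne}$. In (ii), (iii) and (v), let $|z|=r<1$. Then: (i) Subordination: $\dfrac{zf'(z)}{f(z)}\prec\dfrac{z\widehat f_{Ne}'(z)}{\widehat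 f_{Ne}(z)}$ and $\dfrac{f(z)}{z}\prec\dfrac{\widehat f_{Ne}(z)}{z}$. (ii) Distortion: $\widehat f_{Ne}'(-r)\le|f'(z)|\le\widehat f_{Ne}'(r)$. (iii) Growth: $-\widehat f_{Ne}(-r)\le|f(z)|\le\widehat f_{Ne}(r)$. (iv) Covering: either $f$ is a rotation of $\widehat f_{Ne}$ or $f(\mathbb{D})$ contains the disk $\{w:|w|<-\widehat f_{Ne}(-1)\}$. Here $-\widehat f_{Ne}(-1)\approx0.645159$, with error less than $5\cdot10^{-7}$. (v) Rotation: $\Big|\arg\dfrac{f(z)}{z}\Big|\le\max_{|\zeta|=r}\arg\dfrac{\widehat f_{Ne}(\zeta)}{\zeta}$, where $\arg$ is the principal argument. Equality cases: for each of the two inequalities in (ii), each of the two inequalities in (iii), and the inequality in (v), equality holds for some nonzero $z\in\mathbb{D}$ if and only if $f$ is a rotation of $\widehat f_{Ne}$. Moreover, $\{w:|w|<-\widehat f_{Ne}(-1)\}$ is the largest open disk centred at $0$ contained in $f(\mathbb{D})$ if and only if $f$ is a rotation of $\widehat f_{Ne}$. -/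

import Mathlib

open Metric

/-- The class `𝒜`: analytic functions on the open unit disk `ball 0 1` with
`f(0) = 0` and `f'(0) = 1`.  Values of `f` outside the disk play no role. -/
def ClassA : Set (ℂ → ℂ) :=
  {f | DifferentiableOn ℂ f (ball 0 1) ∧ f 0 = 0 ∧ deriv f 0 = 1}

/-- Subordination `f ≺ g` of functions analytic in the open unit disk: `f = g ∘ w` on the disk
for some analytic `w` with `w(0) = 0` and `|w| < 1`. -/
def Subordinate (f g : ℂ → ℂ) : Prop :=
  DifferentiableOn ℂ f (ball 0 1) ∧ DifferentiableOn ℂ g (ball 0 1) ∧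
    ∃ w : ℂ → ℂ, DifferentiableOn ℂ w (ball 0 1) ∧ w 0 = 0 ∧
      (∀ z ∈ ball (0 : ℂ) 1, ‖w z‖ < 1) ∧ ∀ z ∈ ball (0 : ℂ) 1, f z = g (w z)

/-- The Ma-Minda class `𝒞(φ)`: all `f ∈ 𝒜` with `1 + z f''/f' ≺ φ`.  The subordination makes
the quotient bounded near every point of the disk, so it forces `f' ≠ 0` there. -/
def MaMindaConvex (φ : ℂ → ℂ) : Set (ℂ → ℂ) :=
  {f | f ∈ ClassA ∧ Subordinate (fun z => 1 + z * deriv (deriv f) z / deriv f z) φ}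

/-- The nephroid function `φ_Ne(z) = 1 + z - z³/3`. -/
noncomputable def phiNe (z : ℂ) : ℂ := 1 + z - z ^ 3 / 3

/-- The class `𝒞_Ne`. -/
def ClassCNe : Set (ℂ → ℂ) := MaMindaConvex phiNe

/-- The extremal function `∫₀^z exp(ζ - ζ³/9) dζ`, integrated along the segment from `0` to `z`. -/
noncomputable def neHat (z : ℂ) : ℂ :=
  ∫ t in (0 : ℝ)..1, Complex.exp ((t : ℂ) * z - ((t : ℂ) * z) ^ 3 / 9) * z

/-- `z f'(z) / f(z)` for `f ∈ 𝒜`, with its removable singularity at `0` filled in. -/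
noncomputable def starQuot (f : ℂ → ℂ) (z : ℂ) : ℂ :=
  if z = 0 then 1 else z * deriv f z / f z

/-- `f(z) / z` for `f ∈ 𝒜`, with its removable singularity at `0` filled in. -/
noncomputable def idQuot (f : ℂ → ℂ) (z : ℂ) : ℂ :=
  if z = 0 then 1 else f z / z

/-- On the unit disk, `f` is a rotation of `g`: `f(z) = x⁻¹ g(x z)` for some `x` with `|x| = 1`. -/
def IsRotationOf (f g : ℂ → ℂ) : Prop :=
  ∃ x : ℂ, ‖x‖ = 1 ∧ ∀ z ∈ ball (0 : ℂ) 1, f z = x⁻¹ * g (x * z)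

/-- `neHat` is the primitive of `exp(z - z³/9)` vanishing at `0`. -/
theorem hasDerivAt_neHat (z : ℂ) :
    HasDerivAt neHat (Complex.exp (z - z ^ 3 / 9)) z := by
  have hd : Differentiable ℂ (fun ζ : ℂ => Complex.exp (ζ - ζ ^ 3 / 9)) := by fun_prop
  obtain ⟨F, hF⟩ : ∃ F : ℂ → ℂ, ∀ ζ, HasDerivAt F (Complex.exp (ζ - ζ ^ 3 / 9)) ζ := by
    obtain ⟨F, hF⟩ := hd.isExactOn_univ
    exact ⟨F, fun ζ => hF ζ (Set.mem_univ ζ)⟩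
  have h : neHat = fun u => F u - F 0 := by
    funext u
    have h1 : ∀ t ∈ Set.uIcc (0 : ℝ) 1, HasDerivAt (fun s : ℝ => F ((s : ℂ) * u))
        (Complex.exp ((t : ℂ) * u - ((t : ℂ) * u) ^ 3 / 9) * u) t := by
      intro t _
      have h2 : HasDerivAt (fun s : ℝ => (s : ℂ) * u) u t := by
        simpa using (Complex.ofRealCLM.hasDerivAt (x := t)).mul_const u
      exact (hF _).comp t h2
    have := intervalIntegral.integral_eq_sub_of_hasDerivAt h1
      (Continuous.intervalIntegrable (by fun_prop) _ _)
    simpa [neHat] using this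
  rw [h]
  exact (hF z).sub_const _

/-- `neHat` takes real values at real points. -/
theorem neHat_ofReal_im (x : ℝ) : (neHat x).im = 0 := by
  have : neHat x = ((∫ t in (0 : ℝ)..1, Real.exp (t * x - (t * x) ^ 3 / 9) * x : ℝ) : ℂ) := by
    rw [neHat, ← intervalIntegral.integral_ofReal]
    push_cast
    rfl
  rw [this, Complex.ofReal_im]

open Set Filter Topology ComplexConjugate

/-! ### Functions whose derivative has positive real part -/

/-! Write E, K, B for `neExp`, `neK`, `neB`: with g = `neHat` these are log g', g/z and g/(zg'). The
theorem rests on three subordinations: log f' ≺ E, f/(zf') ≺ B and f/z ≺ K. Each is proved by the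
method of first contact (`exists_schwarz_of_no_contact`): if p is not subordinate to a function G
with Re G' > 0 on the closed disk, Jack's lemma gives |z₀| < 1, |ζ₀| = 1 and m ≥ 1 with p(z₀) =
G(ζ₀) and z₀p'(z₀) = mζ₀G'(ζ₀), and this has to be refuted.

For log f', the quantity z(log f')' lies in the nephroid domain {ω - ω³/3 : |ω| < 1}, while m times
a boundary point does not (`neExp_no_contact`). For b = f/(zf') there is the equation zb' = 1 - (1 +
zf''/f')b, which B satisfies with φ = `phiNe` as coefficient. Contact would put φ(ζ) + (m-1)(φ(ζ) -
1/B(ζ)) inside the domain, but this ray leaves the nephroid outwards (`no_contact_neB`). For f/z,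
the second subordination makes zf'/f - 1 a value of 1/B - 1 at an interior point, and contact makes
it m times a value on the circle; starlikeness of 1/B - 1 (`inv_neB_starlike`) and injectivity of B
exclude this.

What is needed of B reduces to inequalities on the unit circle. There B is replaced by its Taylor
polynomial of degree nine, with the error controlled through the differential equation, and
polynomial inequalities in x = Re z remain (`E1_pos` to `E4_pos`).

The bounds then follow from the Schwarz lemma and the extreme values of Re E, |K| and arg K on disks
|ζ| ≤ r, which are attained only on |ζ| = r; equality in the Schwarz lemma makes f a rotation.
Covering follows from growth by connectedness. For its equality case, the lower distortion bound is
integrated along the preimage of a radius, which carries a strict growth estimate up to the boundary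
(`sphere_subset_image`). -/

theorem hasDerivAt_re {F : ℝ → ℂ} {F' : ℂ} {t : ℝ} (h : HasDerivAt F F' t) :
    HasDerivAt (fun s => (F s).re) F'.re t :=
  Complex.reCLM.hasFDerivAt.comp_hasDerivAt t h

theorem re_lt_re_of_deriv_re_pos {F F' : ℝ → ℂ}
    (hF : ∀ t ∈ Icc (0 : ℝ) 1, HasDerivAt F (F' t) t)
    (hpos : ∀ t ∈ Ioo (0 : ℝ) 1, 0 < (F' t).re) : (F 0).re < (F 1).re := by
  have hre : ∀ t ∈ Icc (0 : ℝ) 1, HasDerivAt (fun s => (F s).re) (F' t).re t := fun t ht =>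
    hasDerivAt_re (hF t ht)
  have hmono : StrictMonoOn (fun s => (F s).re) (Icc 0 1) := by
    apply strictMonoOn_of_deriv_pos (convex_Icc 0 1)
    · exact fun t ht => (hre t ht).continuousAt.continuousWithinAt
    · intro t ht
      rw [interior_Icc] at ht
      rw [(hre t (Ioo_subset_Icc_self ht)).deriv]
      exact hpos t ht
  exact hmono (by simp) (by simp) one_pos

theorem hasDerivAt_comp_segment {g : ℂ → ℂ} {g' a b : ℂ} {t : ℝ}
    (hg : HasDerivAt g g' (a + t * b)) :
    HasDerivAt (fun s : ℝ => g (a + s * b)) (g' * b) t := by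
  have h : HasDerivAt (fun s : ℝ => a + (s : ℂ) * b) b t := by
    simpa using ((Complex.ofRealCLM.hasDerivAt (x := t)).mul_const b).const_add a
  exact hg.comp t h

theorem hasDerivAt_comp_ray {g : ℂ → ℂ} {g' b : ℂ} {t : ℝ} (hg : HasDerivAt g g' (t * b)) :
    HasDerivAt (fun s : ℝ => g (s * b)) (g' * b) t := by
  simpa using hasDerivAt_comp_segment (a := 0) (b := b) (t := t) (by simpa using hg)

/-- The Noshiro–Warschawski criterion: (g y - g x)/(y - x) is the mean of g' over the segment from x
to y, so its real part is positive. -/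
theorem injOn_of_deriv_re_pos {g g' : ℂ → ℂ} {S : Set ℂ} (hS : Convex ℝ S)
    (hg : ∀ z ∈ S, HasDerivAt g (g' z) z) (hpos : ∀ z ∈ S, 0 < (g' z).re) : InjOn g S := by
  intro x hx y hy hxy
  by_contra hne
  have hne' : y - x ≠ 0 := sub_ne_zero.2 (Ne.symm hne)
  have hmem : ∀ t ∈ Icc (0 : ℝ) 1, x + t * (y - x) ∈ S := fun t ht => by
    have := hS.add_smul_sub_mem hx hy ht
    simpa using this
  have := re_lt_re_of_deriv_re_pos (F := fun t : ℝ => g (x + t * (y - x)) / (y - x))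
    (F' := fun t => g' (x + t * (y - x)))
    (fun t ht => by
      have := (hasDerivAt_comp_segment (hg _ (hmem t ht))).div_const (y - x)
      rwa [mul_div_assoc, div_self hne', mul_one] at this)
    (fun t ht => hpos _ (hmem t (Ioo_subset_Icc_self ht)))
  simp [hxy] at this

/-- Near g ζ the set-theoretic inverse agrees with the local inverse of the inverse function
theorem, because the latter takes values in U, where g is injective. -/
theorem exists_hasDerivAt_inverse {g : ℂ → ℂ} {U : Set ℂ} (hU : IsOpen U)
    (hg : DifferentiableOn ℂ g U) (hinj : InjOn g U) (hd : ∀ z ∈ U, deriv g z ≠ 0) :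
    ∃ γ : ℂ → ℂ, (∀ ζ ∈ U, γ (g ζ) = ζ) ∧
      ∀ ζ ∈ U, HasDerivAt γ (deriv g ζ)⁻¹ (g ζ) := by
  refine ⟨Function.invFunOn g U, fun ζ hζ => hinj.leftInvOn_invFunOn hζ, fun ζ hζ => ?_⟩
  have hs : HasStrictDerivAt g (deriv g ζ) ζ :=
    (hg.analyticAt (hU.mem_nhds hζ)).hasStrictDerivAt
  have h1 := hs.to_localInverse (hd ζ hζ)
  refine h1.hasDerivAt.congr_of_eventuallyEq ?_
  have h2 := h1.hasDerivAt.continuousAt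
  have h3 : hs.localInverse g _ ζ (hd ζ hζ) (g ζ) = ζ :=
    (hs.eventually_left_inverse (hd ζ hζ)).self_of_nhds
  have h4 : ∀ᶠ y in 𝓝 (g ζ), hs.localInverse g _ ζ (hd ζ hζ) y ∈ U :=
    h2 (by rw [h3]; exact hU.mem_nhds hζ)
  filter_upwards [h4, hs.eventually_right_inverse (hd ζ hζ)] with y hy hy'
  conv_lhs => rw [← hy']
  exact hinj.leftInvOn_invFunOn hy

theorem exists_one_lt_ball_subset {U : Set ℂ} (hU : IsOpen U) (h : closedBall (0 : ℂ) 1 ⊆ U) :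
    ∃ R : ℝ, 1 < R ∧ ball (0 : ℂ) R ⊆ U := by
  obtain ⟨δ, hδ, h⟩ := (isCompact_closedBall (0 : ℂ) 1).exists_thickening_subset_open hU h
  rw [thickening_closedBall hδ zero_le_one] at h
  exact ⟨δ + 1, by linarith, by simpa [add_comm] using h⟩

/-- The minimum principle for the real part, in strict form. -/
theorem re_pos_of_sphere {h : ℂ → ℂ} (hd : ∀ z ∈ closedBall (0 : ℂ) 1, DifferentiableAt ℂ h z)
    (hs : ∀ z ∈ sphere (0 : ℂ) 1, 0 < (h z).re) : ∀ z ∈ closedBall (0 : ℂ) 1, 0 < (h z).re := by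
  intro z hz
  have hc : ContinuousOn (fun z => (h z).re) (sphere 0 1) := fun w hw =>
    (Complex.continuous_re.continuousAt.comp
      (hd w (sphere_subset_closedBall hw)).continuousAt).continuousWithinAt
  obtain ⟨w, hw, hmin⟩ := (isCompact_sphere (0 : ℂ) 1).exists_isMinOn
    ⟨1, by simp⟩ hc
  -- The maximum principle is applied to exp(-h), whose modulus is exp(-Re h).
  have hcl : DiffContOnCl ℂ (fun z => Complex.exp (-h z)) (ball 0 1) := by
    apply DifferentiableOn.diffContOnCl
    rw [closure_ball _ one_ne_zero]
    exact fun y hy => (hd y hy).neg.cexp.differentiableWithinAt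
  have := Complex.norm_le_of_forall_mem_frontier_norm_le isBounded_ball hcl
    (C := Real.exp (-(h w).re)) (fun y hy => by
      rw [frontier_ball _ one_ne_zero] at hy
      rw [Complex.norm_exp]
      exact Real.exp_le_exp.2 (by simpa using hmin hy))
    (z := z) (by rwa [closure_ball _ one_ne_zero])
  rw [Complex.norm_exp, Real.exp_le_exp] at this
  have h2 := hs w hw
  simp at this
  linarith

/-! ### Jack's lemma and the method of first contact -/

/-- Jack's lemma. Put A = conj(w z₀) z₀ w'(z₀). By the Schwarz lemma |w(t z₀)| ≤ t, with equality at
t = 1, so the radial derivative gives Re A ≥ 1. On the circle through z₀ the modulus of w is maximal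
at z₀, so the tangential derivative gives Im A = 0. -/
theorem one_le_of_schwarz_contact {w : ℂ → ℂ} {z₀ : ℂ} (hz₀ : z₀ ≠ 0)
    (hw : DifferentiableOn ℂ w (ball 0 ‖z₀‖)) (h0 : w 0 = 0)
    (hlt : ∀ z ∈ ball (0 : ℂ) ‖z₀‖, ‖w z‖ ≤ 1) (hle : ∀ z, ‖z‖ = ‖z₀‖ → ‖w z‖ ≤ 1)
    (hd : DifferentiableAt ℂ w z₀) (h1 : ‖w z₀‖ = 1) :
    ∃ m : ℝ, 1 ≤ m ∧ z₀ * deriv w z₀ = m * w z₀ := by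
  have hr : 0 < ‖z₀‖ := norm_pos_iff.2 hz₀
  have hw1 : conj (w z₀) * w z₀ = 1 := by
    rw [mul_comm, Complex.mul_conj, Complex.normSq_eq_norm_sq, h1]; simp
  set A : ℂ := conj (w z₀) * (z₀ * deriv w z₀) with hA
  have hAw : z₀ * deriv w z₀ = A * w z₀ := by
    rw [hA]; linear_combination (-(z₀ * deriv w z₀)) * hw1
  have hnorm : ∀ c : ℂ, (conj (w z₀) * c).re ≤ ‖c‖ := fun c => by
    refine (Complex.re_le_norm _).trans ?_
    rw [norm_mul, RCLike.norm_conj, h1, one_mul]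
  -- radial direction
  have hrad : HasDerivAt (fun t : ℝ => (conj (w z₀) * w (t * z₀)).re - t) (A.re - 1) 1 := by
    have hd' : HasDerivAt w (deriv w z₀) (((1 : ℝ) : ℂ) * z₀) := by
      rw [Complex.ofReal_one, one_mul]; exact hd.hasDerivAt
    have := (hasDerivAt_re ((hasDerivAt_comp_ray hd').const_mul (conj (w z₀)))).sub
      (hasDerivAt_id' (1 : ℝ))
    rw [mul_comm (deriv w z₀)] at this
    exact this
  have hAre : 1 ≤ A.re := by
    by_contra hcon
    push Not at hcon
    have hev : ∀ᶠ t : ℝ in 𝓝[<] (1 : ℝ), (conj (w z₀) * w (t * z₀)).re - t ≤ 0 := by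
      have h2 : Ioo (0 : ℝ) 1 ∈ 𝓝[<] (1 : ℝ) := Ioo_mem_nhdsLT one_pos
      filter_upwards [h2] with t ht
      have hmem : (t : ℂ) * z₀ ∈ ball (0 : ℂ) ‖z₀‖ := by
        simp only [mem_ball_zero_iff, norm_mul, Complex.norm_real, Real.norm_eq_abs,
          abs_of_pos ht.1]
        nlinarith [ht.2]
      have h3 := Complex.dist_le_div_mul_dist_of_mapsTo_ball (R₁ := ‖z₀‖) (R₂ := 1) hw
        (fun y hy => by simpa [h0] using hlt y hy) hmem
      have h4 : 1 / ‖z₀‖ * dist ((t : ℂ) * z₀) 0 = t := by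
        simp only [dist_zero_right, norm_mul, Complex.norm_real, Real.norm_eq_abs, abs_of_pos ht.1]
        field_simp
      rw [h4, h0, dist_zero_right] at h3
      linarith [hnorm (w (t * z₀))]
    have hval : (conj (w z₀) * w ((1 : ℝ) * z₀)).re - 1 = 0 := by
      simp only [Complex.ofReal_one, one_mul, hw1]; simp
    have hslope : ∀ᶠ t in 𝓝[<] (1 : ℝ),
        slope (fun t : ℝ => (conj (w z₀) * w (t * z₀)).re - t) 1 t < 0 := by
      have := (hasDerivAt_iff_tendsto_slope.1 hrad).mono_left
        (nhdsWithin_mono 1 (fun t (ht : t < 1) => ht.ne))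
      exact this.eventually (gt_mem_nhds (by linarith))
    obtain ⟨t, ⟨hs, hle⟩, ht⟩ := ((hslope.and hev).and self_mem_nhdsWithin).exists
    rw [slope_def_field] at hs
    have ht' : t < 1 := ht
    rw [hval, sub_zero] at hs
    have := div_nonneg_of_nonpos hle (by linarith : t - 1 ≤ 0)
    linarith
  -- tangential direction
  have htan : HasDerivAt (fun s : ℝ => (conj (w z₀) * w (z₀ * Complex.exp (s * Complex.I))).re)
      (A * Complex.I).re 0 := by
    have he : HasDerivAt (fun s : ℝ => z₀ * Complex.exp (s * Complex.I)) (z₀ * Complex.I) 0 := by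
      have h := hasDerivAt_comp_ray (g := Complex.exp) (b := Complex.I) (t := 0)
        (Complex.hasDerivAt_exp _)
      simpa using h.const_mul z₀
    have hd' : HasDerivAt w (deriv w z₀) (z₀ * Complex.exp ((0 : ℝ) * Complex.I)) := by
      simpa using hd.hasDerivAt
    have := hasDerivAt_re ((hd'.comp (0 : ℝ) he).const_mul (conj (w z₀)))
    have e : A * Complex.I = conj (w z₀) * (deriv w z₀ * (z₀ * Complex.I)) := by rw [hA]; ring
    rw [e]
    exact this
  have hmax : IsLocalMax
      (fun s : ℝ => (conj (w z₀) * w (z₀ * Complex.exp (s * Complex.I))).re) 0 := by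
    refine Eventually.of_forall fun s => ?_
    have h2 : ‖w (z₀ * Complex.exp (s * Complex.I))‖ ≤ 1 :=
      hle _ (by rw [norm_mul, Complex.norm_exp_ofReal_mul_I, mul_one])
    have h3 := hnorm (w (z₀ * Complex.exp (s * Complex.I)))
    simp only [Complex.ofReal_zero, zero_mul, Complex.exp_zero, mul_one, hw1, Complex.one_re]
    linarith
  have hAim : A.im = 0 := by
    have := hmax.hasDerivAt_eq_zero htan
    simpa using this
  refine ⟨A.re, hAre, ?_⟩
  rw [hAw]
  congr 1
  exact Complex.ext (by simp) (by simp [hAim])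

/-- If `p` is not subordinate to `g` then the image under `p` of some disk touches the boundary of
the image under `g` of the unit disk, and there Jack's lemma holds. -/
theorem exists_schwarz_of_no_contact {g p : ℂ → ℂ} (hg : Differentiable ℂ g)
    (hg' : ∀ z ∈ closedBall (0 : ℂ) 1, 0 < (deriv g z).re)
    (hp : DifferentiableOn ℂ p (ball 0 1)) (h0 : p 0 = g 0)
    (hno : ∀ (z₀ ζ₀ : ℂ) (m : ℝ), ‖z₀‖ < 1 → ‖ζ₀‖ = 1 → 1 ≤ m → p z₀ = g ζ₀ →
      z₀ * deriv p z₀ = m * (ζ₀ * deriv g ζ₀) → False) :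
    ∃ w : ℂ → ℂ, DifferentiableOn ℂ w (ball 0 1) ∧ w 0 = 0 ∧
      (∀ z ∈ ball (0 : ℂ) 1, ‖w z‖ < 1) ∧ ∀ z ∈ ball (0 : ℂ) 1, p z = g (w z) := by
  have hcont : Continuous (deriv g) := (hg.contDiff (n := 1)).continuous_deriv le_rfl
  -- A disk of radius R > 1 is needed so that the inverse of g is differentiable also at the
  -- boundary values g ζ₀ with |ζ₀| = 1.
  obtain ⟨R, hR, hRU⟩ := exists_one_lt_ball_subset
    (U := {z | 0 < (deriv g z).re})
    (isOpen_lt continuous_const (Complex.continuous_re.comp hcont)) hg'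
  have hsub : closedBall (0 : ℂ) 1 ⊆ ball 0 R := closedBall_subset_ball hR
  have hinj : InjOn g (ball 0 R) := injOn_of_deriv_re_pos (convex_ball 0 R)
    (fun z _ => (hg z).hasDerivAt) (fun z hz => hRU hz)
  obtain ⟨γ, hγ, hγ'⟩ := exists_hasDerivAt_inverse isOpen_ball hg.differentiableOn hinj
    (fun z hz h => by have := hRU hz; simp [h] at this)
  -- where `p` takes values in `g '' closedBall 0 1`, the composite `γ ∘ p` is differentiable
  have hw : ∀ z ∈ ball (0 : ℂ) 1, ∀ ζ ∈ closedBall (0 : ℂ) 1, p z = g ζ →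
      γ (p z) = ζ ∧ HasDerivAt (fun z => γ (p z)) ((deriv g ζ)⁻¹ * deriv p z) z := by
    intro z hz ζ hζ h
    refine ⟨by rw [h, hγ ζ (hsub hζ)], ?_⟩
    have h1 := hγ' ζ (hsub hζ)
    rw [← h] at h1
    exact h1.comp z (hp.differentiableAt (isOpen_ball.mem_nhds hz)).hasDerivAt
  have hγ0 : γ (p 0) = 0 := by rw [h0, hγ 0 (hsub (by simp))]
  by_cases hall : ∀ z ∈ ball (0 : ℂ) 1, p z ∈ g '' ball 0 1
  · refine ⟨fun z => γ (p z), fun z hz => ?_, hγ0, fun z hz => ?_, fun z hz => ?_⟩ <;>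
    obtain ⟨ζ, hζ, h⟩ := hall z hz <;>
    obtain ⟨h1, h2⟩ := hw z hz ζ (ball_subset_closedBall hζ) h.symm
    · exact h2.differentiableAt.differentiableWithinAt
    · simpa [h1] using hζ
    · simp [h1, h]
  exfalso
  push Not at hall
  obtain ⟨z₂, hz₂, hz₂p⟩ := hall
  have hopen : IsOpen (g '' ball 0 1) := by
    rw [isOpen_iff_mem_nhds]
    rintro _ ⟨ζ, hζ, rfl⟩
    have hne : deriv g ζ ≠ 0 := fun h => by
      have := hg' ζ (ball_subset_closedBall hζ); simp [h] at this
    have := (hg.analyticAt ζ).hasStrictDerivAt.map_nhds_eq hne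
    rw [← this]
    exact image_mem_map (isOpen_ball.mem_nhds hζ)
  have hb2 : ‖z₂‖ < 1 := by simpa using hz₂
  have hcb : closedBall (0 : ℂ) ‖z₂‖ ⊆ ball 0 1 := closedBall_subset_ball hb2
  -- First contact: z₀ is a point of least modulus at which p leaves the open set g(𝔻). On |z| <
  -- |z₀| the function γ ∘ p is then a map into the unit disk, and it has modulus 1 at z₀.
  have hcpt : IsCompact (closedBall (0 : ℂ) ‖z₂‖ ∩ p ⁻¹' (g '' ball 0 1)ᶜ) :=
    (isCompact_closedBall _ _).of_isClosed_subset
      ((hp.continuousOn.mono hcb).preimage_isClosed_of_isClosed isClosed_closedBall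
        hopen.isClosed_compl) inter_subset_left
  obtain ⟨z₀, ⟨hz₀, hz₀p⟩, hmin⟩ := hcpt.exists_isMinOn ⟨z₂, by simp, hz₂p⟩
    continuous_norm.continuousOn
  have hz₀1 : ‖z₀‖ < 1 := by simpa using hcb hz₀
  have hin : ∀ z ∈ ball (0 : ℂ) ‖z₀‖, p z ∈ g '' ball 0 1 := by
    intro z hz
    by_contra hcon
    have hz' : ‖z‖ < ‖z₀‖ := by simpa using hz
    have hz0' : ‖z₀‖ ≤ ‖z₂‖ := by simpa using hz₀
    have : ‖z₀‖ ≤ ‖z‖ := hmin ⟨by simpa using hz'.le.trans hz0', hcon⟩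
    linarith
  have hz₀0 : z₀ ≠ 0 := by
    rintro rfl
    exact hz₀p ⟨0, by simp, h0.symm⟩
  have hbb : ball (0 : ℂ) ‖z₀‖ ⊆ ball 0 1 := ball_subset_ball hz₀1.le
  have hin' : ∀ z, ‖z‖ = ‖z₀‖ → p z ∈ g '' closedBall 0 1 := by
    intro z hz
    have hcl : IsClosed (g '' closedBall 0 1) :=
      ((isCompact_closedBall (0 : ℂ) 1).image hg.continuous).isClosed
    have hzc : z ∈ closure (ball (0 : ℂ) ‖z₀‖) := by
      rw [closure_ball _ (norm_ne_zero_iff.2 hz₀0)]; simp [hz]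
    have hpc : ContinuousAt p z :=
      (hp.differentiableAt (isOpen_ball.mem_nhds (by simpa [hz] using hz₀1))).continuousAt
    have := hpc.continuousWithinAt.mem_closure_image (s := ball (0 : ℂ) ‖z₀‖) hzc
    refine closure_minimal ?_ hcl this
    rintro _ ⟨y, hy, rfl⟩
    exact image_mono ball_subset_closedBall (hin y hy)
  obtain ⟨ζ₀, hζ₀, hpζ⟩ := hin' z₀ rfl
  have hζ₀1 : ‖ζ₀‖ = 1 := by
    have h1 : ‖ζ₀‖ ≤ 1 := by simpa using hζ₀
    refine h1.antisymm (not_lt.1 fun h => hz₀p ⟨ζ₀, by simpa using h, hpζ⟩)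
  obtain ⟨hγζ, hγd⟩ := hw z₀ (by simpa using hz₀1) ζ₀ hζ₀ hpζ.symm
  have hγn : ∀ z ∈ ball (0 : ℂ) 1, p z ∈ g '' closedBall 0 1 → ‖γ (p z)‖ ≤ 1 := by
    rintro z hz ⟨ζ, hζ, h⟩
    rw [(hw z hz ζ hζ h.symm).1]
    simpa using hζ
  obtain ⟨m, hm, hmz⟩ := one_le_of_schwarz_contact (w := fun z => γ (p z)) hz₀0
    (fun z hz => by
      obtain ⟨ζ, hζ, h⟩ := hin z hz
      exact (hw z (hbb hz) ζ (ball_subset_closedBall hζ) h.symm).2.differentiableAt.differentiableWithinAt)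
    hγ0 (fun z hz => hγn z (hbb hz) (image_mono ball_subset_closedBall (hin z hz)))
    (fun z hz => hγn z (by simpa [hz] using hz₀1) (hin' z hz))
    hγd.differentiableAt (by simp only [hγζ]; exact hζ₀1)
  refine hno z₀ ζ₀ m hz₀1 hζ₀1 hm hpζ.symm ?_
  have hne : deriv g ζ₀ ≠ 0 := fun h => by
    have := hg' ζ₀ hζ₀; simp [h] at this
  simp only [hγd.deriv, hγζ] at hmz
  field_simp at hmz
  linear_combination hmz

/-! ### Starlikeness -/

/-- A function with `Re (z g'/g) > 0` on the closed disk maps closed disks about `0` onto sets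
that are starlike about `0`. -/
theorem exists_mul_eq_of_starlike {g : ℂ → ℂ} (hg : ∀ z ∈ closedBall (0 : ℂ) 1, AnalyticAt ℂ g z)
    (hstar : ∀ z ∈ closedBall (0 : ℂ) 1, z ≠ 0 → 0 < (z * deriv g z / g z).re)
    (h0 : g 0 = 0) {z₁ : ℂ} (hz₁ : ‖z₁‖ ≤ 1) {c : ℝ} (hc : c ∈ Icc (0 : ℝ) 1) :
    ∃ ζ : ℂ, ‖ζ‖ ≤ ‖z₁‖ ∧ g ζ = c * g z₁ := by
  rcases eq_or_ne (g z₁) 0 with hg1 | hg1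
  · exact ⟨z₁, le_rfl, by simp [hg1]⟩
  have hsub : closedBall (0 : ℂ) ‖z₁‖ ⊆ closedBall 0 1 := closedBall_subset_closedBall hz₁
  have hgc : ContinuousOn g (closedBall (0 : ℂ) ‖z₁‖) := fun z hz =>
    (hg z (hsub hz)).continuousAt.continuousWithinAt
  set s : Set ℝ := {c | (c : ℂ) * g z₁ ∈ g '' closedBall 0 ‖z₁‖} with hs
  have hscl : IsClosed s :=
    (((isCompact_closedBall (0 : ℂ) ‖z₁‖).image_of_continuousOn hgc).isClosed).preimage
      (by fun_prop)
  have hmain : Icc (0 : ℝ) 1 ⊆ s := by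
    -- Descent from c = 1: the set of admissible c is closed, so it suffices to move a little to the
    -- left of each of its positive points x.
    apply IsClosed.Icc_subset_of_forall_exists_lt (hscl.inter isClosed_Icc)
    · exact ⟨z₁, by simp, by simp⟩
    rintro x ⟨⟨ζ, hζ, hζx⟩, hx0, hx1⟩ y hy
    have hζ0 : ζ ≠ 0 := by
      rintro rfl
      rw [h0] at hζx
      exact hg1 ((mul_eq_zero.1 hζx.symm).resolve_left (by exact_mod_cast hx0.ne'))
    have hst := hstar ζ (hsub hζ) hζ0
    have hgd : deriv g ζ ≠ 0 := fun h => by simp [h] at hst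
    have hsd := (hg ζ (hsub hζ)).hasStrictDerivAt
    have h1 := (hsd.to_localInverse hgd).hasDerivAt
    have h3 : hsd.localInverse g _ ζ hgd (g ζ) = ζ :=
      (hsd.eventually_left_inverse hgd).self_of_nhds
    have h4 := hsd.eventually_right_inverse hgd
    set δ := hsd.localInverse g _ ζ hgd with hδ
    rw [hζx] at h1 h3 h4
    have h5 := hasDerivAt_comp_ray h1
    -- The derivative of the squared modulus of the preimage is (2/x)|ζ|² Re(g/(ζg')), which is
    -- positive by starlikeness. As t decreases the preimage moves inwards and stays in the disk.
    have hsq : HasDerivAt (fun t : ℝ => ‖δ (t * g z₁)‖ ^ 2)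
        (2 * (conj ζ * ((deriv g ζ)⁻¹ * g z₁)).re) x := by
      have := h5.norm_sq
      convert this using 1
      rw [h3, Complex.inner]
      simp only [Complex.mul_re, Complex.conj_re, Complex.conj_im]; ring
    have hpos : 0 < 2 * (conj ζ * ((deriv g ζ)⁻¹ * g z₁)).re := by
      have hgz : g z₁ = (x : ℂ)⁻¹ * g ζ := by
        rw [hζx]; field_simp [(by exact_mod_cast hx0.ne' : (x : ℂ) ≠ 0)]
      have hgζ : g ζ ≠ 0 := fun h => by simp [h] at hst
      have e : conj ζ * ((deriv g ζ)⁻¹ * g z₁) =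
          ((x⁻¹ * Complex.normSq ζ : ℝ) : ℂ) * (ζ * deriv g ζ / g ζ)⁻¹ := by
        rw [hgz]; push_cast; rw [← Complex.mul_conj]; field_simp
      rw [e, Complex.re_ofReal_mul]
      have : 0 < ((ζ * deriv g ζ / g ζ)⁻¹).re := by
        rw [Complex.inv_re]
        exact div_pos hst (Complex.normSq_pos.2 fun h => by simp [h] at hst)
      have := Complex.normSq_pos.2 hζ0
      positivity
    have hslope : ∀ᶠ t in 𝓝[<] x, 0 < slope (fun t : ℝ => ‖δ (t * g z₁)‖ ^ 2) x t := by
      have := (hasDerivAt_iff_tendsto_slope.1 hsq).mono_left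
        (nhdsWithin_mono x (fun t (ht : t < x) => ht.ne))
      exact this.eventually (lt_mem_nhds hpos)
    have h6 : ∀ᶠ t : ℝ in 𝓝[<] x, g (δ (t * g z₁)) = t * g z₁ := by
      have hcm : ContinuousAt (fun t : ℝ => (t : ℂ) * g z₁) x := by fun_prop
      exact (hcm.eventually h4).filter_mono nhdsWithin_le_nhds
    have h7 : Ico y x ∈ 𝓝[<] x := Ico_mem_nhdsLT hy
    obtain ⟨t, ⟨hsl, hgt⟩, htm⟩ := ((hslope.and h6).and h7).exists
    refine ⟨t, ⟨δ (t * g z₁), ?_, hgt⟩, htm⟩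
    rw [slope_def_field] at hsl
    have hneg : t - x < 0 := by linarith [htm.2]
    have h8 : ‖δ (t * g z₁)‖ ^ 2 - ‖δ (x * g z₁)‖ ^ 2 < 0 := by
      by_contra hcon
      have := div_nonpos_of_nonneg_of_nonpos (not_lt.1 hcon) hneg.le
      linarith
    rw [h3] at h8
    have h9 : ‖δ (t * g z₁)‖ ≤ ‖ζ‖ := by
      refine (sq_le_sq₀ (norm_nonneg _) (norm_nonneg _)).1 ?_
      linarith
    exact mem_closedBall_zero_iff.2 (h9.trans (by simpa using hζ))
  obtain ⟨ζ, hζ, h⟩ := hmain hc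
  exact ⟨ζ, by simpa using hζ, h⟩

/-! ### The equality case of the Schwarz lemma -/

theorem eq_mul_of_schwarz_norm_eq {w : ℂ → ℂ} (hw : DifferentiableOn ℂ w (ball 0 1))
    (h0 : w 0 = 0) (hlt : ∀ z ∈ ball (0 : ℂ) 1, ‖w z‖ < 1) {z₀ : ℂ} (hz₀ : z₀ ≠ 0)
    (hz₁ : ‖z₀‖ < 1) (heq : ‖w z₀‖ = ‖z₀‖) :
    ∃ x : ℂ, ‖x‖ = 1 ∧ ∀ z ∈ ball (0 : ℂ) 1, w z = x * z := by
  have hds : ‖dslope w 0 z₀‖ = 1 := by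
    rw [dslope_of_ne _ hz₀, slope_def_field, h0, sub_zero, sub_zero, norm_div, heq,
      div_self (norm_ne_zero_iff.2 hz₀)]
  have := Complex.affine_of_mapsTo_ball_of_norm_dslope_eq_div (R₁ := 1) (R₂ := 1) hw
    (fun y hy => by simpa [h0] using (hlt y hy).le) (z₀ := z₀) (by simpa using hz₁) (by simpa using hds)
  refine ⟨dslope w 0 z₀, hds, fun z hz => ?_⟩
  have h2 := this hz
  simp [h0] at h2
  rw [h2, mul_comm]

/-! ### The extremal function -/

/-- The logarithm of `neHat'`. -/
noncomputable def neExp (z : ℂ) : ℂ := z - z ^ 3 / 9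

/-- `neHat z / z` as an entire function. -/
noncomputable def neK : ℂ → ℂ := dslope neHat 0

/-- `neHat z / (z * neHat' z)` as an entire function. -/
noncomputable def neB (z : ℂ) : ℂ := neK z * Complex.exp (-neExp z)

theorem neHat_zero : neHat 0 = 0 := by simp [neHat]

theorem neExp_zero : neExp 0 = 0 := by simp [neExp]

theorem deriv_neHat (z : ℂ) : deriv neHat z = Complex.exp (neExp z) := (hasDerivAt_neHat z).deriv

theorem differentiable_neHat : Differentiable ℂ neHat :=
  fun z => (hasDerivAt_neHat z).differentiableAt

theorem hasDerivAt_neExp (z : ℂ) : HasDerivAt neExp (1 - z ^ 2 / 3) z := by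
  have := (hasDerivAt_id' z).sub (((hasDerivAt_id' z).pow 3).div_const 9)
  exact this.congr_deriv (by push_cast; ring)

theorem differentiable_neExp : Differentiable ℂ neExp :=
  fun z => (hasDerivAt_neExp z).differentiableAt

theorem neExp_ofReal (x : ℝ) : neExp x = ((x - x ^ 3 / 9 : ℝ) : ℂ) := by
  simp [neExp]

theorem norm_neExp_le {z : ℂ} (hz : ‖z‖ ≤ 1) : ‖neExp z‖ ≤ 10 / 9 := by
  have h3 : ‖z‖ ^ 3 ≤ 1 := pow_le_one₀ (norm_nonneg _) hz
  calc ‖neExp z‖ ≤ ‖z‖ + ‖z ^ 3 / 9‖ := norm_sub_le _ _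
    _ = ‖z‖ + ‖z‖ ^ 3 / 9 := by simp
    _ ≤ 10 / 9 := by linarith

theorem third_lt_cos_of_abs_le {θ : ℝ} (h : |θ| ≤ 10 / 9) : 1 / 3 < Real.cos θ := by
  have := Real.one_sub_sq_div_two_le_cos (x := θ)
  have h2 : θ ^ 2 ≤ (10 / 9) ^ 2 := sq_le_sq' (by linarith [(abs_le.1 h).1]) (abs_le.1 h).2
  linarith

theorem exp_neExp_re_pos {z : ℂ} (hz : ‖z‖ ≤ 1) : 0 < (Complex.exp (neExp z)).re := by
  rw [Complex.exp_re]
  have := third_lt_cos_of_abs_le ((Complex.abs_im_le_norm _).trans (norm_neExp_le hz))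
  have := Real.exp_pos (neExp z).re
  positivity

/-- After exp(Re E) is factored out, what remains is at least cos(Im E) - |z²/3|. The cosine exceeds
1/3 because |E| ≤ 10/9. -/
theorem deriv_neExp_mul_exp_re_pos {z : ℂ} (hz : ‖z‖ ≤ 1) :
    0 < ((1 - z ^ 2 / 3) * Complex.exp (neExp z)).re := by
  have hcos := third_lt_cos_of_abs_le ((Complex.abs_im_le_norm _).trans (norm_neExp_le hz))
  have he : Complex.exp (neExp z) =
      (Real.exp (neExp z).re : ℂ) * Complex.exp ((neExp z).im * Complex.I) := by
    rw [Complex.ofReal_exp, ← Complex.exp_add, Complex.re_add_im]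
  rw [he, mul_left_comm, Complex.re_ofReal_mul, sub_mul, one_mul, Complex.sub_re,
    Complex.exp_ofReal_mul_I_re]
  have h1 : (z ^ 2 / 3 * Complex.exp ((neExp z).im * Complex.I)).re ≤ 1 / 3 := by
    refine (Complex.re_le_norm _).trans ?_
    rw [norm_mul, Complex.norm_exp_ofReal_mul_I, mul_one, norm_div, norm_pow]
    have : ‖z‖ ^ 2 ≤ 1 := pow_le_one₀ (norm_nonneg _) hz
    simp; linarith
  have := Real.exp_pos (neExp z).re
  exact mul_pos this (by linarith)

theorem differentiable_neK : Differentiable ℂ neK := by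
  rw [← differentiableOn_univ]
  exact (Complex.differentiableOn_dslope univ_mem).2 differentiable_neHat.differentiableOn

theorem neK_zero : neK 0 = 1 := by
  rw [neK, dslope_same, deriv_neHat, neExp_zero, Complex.exp_zero]

theorem mul_neK (z : ℂ) : z * neK z = neHat z := by
  have := sub_smul_dslope neHat 0 z
  rwa [neHat_zero, sub_zero, sub_zero, smul_eq_mul] at this

theorem mul_deriv_neK (z : ℂ) : z * deriv neK z = Complex.exp (neExp z) - neK z := by
  have h1 : HasDerivAt (fun z => z * neK z) (1 * neK z + z * deriv neK z) z :=
    (hasDerivAt_id' z).mul (differentiable_neK z).hasDerivAt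
  have h2 : (fun z => z * neK z) = neHat := funext mul_neK
  rw [h2] at h1
  have := h1.unique (hasDerivAt_neHat z)
  rw [neExp]
  linear_combination this

theorem norm_ofReal_mul_le {z : ℂ} {t : ℝ} (hz : ‖z‖ ≤ 1) (ht : t ∈ Icc (0 : ℝ) 1) :
    ‖(t : ℂ) * z‖ ≤ 1 := by
  rw [norm_mul, Complex.norm_real, Real.norm_eq_abs, abs_of_nonneg ht.1]
  exact mul_le_one₀ ht.2 (norm_nonneg _) hz

/-- K(z) is the integral of exp(E(tz)) over 0 ≤ t ≤ 1, with primitive t K(tz). -/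
theorem neK_re_pos {z : ℂ} (hz : ‖z‖ ≤ 1) : 0 < (neK z).re := by
  have := re_lt_re_of_deriv_re_pos (F := fun t : ℝ => t * neK (t * z))
    (F' := fun t => Complex.exp (neExp (t * z)))
    (fun t _ => by
      have := (Complex.ofRealCLM.hasDerivAt (x := t)).mul
        (hasDerivAt_comp_ray (b := z) (differentiable_neK (t * z)).hasDerivAt)
      refine this.congr_deriv ?_
      rw [Complex.ofRealCLM_apply, Complex.ofReal_one, Complex.ofRealCLM_apply]
      linear_combination mul_deriv_neK (t * z))
    (fun t ht => exp_neExp_re_pos (norm_ofReal_mul_le hz (Ioo_subset_Icc_self ht)))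
  simpa using this

theorem neK_ne_zero {z : ℂ} (hz : ‖z‖ ≤ 1) : neK z ≠ 0 := fun h => by
  have := neK_re_pos hz; simp [h] at this

theorem hasDerivAt_mul_deriv_neK (z : ℂ) :
    HasDerivAt (fun z => z ^ 2 * deriv neK z) (z * (1 - z ^ 2 / 3) * Complex.exp (neExp z)) z := by
  have h2 : (fun z => z ^ 2 * deriv neK z) = fun z => z * Complex.exp (neExp z) - neHat z := by
    funext z; rw [← mul_neK]; linear_combination z * mul_deriv_neK z
  rw [h2]
  have := ((hasDerivAt_id' z).mul (hasDerivAt_neExp z).cexp).sub (hasDerivAt_neHat z)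
  exact this.congr_deriv (by simp only [neExp]; ring)

/-- K'(z) is the integral of t(1 - (tz)²/3)exp(E(tz)) over 0 ≤ t ≤ 1, with primitive t²K'(tz). The
computation divides by z², so z = 0 is separate; there K'(0) = 1/2. -/
theorem deriv_neK_re_pos {z : ℂ} (hz : ‖z‖ ≤ 1) : 0 < (deriv neK z).re := by
  rcases eq_or_ne z 0 with rfl | hz0
  · have h := (hasDerivAt_mul_deriv_neK 0)
    have hk : HasDerivAt (fun z => z * deriv neK z) (deriv neK 0) 0 := by
      have hd : Differentiable ℂ (deriv neK) := by
        rw [← differentiableOn_univ]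
        exact differentiable_neK.differentiableOn.deriv isOpen_univ
      exact ((hasDerivAt_id' (0 : ℂ)).mul (hd 0).hasDerivAt).congr_deriv (by ring)
    have hk' : HasDerivAt (fun z => z * deriv neK z)
        ((1 - 0 ^ 2 / 3) * Complex.exp (neExp 0) - deriv neK 0) 0 := by
      have e : (fun z => z * deriv neK z) = fun z => Complex.exp (neExp z) - neK z :=
        funext mul_deriv_neK
      rw [e]
      have := (hasDerivAt_neExp 0).cexp.sub (differentiable_neK 0).hasDerivAt
      exact this.congr_deriv (by ring)
    have h2 : deriv neK 0 = ((1 / 2 : ℝ) : ℂ) := by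
      have := hk.unique hk'
      simp [neExp_zero] at this
      push_cast
      linear_combination this / 2
    rw [h2, Complex.ofReal_re]; norm_num
  have := re_lt_re_of_deriv_re_pos (F := fun t : ℝ => (t : ℂ) ^ 2 * deriv neK (t * z))
    (F' := fun t => (t : ℂ) * ((1 - (t * z) ^ 2 / 3) * Complex.exp (neExp (t * z))))
    (fun t _ => by
      have := ((hasDerivAt_comp_ray (b := z) (hasDerivAt_mul_deriv_neK (t * z)))).div_const (z ^ 2)
      have e : (fun s : ℝ => (s : ℂ) ^ 2 * deriv neK (s * z)) =
          fun s : ℝ => ((s : ℂ) * z) ^ 2 * deriv neK (s * z) / z ^ 2 := by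
        funext s; field_simp
      rw [e]
      exact this.congr_deriv (by field_simp))
    (fun t ht => by
      rw [Complex.re_ofReal_mul]
      exact mul_pos ht.1 (deriv_neExp_mul_exp_re_pos
        (norm_ofReal_mul_le hz (Ioo_subset_Icc_self ht))))
  simpa using this

theorem neK_ofReal_im (x : ℝ) : (neK x).im = 0 := by
  rcases eq_or_ne x 0 with rfl | hx
  · simp [neK_zero]
  have h := congrArg Complex.im (mul_neK x)
  rw [neHat_ofReal_im, Complex.im_ofReal_mul] at h
  exact (mul_eq_zero.1 h).resolve_left hx

theorem differentiable_neB : Differentiable ℂ neB :=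
  differentiable_neK.mul differentiable_neExp.neg.cexp

theorem neB_zero : neB 0 = 1 := by simp [neB, neK_zero, neExp_zero]

theorem neB_ne_zero {z : ℂ} (hz : ‖z‖ ≤ 1) : neB z ≠ 0 :=
  mul_ne_zero (neK_ne_zero hz) (Complex.exp_ne_zero _)

/-- This equation is the link to the class: f/(zf') satisfies it with 1 + zf''/f' in place of φ. It
also controls the Taylor polynomial, which satisfies it up to `neRes`. -/
theorem mul_deriv_neB (z : ℂ) : z * deriv neB z = 1 - phiNe z * neB z := by
  have h : HasDerivAt neB (deriv neK z * Complex.exp (-neExp z) +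
      neK z * (Complex.exp (-neExp z) * -(1 - z ^ 2 / 3))) z :=
    (differentiable_neK z).hasDerivAt.mul (hasDerivAt_neExp z).neg.cexp
  have he : Complex.exp (neExp z) * Complex.exp (-neExp z) = 1 := by
    rw [← Complex.exp_add]; simp
  rw [h.deriv, phiNe, neB]
  linear_combination Complex.exp (-neExp z) * mul_deriv_neK z + he

theorem neB_ofReal_im (x : ℝ) : (neB x).im = 0 := by
  rw [neB, neExp_ofReal, ← Complex.ofReal_neg, ← Complex.ofReal_exp, Complex.im_mul_ofReal,
    neK_ofReal_im, zero_mul]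

/-! ### Polynomial approximation of `neB` -/

/-- The Taylor polynomial of `neB` of degree nine. -/
noncomputable def neBPoly (z : ℂ) : ℂ :=
  1 - 1 / 2 * z + 1 / 6 * z ^ 2 + 1 / 24 * z ^ 3 - 1 / 24 * z ^ 4 + 7 / 432 * z ^ 5
    - 1 / 3024 * z ^ 6 - 41 / 24192 * z ^ 7 + 515 / 653184 * z ^ 8 - 587 / 6531840 * z ^ 9

/-- The derivative of `neBPoly`. -/
noncomputable def neBPoly' (z : ℂ) : ℂ :=
  - 1 / 2 + 1 / 3 * z + 1 / 8 * z ^ 2 - 1 / 6 * z ^ 3 + 35 / 432 * z ^ 4 - 1 / 504 * z ^ 5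
    - 41 / 3456 * z ^ 6 + 515 / 81648 * z ^ 7 - 587 / 725760 * z ^ 8

/-- The residual of `neBPoly` in the differential equation of `neB`. -/
noncomputable def neRes (z : ℂ) : ℂ :=
  z ^ 10 * (3103 / 6531840 - 515 / 1959552 * z + 587 / 19595520 * z ^ 2)

theorem hasDerivAt_neBPoly (z : ℂ) : HasDerivAt neBPoly (neBPoly' z) z := by
  have h : ∀ (n : ℕ) (c : ℂ), HasDerivAt (fun z => c * z ^ n) (c * (n * z ^ (n - 1))) z :=
    fun n c => (hasDerivAt_pow n z).const_mul c
  have := (((((((((hasDerivAt_id' z).const_mul (1 / 2 : ℂ)).const_sub 1).add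
    (h 2 (1 / 6))).add (h 3 (1 / 24))).sub (h 4 (1 / 24))).add (h 5 (7 / 432))).sub
    (h 6 (1 / 3024))).sub (h 7 (41 / 24192))).add (h 8 (515 / 653184))|>.sub (h 9 (587 / 6531840))
  exact this.congr_deriv (by rw [neBPoly']; push_cast; ring)

theorem mul_neBPoly' (z : ℂ) : z * neBPoly' z = 1 - phiNe z * neBPoly z + neRes z := by
  rw [neBPoly, neBPoly', neRes, phiNe]; ring

theorem norm_neRes_le {z : ℂ} (hz : ‖z‖ ≤ 1) : ‖neRes z‖ ≤ 77 / 100000 * ‖z‖ ^ 10 := by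
  rw [neRes, norm_mul, norm_pow, mul_comm]
  gcongr
  have h2 : ‖z‖ ^ 2 ≤ 1 := pow_le_one₀ (norm_nonneg _) hz
  refine (norm_add_le _ _).trans ?_
  grw [norm_sub_le]
  simp only [norm_mul, norm_pow, norm_div, RCLike.norm_ofNat]
  linarith

theorem exp_ten_ninths_le : Real.exp (10 / 9) ≤ 31 / 10 := by
  have h1 := Real.exp_one_lt_d9
  have h2 := Real.one_sub_le_exp_neg (1 / 9)
  have h3 : Real.exp (1 / 9) * Real.exp (-(1 / 9)) = 1 := by rw [← Real.exp_add]; simp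
  have h4 : Real.exp (10 / 9) = Real.exp 1 * Real.exp (1 / 9) := by
    rw [← Real.exp_add]; norm_num
  have h5 := Real.exp_pos (1 / 9)
  have h6 : Real.exp (1 / 9) ≤ 9 / 8 := by nlinarith
  rw [h4]
  nlinarith [Real.exp_pos 1]

theorem norm_exp_neExp_sub_le {z : ℂ} (hz : ‖z‖ ≤ 1) {t : ℝ} (ht : t ∈ Icc (0 : ℝ) 1) :
    ‖Complex.exp (neExp (t * z) - neExp z)‖ ≤ 31 / 10 := by
  rw [Complex.norm_exp]
  refine (Real.exp_le_exp.2 ?_).trans exp_ten_ninths_le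
  refine (Complex.re_le_norm _).trans ?_
  have e : neExp (t * z) - neExp z = ((1 - t : ℝ) : ℂ) * -z + ((1 - t ^ 3 : ℝ) : ℂ) * (z ^ 3 / 9) := by
    rw [neExp, neExp]; push_cast; ring
  have h3 : ‖z‖ ^ 3 ≤ 1 := pow_le_one₀ (norm_nonneg _) hz
  have ht3 : t ^ 3 ≤ 1 := pow_le_one₀ ht.1 ht.2
  have ht3' : 0 ≤ t ^ 3 := pow_nonneg ht.1 3
  rw [e]
  refine (norm_add_le _ _).trans ?_
  simp only [norm_mul, Complex.norm_real, Real.norm_eq_abs, norm_neg, norm_div, norm_pow,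
    RCLike.norm_ofNat]
  rw [abs_of_nonneg (by linarith [ht.2]), abs_of_nonneg (by linarith)]
  nlinarith [ht.1, ht.2, norm_nonneg z, pow_nonneg (norm_nonneg z) 3]

/-- An integrating factor: D = B - `neBPoly` satisfies zD' = -φD - `neRes`, and zE' = φ - 1, so s
D(sz) exp(E(sz) - E(z)) has derivative -`neRes`(sz) exp(E(sz) - E(z)). Integrating the bound 3.1 ·
0.00077 t¹⁰ gives less than 0.00022. -/
theorem norm_neB_sub_neBPoly_le {z : ℂ} (hz : ‖z‖ ≤ 1) : ‖neB z - neBPoly z‖ ≤ 1 / 4000 := by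
  have hder : ∀ t : ℝ, HasDerivAt
      (fun s : ℝ => (s : ℂ) * (neB (s * z) - neBPoly (s * z)) *
        Complex.exp (neExp (s * z) - neExp z))
      (-neRes (t * z) * Complex.exp (neExp (t * z) - neExp z)) t := by
    intro t
    have hB := hasDerivAt_comp_ray (b := z) (differentiable_neB (t * z)).hasDerivAt
    have hP := hasDerivAt_comp_ray (b := z) (hasDerivAt_neBPoly (t * z))
    have hN := hasDerivAt_comp_ray (b := z) (hasDerivAt_neExp (t * z))
    have h := ((Complex.ofRealCLM.hasDerivAt (x := t)).mul (hB.sub hP)).mul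
      (hN.sub_const (neExp z)).cexp
    refine h.congr_deriv ?_
    simp only [Complex.ofRealCLM_apply, Complex.ofReal_one, Pi.mul_apply, Pi.sub_apply]
    have h1 := mul_deriv_neB (t * z)
    have h2 := mul_neBPoly' (t * z)
    rw [phiNe] at h1 h2
    linear_combination Complex.exp (neExp (t * z) - neExp z) * (h1 - h2)
  have := image_norm_le_of_norm_deriv_right_le_deriv_boundary (a := 0) (b := 1)
    (B := fun t => 31 / 10 * (77 / 100000) * (t ^ 11 / 11))
    (B' := fun t => 31 / 10 * (77 / 100000) * t ^ 10)
    (fun t _ => (hder t).continuousAt.continuousWithinAt)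
    (fun t _ => (hder t).hasDerivWithinAt) (by simp)
    (fun t => (((hasDerivAt_pow 11 t).div_const 11).const_mul _).congr_deriv (by norm_num))
    (fun t ht => by
      have ht' := Ico_subset_Icc_self ht
      have hz10 : ‖z‖ ^ 10 ≤ 1 := pow_le_one₀ (norm_nonneg _) hz
      have h1 : ‖neRes (t * z)‖ ≤ 77 / 100000 * t ^ 10 := by
        refine (norm_neRes_le (norm_ofReal_mul_le hz ht')).trans ?_
        rw [norm_mul, Complex.norm_real, Real.norm_eq_abs, abs_of_nonneg ht.1, mul_pow]
        have := pow_nonneg ht.1 10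
        nlinarith
      rw [norm_mul, norm_neg]
      have := mul_le_mul h1 (norm_exp_neExp_sub_le hz ht') (norm_nonneg _) (by
        have := pow_nonneg ht.1 10; positivity)
      linarith) (right_mem_Icc.2 zero_le_one)
  simp at this
  linarith

/-- On the unit circle the factor z in the differential equation has modulus 1, so the bound for the
difference passes to its derivative; the maximum principle extends it to the disk. -/
theorem norm_deriv_neB_sub_le {z : ℂ} (hz : ‖z‖ ≤ 1) :
    ‖deriv neB z - neBPoly' z‖ ≤ 7 / 5000 := by
  have hcl : DiffContOnCl ℂ (fun z => deriv neB z - neBPoly' z) (ball 0 1) := by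
    apply DifferentiableOn.diffContOnCl
    refine DifferentiableOn.sub
      ((differentiable_neB.differentiableOn.deriv isOpen_univ).mono (subset_univ _)) ?_
    unfold neBPoly'
    fun_prop
  refine Complex.norm_le_of_forall_mem_frontier_norm_le isBounded_ball hcl (fun y hy => ?_)
    (by rwa [closure_ball _ one_ne_zero, mem_closedBall_zero_iff])
  rw [frontier_ball _ one_ne_zero, mem_sphere_zero_iff_norm] at hy
  have e : y * (deriv neB y - neBPoly' y) = -(phiNe y * (neB y - neBPoly y) + neRes y) := by
    linear_combination mul_deriv_neB y - mul_neBPoly' y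
  have h1 : ‖phiNe y‖ ≤ 7 / 3 := by
    rw [phiNe]
    grw [norm_sub_le, norm_add_le]
    simp [hy]; norm_num
  have h2 := norm_neB_sub_neBPoly_le hy.le
  have h3 := norm_neRes_le hy.le
  rw [hy, one_pow] at h3
  calc ‖deriv neB y - neBPoly' y‖ = ‖y * (deriv neB y - neBPoly' y)‖ := by
        rw [norm_mul, hy, one_mul]
    _ ≤ ‖phiNe y‖ * ‖neB y - neBPoly y‖ + ‖neRes y‖ := by
        rw [e, norm_neg]
        exact (norm_add_le _ _).trans_eq (by rw [norm_mul])
    _ ≤ 7 / 3 * (1 / 4000) + 77 / 100000 * 1 := by gcongr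
    _ ≤ 7 / 5000 := by norm_num

/-- The real part of `neBPoly` on the unit circle, as a polynomial in `Re z`. -/
noncomputable def neU (x : ℝ) : ℝ :=
  517835 / 653184 - 386777 / 725760 * x + 25943 / 40824 * x ^ 2 - 13147 / 54432 * x ^ 3
    - 3905 / 20412 * x ^ 4 + 6203 / 15120 * x ^ 5 - 1084 / 5103 * x ^ 6 - 643 / 11340 * x ^ 7
    + 515 / 5103 * x ^ 8 - 587 / 25515 * x ^ 9

/-- The imaginary part of `neBPoly` on the unit circle, divided by `Im z`. -/
noncomputable def neV (x : ℝ) : ℝ :=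
  -3421757 / 6531840 + 40147 / 81648 * x - 1513 / 23328 * x ^ 2 - 10601 / 40824 * x ^ 3
    + 10159 / 27216 * x ^ 4 - 551 / 3402 * x ^ 5 - 6961 / 102060 * x ^ 6 + 515 / 5103 * x ^ 7
    - 587 / 25515 * x ^ 8

/-- Powers on the unit circle, reduced by `z ^ 2 = 2 * x * z - 1`. -/
theorem neBPoly_circle {z : ℂ} (hz : ‖z‖ = 1) :
    neBPoly z = ((neU z.re : ℝ) : ℂ) + ((neV z.re : ℝ) : ℂ) * z.im * Complex.I := by
  set x := z.re with hx
  have hzx : z = x + z.im * Complex.I := (Complex.re_add_im z).symm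
  have hn : x ^ 2 + z.im ^ 2 = 1 := by
    have := Complex.sq_norm z
    rw [hz, Complex.normSq_apply] at this
    linarith
  have h2 : z ^ 2 = 2 * x * z - 1 := by
    have : ((x ^ 2 + z.im ^ 2 : ℝ) : ℂ) = 1 := by rw [hn]; simp
    push_cast at this
    rw [hzx]
    linear_combination -this + (z.im : ℂ) ^ 2 * Complex.I_sq
  have step : ∀ {n : ℕ} {a b : ℂ}, z ^ n = a * z - b → z ^ (n + 1) = (2 * x * a - b) * z - a := by
    intro n a b h
    rw [pow_succ, h]
    linear_combination a * h2
  have h3 := step h2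
  have h4 := step h3
  have h5 := step h4
  have h6 := step h5
  have h7 := step h6
  have h8 := step h7
  have h9 := step h8
  have hI : ((neV x : ℝ) : ℂ) * z.im * Complex.I = ((neV x : ℝ) : ℂ) * (z - x) := by
    linear_combination -((neV x : ℝ) : ℂ) * hzx
  rw [hI, neBPoly, h9, h8, h7, h6, h5, h4, h3, h2, neU, neV]
  push_cast
  ring

/-- Dividing by Im z is harmless: B - `neBPoly` is real on the real axis, so the mean value
inequality on the segment from Re z to z bounds its imaginary part by a multiple of |Im z|. Where Im
z = 0 the value V is arbitrary and is taken to be `neV`. -/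
theorem exists_neB_circle {z : ℂ} (hz : ‖z‖ = 1) : ∃ U V : ℝ,
    neB z = (U : ℂ) + (V : ℂ) * z.im * Complex.I ∧ |U - neU z.re| ≤ 1 / 4000 ∧
      |V - neV z.re| ≤ 7 / 5000 := by
  have hre : (neBPoly z).re = neU z.re ∧ (neBPoly z).im = neV z.re * z.im := by
    rw [neBPoly_circle hz]; simp
  have hU : |(neB z).re - neU z.re| ≤ 1 / 4000 := by
    rw [← hre.1, ← Complex.sub_re]
    exact (Complex.abs_re_le_norm _).trans (norm_neB_sub_neBPoly_le hz.le)
  rcases eq_or_ne z.im 0 with h0 | h0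
  · refine ⟨(neB z).re, neV z.re, ?_, hU, by norm_num⟩
    have hzr : z = ((z.re : ℝ) : ℂ) := Complex.ext (by simp) (by simp [h0])
    have := neB_ofReal_im z.re
    rw [← hzr] at this
    exact Complex.ext (by simp [h0]) (by simp [h0, this])
  · refine ⟨(neB z).re, (neB z).im / z.im, ?_, hU, ?_⟩
    · exact Complex.ext (by simp) (by simp [h0])
    have hP0 : (neBPoly (z.re : ℂ)).im = 0 := by
      have : neBPoly (z.re : ℂ) = ((1 - 1 / 2 * z.re + 1 / 6 * z.re ^ 2 + 1 / 24 * z.re ^ 3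
          - 1 / 24 * z.re ^ 4 + 7 / 432 * z.re ^ 5 - 1 / 3024 * z.re ^ 6 - 41 / 24192 * z.re ^ 7
          + 515 / 653184 * z.re ^ 8 - 587 / 6531840 * z.re ^ 9 : ℝ) : ℂ) := by
        rw [neBPoly]; push_cast; rfl
      rw [this, Complex.ofReal_im]
    have hseg := (convex_closedBall (0 : ℂ) 1).norm_image_sub_le_of_norm_hasDerivWithin_le
      (f := fun z => neB z - neBPoly z) (f' := fun z => deriv neB z - neBPoly' z) (C := 7 / 5000)
      (x := (z.re : ℂ)) (y := z)
      (fun w _ => ((differentiable_neB w).hasDerivAt.sub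
        (hasDerivAt_neBPoly w)).hasDerivWithinAt)
      (fun w hw => norm_deriv_neB_sub_le (by simpa using hw))
      (by
        rw [mem_closedBall_zero_iff, Complex.norm_real, Real.norm_eq_abs]
        exact (Complex.abs_re_le_norm z).trans hz.le)
      (by simp [hz])
    have hzs : ‖z - z.re‖ = |z.im| := by
      have : z - z.re = z.im * Complex.I := by
        nth_rw 1 [← Complex.re_add_im z]; ring
      rw [this]; simp
    have him := (Complex.abs_im_le_norm _).trans hseg
    rw [hzs] at him
    simp only [Complex.sub_im, hP0, neB_ofReal_im, hre.2, sub_zero] at him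
    have e : (neB z).im / z.im - neV z.re = ((neB z).im - neV z.re * z.im) / z.im := by
      field_simp
    rw [e, abs_div, div_le_iff₀ (abs_pos.2 h0)]
    exact him

/-! ### Polynomial inequalities on the unit circle -/

/-- Method for this and the following polynomial inequalities: a and b are the distances to the ends
of the interval, a + b is constant, and the polynomial is rewritten as a form in a and b with
positive coefficients (Bernstein form), of raised degree where necessary. In the inequalities behind
`E1_pos` to `E4_pos`, a margin such as 1/50 is kept to absorb the error of the Taylor approximation.
-/
theorem neU_lower {x : ℝ} (h1 : -1 ≤ x) (h2 : x ≤ 1) :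
    0 ≤ neU x - 5 / 8 := by
  obtain ⟨a, ha⟩ : ∃ a, a = x - (-1) := ⟨_, rfl⟩
  obtain ⟨b, hb⟩ : ∃ b, b = (1) - x := ⟨_, rfl⟩
  have ha0 : 0 ≤ a := by linarith
  have hb0 : 0 ≤ b := by linarith
  have key : neU x - 5 / 8 =
      6168487 / 3344302080 * b^9 + 57491789 / 3344302080 * a * b^8
      + 8977751 / 167215104 * a^2 * b^7 + 4607339 / 119439360 * a^3 * b^6
      + 9069479 / 238878720 * a^4 * b^5 + 26547347 / 1672151040 * a^5 * b^4
      + 214121 / 119439360 * a^6 * b^3 + 106613 / 167215104 * a^7 * b^2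
      + 341231 / 3344302080 * a^8 * b + 13679 / 123863040 * a^9 := by
    simp only [ha, hb, neU]
    ring
  rw [key]
  positivity

theorem neU_upper {x : ℝ} (h1 : -1 ≤ x) (h2 : x ≤ 1) :
    0 ≤ 8 / 5 - neU x := by
  obtain ⟨a, ha⟩ : ∃ a, a = x - (-1) := ⟨_, rfl⟩
  obtain ⟨b, hb⟩ : ∃ b, b = (1) - x := ⟨_, rfl⟩
  have ha0 : 0 ≤ a := by linarith
  have hb0 : 0 ≤ b := by linarith
  have key : 8 / 5 - neU x =
      200057 / 6688604160 * b^10 + 233 / 61931520 * a * b^9 + 16512557 / 2229534720 * a^2 * b^8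
      + 1186627 / 17418240 * a^3 * b^7 + 2860889 / 17694720 * a^4 * b^6
      + 178100711 / 836075520 * a^5 * b^5 + 213050693 / 1114767360 * a^6 * b^4
      + 875113 / 7741440 * a^7 * b^3 + 94703663 / 2229534720 * a^8 * b^2
      + 15743719 / 1672151040 * a^9 * b + 222193 / 247726080 * a^10 := by
    simp only [ha, hb, neU]
    ring
  rw [key]
  positivity

theorem neV_lower {x : ℝ} (h1 : -1 ≤ x) (h2 : x ≤ 1) :
    0 ≤ neV x + 9 / 10 := by
  obtain ⟨a, ha⟩ : ∃ a, a = x - (-1) := ⟨_, rfl⟩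
  obtain ⟨b, hb⟩ : ∃ b, b = (1) - x := ⟨_, rfl⟩
  have ha0 : 0 ≤ a := by linarith
  have hb0 : 0 ≤ b := by linarith
  have key : neV x + 9 / 10 =
      394109 / 955514880 * b^10 + 1242347 / 668860416 * a * b^9
      + 2741797 / 2229534720 * a^2 * b^8 + 4023511 / 278691840 * a^3 * b^7
      + 38913671 / 668860416 * a^4 * b^6 + 4724263 / 47775744 * a^5 * b^5
      + 3175243 / 31850496 * a^6 * b^4 + 18440791 / 278691840 * a^7 * b^3
      + 62005957 / 2229534720 * a^8 * b^2 + 4496875 / 668860416 * a^9 * b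
      + 4992523 / 6688604160 * a^10 := by
    simp only [ha, hb, neV]
    ring
  rw [key]
  positivity

theorem neW_upper {x : ℝ} (h1 : -1 ≤ x) (h2 : x ≤ 1) :
    0 ≤ 27 / 10 - (neU x ^ 2 + (1 - x ^ 2) * neV x ^ 2) := by
  obtain ⟨a, ha⟩ : ∃ a, a = x - (-1) := ⟨_, rfl⟩
  obtain ⟨b, hb⟩ : ∃ b, b = (1) - x := ⟨_, rfl⟩
  have ha0 : 0 ≤ a := by linarith
  have hb0 : 0 ≤ b := by linarith
  have key : 27 / 10 - (neU x ^ 2 + (1 - x ^ 2) * neV x ^ 2) =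
      10114636934351 / 21844446098227200 * b^9 + 11597475713119 / 21844446098227200 * a * b^8
      + 145184163015119 / 5461111524556800 * a^2 * b^7
      + 1383922053117451 / 5461111524556800 * a^3 * b^6
      + 4868734633285633 / 10922223049113600 * a^4 * b^5
      + 5510428710296393 / 10922223049113600 * a^5 * b^4
      + 1978809833699411 / 5461111524556800 * a^6 * b^3
      + 866740472738599 / 5461111524556800 * a^7 * b^2
      + 881812579552679 / 21844446098227200 * a^8 * b + 130833188639 / 29964946636800 * a^9 := by
    simp only [ha, hb, neU, neV]
    ring
  rw [key]
  positivity

theorem neV_upper {x : ℝ} (h1 : -1 ≤ x) (h2 : x ≤ 1) :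
    0 ≤ -1 / 10 - neV x := by
  obtain ⟨a, ha⟩ : ∃ a, a = x - (-1) := ⟨_, rfl⟩
  obtain ⟨b, hb⟩ : ∃ b, b = (1) - x := ⟨_, rfl⟩
  have ha0 : 0 ≤ a := by linarith
  have hb0 : 0 ≤ b := by linarith
  have key : -1 / 10 - neV x =
      352387 / 238878720 * b^8 + 4362229 / 209018880 * a * b^7 + 5523517 / 59719680 * a^2 * b^6
      + 23284699 / 209018880 * a^3 * b^5 + 18099875 / 167215104 * a^4 * b^4
      + 13393379 / 209018880 * a^5 * b^3 + 1259117 / 59719680 * a^6 * b^2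
      + 121787 / 29859840 * a^7 * b + 232949 / 1672151040 * a^8 := by
    simp only [ha, hb, neV]
    ring
  rw [key]
  positivity

/-- With W = |B|², this and the next two say on which side of two tangent directions the vector φ -
1/B lies, after multiplication by W. `neE3_poly` is for the starlikeness of 1/B - 1, and `neE4_poly`
for Re B' < 0. -/
theorem neE1_poly {x : ℝ} (h1 : -1 ≤ x) (h2 : x ≤ 1) :
    0 ≤ (2 * x + 4 / 3) * (neU x ^ 2 + (1 - x ^ 2) * neV x ^ 2) - 2 * x * neU x
      - (2 * x ^ 2 - 1) * neV x - 1 / 50 := by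
  obtain ⟨a, ha⟩ : ∃ a, a = x - (-1) := ⟨_, rfl⟩
  obtain ⟨b, hb⟩ : ∃ b, b = (1) - x := ⟨_, rfl⟩
  have ha0 : 0 ≤ a := by linarith
  have hb0 : 0 ≤ b := by linarith
  have key : (2 * x + 4 / 3) * (neU x ^ 2 + (1 - x ^ 2) * neV x ^ 2) - 2 * x * neU x
      - (2 * x ^ 2 - 1) * neV x - 1 / 50 =
      125078791765583 / 32766669147340800 * b^9 + 173965179686803 / 4680952735334400 * a * b^8
      + 210115714992331 / 1638333457367040 * a^2 * b^7
      + 1148439614505481 / 8191667286835200 * a^3 * b^6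
      + 2599433553480961 / 16383334573670400 * a^4 * b^5
      + 1843175570720579 / 16383334573670400 * a^5 * b^4
      + 441629987523899 / 8191667286835200 * a^6 * b^3
      + 33431188970153 / 1638333457367040 * a^7 * b^2
      + 149354674347239 / 32766669147340800 * a^8 * b + 26416709093 / 44947419955200 * a^9 := by
    simp only [ha, hb, neU, neV]
    ring
  rw [key]
  positivity

/-- The condition 2x² ≥ 1 of `E2_pos` forces |x| ≥ 7/10, so the two end intervals suffice. -/
theorem neE2_poly_right {x : ℝ} (h1 : 7 / 10 ≤ x) (h2 : x ≤ 1) :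
    0 ≤ (2 * x - 4 / 3 + 8 * x ^ 2 - 16 / 3 * x ^ 4) * (neU x ^ 2 + (1 - x ^ 2) * neV x ^ 2)
      - 2 * x * neU x + (2 * x ^ 2 - 1) * neV x - 1 / 50 := by
  obtain ⟨a, ha⟩ : ∃ a, a = x - (7 / 10) := ⟨_, rfl⟩
  obtain ⟨b, hb⟩ : ∃ b, b = (1) - x := ⟨_, rfl⟩
  have ha0 : 0 ≤ a := by linarith
  have hb0 : 0 ≤ b := by linarith
  have key : (2 * x - 4 / 3 + 8 * x ^ 2 - 16 / 3 * x ^ 4) * (neU x ^ 2 + (1 - x ^ 2) * neV x ^ 2)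
      - 2 * x * neU x + (2 * x ^ 2 - 1) * neV x - 1 / 50 =
      1508948534306996826487 / 830342837254140 * b^13
      + 890994448936055817929 / 36904126100184 * a * b^12
      + 8110844101676801461855 / 55356189150276 * a^2 * b^11
      + 89279368495894653620225 / 166068567450828 * a^3 * b^10
      + 16353699913490154202375 / 12301375366728 * a^4 * b^9
      + 43107971549448144255625 / 18452063050092 * a^5 * b^8
      + 165765096313024130246875 / 55356189150276 * a^6 * b^7
      + 643390353880215359375 / 227803247532 * a^7 * b^6
      + 35959297175345119609375 / 18452063050092 * a^8 * b^5
      + 319618046664991892734375 / 332137134901656 * a^9 * b^4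
      + 2997031082901981640625 / 9226031525046 * a^10 * b^3
      + 947591723622707031250 / 13839047287569 * a^11 * b^2
      + 348087132207666015625 / 47448162128808 * a^12 * b
      + 126828811181640625 / 683409742596 * a^13 := by
    simp only [ha, hb, neU, neV]
    ring
  rw [key]
  positivity

theorem neE2_poly_left {x : ℝ} (h1 : -1 ≤ x) (h2 : x ≤ -7 / 10) :
    0 ≤ (2 * x - 4 / 3 + 8 * x ^ 2 - 16 / 3 * x ^ 4) * (neU x ^ 2 + (1 - x ^ 2) * neV x ^ 2)
      - 2 * x * neU x + (2 * x ^ 2 - 1) * neV x - 1 / 50 := by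
  obtain ⟨a, ha⟩ : ∃ a, a = x - (-1) := ⟨_, rfl⟩
  obtain ⟨b, hb⟩ : ∃ b, b = (-7 / 10) - x := ⟨_, rfl⟩
  have ha0 : 0 ≤ a := by linarith
  have hb0 : 0 ≤ b := by linarith
  have key : (2 * x - 4 / 3 + 8 * x ^ 2 - 16 / 3 * x ^ 4) * (neU x ^ 2 + (1 - x ^ 2) * neV x ^ 2)
      - 2 * x * neU x + (2 * x ^ 2 - 1) * neV x - 1 / 50 =
      3122210258116357421875 / 498205702352484 * b^13
      + 109965687688232685546875 / 996411404704968 * a * b^12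
      + 4790615418245486328125 / 5931020266101 * a^2 * b^11
      + 845131573468316816796875 / 249102851176242 * a^3 * b^10
      + 9272506475220364495390625 / 996411404704968 * a^4 * b^9
      + 492486854084524779296875 / 27678094575138 * a^5 * b^8
      + 4078721285376584404109375 / 166068567450828 * a^6 * b^7
      + 4132713221578166521240625 / 166068567450828 * a^7 * b^6
      + 1027591350542905946860625 / 55356189150276 * a^8 * b^5
      + 10052438112161357647447625 / 996411404704968 * a^9 * b^4
      + 1937108693192467032912175 / 498205702352484 * a^10 * b^3
      + 3413523170023546240925 / 3389154437772 * a^11 * b^2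
      + 156684471948076003170791 / 996411404704968 * a^12 * b
      + 6960115243442856620906 / 622757127940605 * a^13 := by
    simp only [ha, hb, neU, neV]
    ring
  rw [key]
  positivity

theorem neE3_poly {x : ℝ} (h1 : -1 ≤ x) (h2 : x ≤ 1) :
    0 ≤ (neU x ^ 2 + (1 - x ^ 2) * neV x ^ 2) * ((1 + 2 * x - 4 / 3 * x ^ 3) * (1 - neU x)
      - 4 / 3 * (1 - x ^ 2) ^ 2 * neV x) - neU x + neU x ^ 2 - (1 - x ^ 2) * neV x ^ 2 - 11 / 500 := by
  obtain ⟨a, ha⟩ : ∃ a, a = x - (-1) := ⟨_, rfl⟩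
  obtain ⟨b, hb⟩ : ∃ b, b = (1) - x := ⟨_, rfl⟩
  have ha0 : 0 ≤ a := by linarith
  have hb0 : 0 ≤ b := by linarith
  have key : (neU x ^ 2 + (1 - x ^ 2) * neV x ^ 2) * ((1 + 2 * x - 4 / 3 * x ^ 3) * (1 - neU x)
      - 4 / 3 * (1 - x ^ 2) ^ 2 * neV x) - neU x + neU x ^ 2 - (1 - x ^ 2) * neV x ^ 2 - 11 / 500 =
      337857487211931992873 / 109581639784123663908864000 * b^17
      + 3235998024256930894541 / 36527213261374554636288000 * a * b^16
      + 6514865509195759369447 / 6848852486507728994304000 * a^2 * b^15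
      + 4038643627441688029771 / 760983609611969888256000 * a^3 * b^14
      + 158105676330491763174503 / 9131803315343638659072000 * a^4 * b^13
      + 8046393559800340468831 / 219163279568247327817728 * a^5 * b^12
      + 196969910275888011599443 / 3424426243253864497152000 * a^6 * b^11
      + 39347403799413245451653 / 570737707208977416192000 * a^7 * b^10
      + 399996722261057093340703 / 6087868876895759106048000 * a^8 * b^9
      + 2766537615273525077198377 / 54790819892061831954432000 * a^9 * b^8
      + 23612739846132946665139 / 760983609611969888256000 * a^10 * b^7
      + 103444346573304467757811 / 6848852486507728994304000 * a^11 * b^6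
      + 10552037950298836730287 / 1826360663068727731814400 * a^12 * b^5
      + 3115924870650142426601 / 1826360663068727731814400 * a^13 * b^4
      + 154432623695340947 / 418020781647200256000 * a^14 * b^3
      + 181195799269179592747 / 3424426243253864497152000 * a^15 * b^2
      + 2397314063856040997 / 579797035894834200576000 * a^16 * b
      + 318448608283157 / 5567324075807735808000 * a^17 := by
    simp only [ha, hb, neU, neV]
    ring
  rw [key]
  positivity

theorem neE4_poly {x : ℝ} (h1 : -1 ≤ x) (h2 : x ≤ 1) :
    0 ≤ (4 / 3 + x - 2 / 3 * x ^ 2) * neU x + (1 - x ^ 2) * (1 + 2 / 3 * x) * neV x - x - 1 / 50 := by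
  obtain ⟨a, ha⟩ : ∃ a, a = x - (-1) := ⟨_, rfl⟩
  obtain ⟨b, hb⟩ : ∃ b, b = (1) - x := ⟨_, rfl⟩
  have ha0 : 0 ≤ a := by linarith
  have hb0 : 0 ≤ b := by linarith
  have key : (4 / 3 + x - 2 / 3 * x ^ 2) * neU x + (1 - x ^ 2) * (1 + 2 / 3 * x) * neV x - x - 1 / 50 =
      44763613 / 200658124800 * b^11 + 313910581 / 66886041600 * a * b^10
      + 28820683 / 891813888 * a^2 * b^9 + 255215939 / 2675441664 * a^3 * b^8
      + 218792629 / 2229534720 * a^4 * b^7 + 3971970361 / 33443020800 * a^5 * b^6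
      + 8885438203 / 100329062400 * a^6 * b^5 + 105204389 / 2229534720 * a^7 * b^4
      + 93698453 / 4459069440 * a^8 * b^3 + 46836371 / 8026324992 * a^9 * b^2
      + 67402661 / 66886041600 * a^10 * b + 420599 / 7431782400 * a^11 := by
    simp only [ha, hb, neU, neV]
    ring
  rw [key]
  positivity

/-- Pairs of reals close to the values `(neU x, neV x)`. -/
structure NearUV (x U V : ℝ) : Prop where
  le_x : -1 ≤ x
  x_le : x ≤ 1
  hU : |U - neU x| ≤ 1 / 4000
  hV : |V - neV x| ≤ 7 / 5000

namespace NearUV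

variable {x U V : ℝ}

theorem abs_neV_le (h : NearUV x U V) : |neV x| ≤ 9 / 10 := by
  have h1 := neV_lower h.le_x h.x_le
  have h2 := neV_upper h.le_x h.x_le
  rw [abs_le]; constructor <;> linarith

theorem one_sub_sq_mem (h : NearUV x U V) : 0 ≤ 1 - x ^ 2 ∧ 1 - x ^ 2 ≤ 1 := by
  constructor <;> nlinarith [h.le_x, h.x_le]

theorem abs_W_sub_le (h : NearUV x U V) :
    |(U ^ 2 + (1 - x ^ 2) * V ^ 2) - (neU x ^ 2 + (1 - x ^ 2) * neV x ^ 2)| ≤ 1 / 300 := by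
  have h1 := neU_lower h.le_x h.x_le
  have h2 := neU_upper h.le_x h.x_le
  have hV := abs_le.1 h.abs_neV_le
  obtain ⟨hu1, hu2⟩ := abs_le.1 h.hU
  obtain ⟨hv1, hv2⟩ := abs_le.1 h.hV
  obtain ⟨hy0, hy1⟩ := h.one_sub_sq_mem
  have e : (U ^ 2 + (1 - x ^ 2) * V ^ 2) - (neU x ^ 2 + (1 - x ^ 2) * neV x ^ 2) =
      (U - neU x) * (U + neU x) + (1 - x ^ 2) * ((V - neV x) * (V + neV x)) := by ring
  rw [e]
  have a1 : |(U - neU x) * (U + neU x)| ≤ 1 / 4000 * (3201 / 1000) := by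
    rw [abs_mul]
    exact mul_le_mul h.hU (abs_le.2 ⟨by linarith, by linarith⟩) (abs_nonneg _) (by norm_num)
  have a2 : |(V - neV x) * (V + neV x)| ≤ 7 / 5000 * (1802 / 1000) := by
    rw [abs_mul]
    exact mul_le_mul h.hV (abs_le.2 ⟨by linarith, by linarith⟩) (abs_nonneg _) (by norm_num)
  have a3 : |(1 - x ^ 2) * ((V - neV x) * (V + neV x))| ≤ 1 * (7 / 5000 * (1802 / 1000)) := by
    rw [abs_mul, abs_of_nonneg hy0]
    exact mul_le_mul hy1 a2 (abs_nonneg _) zero_le_one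
  have := abs_add_le ((U - neU x) * (U + neU x)) ((1 - x ^ 2) * ((V - neV x) * (V + neV x)))
  linarith

theorem E1_pos (h : NearUV x U V) :
    0 < (2 * x + 4 / 3) * (U ^ 2 + (1 - x ^ 2) * V ^ 2) - 2 * x * U - (2 * x ^ 2 - 1) * V := by
  have hp := neE1_poly h.le_x h.x_le
  obtain ⟨hy0, hy1⟩ := h.one_sub_sq_mem
  have hx : |2 * x| ≤ 2 := abs_le.2 ⟨by linarith [h.le_x], by linarith [h.x_le]⟩
  have hx2 : |2 * x ^ 2 - 1| ≤ 1 := abs_le.2 ⟨by nlinarith, by nlinarith⟩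
  have hA : |2 * x + 4 / 3| ≤ 10 / 3 := abs_le.2 ⟨by linarith [h.le_x], by linarith [h.x_le]⟩
  have b1 := mul_le_mul hA h.abs_W_sub_le (abs_nonneg _) (by norm_num)
  have b2 := mul_le_mul hx h.hU (abs_nonneg _) (by norm_num)
  have b3 := mul_le_mul hx2 h.hV (abs_nonneg _) (by norm_num)
  rw [← abs_mul] at b1 b2 b3
  have c1 := (abs_le.1 b1).1
  have c2 := (abs_le.1 b2).2
  have c3 := (abs_le.1 b3).2
  linarith

theorem E2_pos (h : NearUV x U V) (hx1 : 0 ≤ 2 * x ^ 2 - 1) :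
    0 < (2 * x - 4 / 3 + 8 * x ^ 2 - 16 / 3 * x ^ 4) * (U ^ 2 + (1 - x ^ 2) * V ^ 2)
      - 2 * x * U + (2 * x ^ 2 - 1) * V := by
  have hp : 0 ≤ (2 * x - 4 / 3 + 8 * x ^ 2 - 16 / 3 * x ^ 4) *
      (neU x ^ 2 + (1 - x ^ 2) * neV x ^ 2)
      - 2 * x * neU x + (2 * x ^ 2 - 1) * neV x - 1 / 50 := by
    rcases le_total 0 x with h0 | h0
    · exact neE2_poly_right (by nlinarith) h.x_le
    · exact neE2_poly_left h.le_x (by nlinarith)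
  obtain ⟨hy0, hy1⟩ := h.one_sub_sq_mem
  have hx : |2 * x| ≤ 2 := abs_le.2 ⟨by linarith [h.le_x], by linarith [h.x_le]⟩
  have hx2 : |2 * x ^ 2 - 1| ≤ 1 := abs_le.2 ⟨by nlinarith, by nlinarith⟩
  have hA : |2 * x - 4 / 3 + 8 * x ^ 2 - 16 / 3 * x ^ 4| ≤ 4 := by
    have e : x ^ 4 = (x ^ 2) ^ 2 := by ring
    rw [e]
    refine abs_le.2 ⟨?_, ?_⟩
    · nlinarith [h.le_x, mul_nonneg hy0 (by linarith : 0 ≤ x ^ 2)]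
    · nlinarith [h.x_le, sq_nonneg (x ^ 2 - 3 / 4)]
  have b1 := mul_le_mul hA h.abs_W_sub_le (abs_nonneg _) (by norm_num)
  have b2 := mul_le_mul hx h.hU (abs_nonneg _) (by norm_num)
  have b3 := mul_le_mul hx2 h.hV (abs_nonneg _) (by norm_num)
  rw [← abs_mul] at b1 b2 b3
  have c1 := (abs_le.1 b1).1
  have c2 := (abs_le.1 b2).2
  have c3 := (abs_le.1 b3).1
  linarith

theorem abs_re_phiNe_le (h : NearUV x U V) : |1 + 2 * x - 4 / 3 * x ^ 3| ≤ 2 := by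
  have h1 := h.le_x
  have h2 := h.x_le
  refine abs_le.2 ⟨?_, ?_⟩
  · nlinarith [mul_nonneg (by linarith : 0 ≤ 1 - x) (sq_nonneg (x + 1)),
      mul_nonneg (by linarith : 0 ≤ 1 - x) (sq_nonneg x), sq_nonneg x]
  · nlinarith [mul_nonneg (by linarith : 0 ≤ 1 + x) (sq_nonneg (x - 7 / 10)), sq_nonneg x]

/-- The errors add up to less than 0.0185, within the margin 11/500 of `neE3_poly`. -/
theorem E3_pos (h : NearUV x U V) :
    0 < (U ^ 2 + (1 - x ^ 2) * V ^ 2) * ((1 + 2 * x - 4 / 3 * x ^ 3) * (1 - U)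
      - 4 / 3 * (1 - x ^ 2) ^ 2 * V) - U + U ^ 2 - (1 - x ^ 2) * V ^ 2 := by
  have hp := neE3_poly h.le_x h.x_le
  obtain ⟨hy0, hy1⟩ := h.one_sub_sq_mem
  have u1 := neU_lower h.le_x h.x_le
  have u2 := neU_upper h.le_x h.x_le
  have hVp := abs_le.1 h.abs_neV_le
  obtain ⟨hu1, hu2⟩ := abs_le.1 h.hU
  obtain ⟨hv1, hv2⟩ := abs_le.1 h.hV
  have hy2 : |4 / 3 * (1 - x ^ 2) ^ 2| ≤ 4 / 3 := by
    rw [abs_of_nonneg (by positivity)]; nlinarith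
  have hφ := h.abs_re_phiNe_le
  set W := U ^ 2 + (1 - x ^ 2) * V ^ 2 with hW
  set W' := neU x ^ 2 + (1 - x ^ 2) * neV x ^ 2 with hW'
  set φ := 1 + 2 * x - 4 / 3 * x ^ 3
  set q := 4 / 3 * (1 - x ^ 2) ^ 2
  have hdW : |W - W'| ≤ 1 / 300 := h.abs_W_sub_le
  have hX : |φ * (1 - U) - q * V| ≤ 5 / 2 := by
    have b1 := mul_le_mul hφ (abs_le.2 ⟨by linarith, by linarith⟩ : |1 - U| ≤ 601 / 1000)
      (abs_nonneg _) (by norm_num)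
    have b2 := mul_le_mul hy2 (abs_le.2 ⟨by linarith, by linarith⟩ : |V| ≤ 902 / 1000)
      (abs_nonneg _) (by norm_num)
    rw [← abs_mul] at b1 b2
    have := abs_sub (φ * (1 - U)) (q * V)
    linarith
  have hdX : |(φ * (1 - U) - q * V) - (φ * (1 - neU x) - q * neV x)| ≤ 3 / 1250 := by
    have b1 := mul_le_mul hφ h.hU (abs_nonneg _) (by norm_num)
    have b2 := mul_le_mul hy2 h.hV (abs_nonneg _) (by norm_num)
    rw [← abs_mul] at b1 b2
    rw [abs_le] at b1 b2 ⊢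
    constructor <;> linarith [b1.1, b1.2, b2.1, b2.2]
  have hW0 : 0 ≤ W' := by positivity
  have hW1 : |W'| ≤ 27 / 10 := by
    rw [abs_of_nonneg hW0]
    have := neW_upper h.le_x h.x_le
    linarith
  have b1 := mul_le_mul hdW hX (abs_nonneg _) (by norm_num)
  have b2 := mul_le_mul hW1 hdX (abs_nonneg _) (by norm_num)
  rw [← abs_mul] at b1 b2
  have c1 := (abs_le.1 b1).1
  have c2 := (abs_le.1 b2).1
  have e : W * (φ * (1 - U) - q * V) = W' * (φ * (1 - neU x) - q * neV x) +
      (W - W') * (φ * (1 - U) - q * V) +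
      W' * ((φ * (1 - U) - q * V) - (φ * (1 - neU x) - q * neV x)) := by ring
  have b3 := mul_le_mul h.hU (abs_le.2 ⟨by linarith, by linarith⟩ : |U + neU x| ≤ 3201 / 1000)
      (abs_nonneg _) (by norm_num)
  have b4 := mul_le_mul h.hV (abs_le.2 ⟨by linarith, by linarith⟩ : |V + neV x| ≤ 1802 / 1000)
      (abs_nonneg _) (by norm_num)
  have b5 := mul_le_mul (abs_le.2 ⟨by linarith, hy1⟩ : |1 - x ^ 2| ≤ 1) b4
      (by positivity) (by norm_num)
  rw [← abs_mul, ← abs_mul] at b5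
  rw [← abs_mul] at b3
  have c3 := (abs_le.1 b3).1
  have c5 := (abs_le.1 b5).2
  have e2 : U ^ 2 - (1 - x ^ 2) * V ^ 2 = neU x ^ 2 - (1 - x ^ 2) * neV x ^ 2 +
      (U - neU x) * (U + neU x) - (1 - x ^ 2) * ((V - neV x) * (V + neV x)) := by ring
  have goal : 0 < W * (φ * (1 - U) - q * V) - U + (U ^ 2 - (1 - x ^ 2) * V ^ 2) := by
    rw [e, e2]
    linarith
  linarith

theorem E4_pos (h : NearUV x U V) :
    0 < (4 / 3 + x - 2 / 3 * x ^ 2) * U + (1 - x ^ 2) * (1 + 2 / 3 * x) * V - x := by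
  have hp := neE4_poly h.le_x h.x_le
  obtain ⟨hy0, hy1⟩ := h.one_sub_sq_mem
  have h1 := h.le_x
  have h2 := h.x_le
  have hA : |4 / 3 + x - 2 / 3 * x ^ 2| ≤ 2 := abs_le.2 ⟨by nlinarith, by nlinarith⟩
  have hB : |(1 - x ^ 2) * (1 + 2 / 3 * x)| ≤ 1 * (5 / 3) := by
    rw [abs_mul, abs_of_nonneg hy0]
    exact mul_le_mul hy1 (abs_le.2 ⟨by linarith, by linarith⟩) (abs_nonneg _) zero_le_one
  have b1 := mul_le_mul hA h.hU (abs_nonneg _) (by norm_num)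
  have b2 := mul_le_mul hB h.hV (abs_nonneg _) (by norm_num)
  rw [← abs_mul] at b1 b2
  have c1 := (abs_le.1 b1).1
  have c2 := (abs_le.1 b2).1
  linarith

end NearUV

/-! ### Geometric properties of `neB` -/

theorem exists_nearUV {z : ℂ} (hz : ‖z‖ = 1) : ∃ U V : ℝ,
    neB z = (U : ℂ) + (V : ℂ) * z.im * Complex.I ∧ NearUV z.re U V := by
  obtain ⟨U, V, h, hU, hV⟩ := exists_neB_circle hz
  have := abs_le.1 ((Complex.abs_re_le_norm z).trans hz.le)
  exact ⟨U, V, h, this.1, this.2, hU, hV⟩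

theorem sq_add_sq_of_norm_eq_one {z : ℂ} (hz : ‖z‖ = 1) : z.re ^ 2 + z.im ^ 2 = 1 := by
  have := Complex.sq_norm z
  rw [hz, Complex.normSq_apply] at this
  linarith

/-- By the minimum principle only |z| = 1 matters. There 1/z = conj z, and the differential equation
reads -B' = (conj z + 1 - z²/3)B - conj z, whose real part is the expression in `E4_pos`. -/
theorem deriv_neB_re_neg {z : ℂ} (hz : ‖z‖ ≤ 1) : (deriv neB z).re < 0 := by
  have := re_pos_of_sphere (h := fun z => -deriv neB z) (fun w _ => by
      have : Differentiable ℂ (deriv neB) := by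
        rw [← differentiableOn_univ]
        exact differentiable_neB.differentiableOn.deriv isOpen_univ
      exact (this w).neg) (fun w hw => by
    have hw1 : ‖w‖ = 1 := by simpa using hw
    obtain ⟨U, V, hB, hUV⟩ := exists_nearUV hw1
    have hn := sq_add_sq_of_norm_eq_one hw1
    have hww : conj w * w = 1 := by
      rw [mul_comm, Complex.mul_conj, Complex.normSq_eq_norm_sq, hw1]; simp
    have e : -deriv neB w = (conj w + 1 - w ^ 2 / 3) * neB w - conj w := by
      have := mul_deriv_neB w
      rw [phiNe] at this
      linear_combination -conj w * this + (deriv neB w + neB w * (1 - w ^ 2 / 3)) * hww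
    have h4 := hUV.E4_pos
    rw [e, hB]
    have hre : w ^ 2 = ((w.re ^ 2 - w.im ^ 2 : ℝ) : ℂ) + ((2 * w.re * w.im : ℝ) : ℂ) * Complex.I := by
      nth_rw 1 [← Complex.re_add_im w]
      push_cast
      linear_combination (w.im : ℂ) ^ 2 * Complex.I_sq
    have hc : conj w = w.re - w.im * Complex.I := by
      apply Complex.ext <;> simp
    rw [hre, hc]
    have hy : w.im ^ 2 = 1 - w.re ^ 2 := by linarith
    have goal : ((w.re - w.im * Complex.I + 1 - (((w.re ^ 2 - w.im ^ 2 : ℝ) : ℂ) +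
        ((2 * w.re * w.im : ℝ) : ℂ) * Complex.I) / 3) * (U + V * w.im * Complex.I) -
        (w.re - w.im * Complex.I)) =
        (((w.re + 1 - (w.re ^ 2 - w.im ^ 2) / 3) * U + w.im ^ 2 * (1 + 2 / 3 * w.re) * V - w.re : ℝ) : ℂ)
        + ((-(w.im + 2 / 3 * w.re * w.im) * U + (w.re + 1 - (w.re ^ 2 - w.im ^ 2) / 3) * V * w.im
          + w.im : ℝ) : ℂ) * Complex.I := by
      push_cast
      linear_combination (-(w.im + 2 / 3 * w.re * w.im) * V * w.im : ℂ) * Complex.I_sq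
    rw [goal]
    simp only [Complex.add_re, Complex.ofReal_re, Complex.re_ofReal_mul, Complex.I_re, mul_zero,
      add_zero]
    rw [hy]
    linarith) z (by simpa using hz)
  simpa using this

/-- B is real on the real axis, and Im B decreases along upward vertical segments at the rate Re B'
< 0. -/
theorem neB_im_neg {z : ℂ} (hz : ‖z‖ ≤ 1) (him : 0 < z.im) : (neB z).im < 0 := by
  have hne : (z.im : ℂ) * Complex.I ≠ 0 := by simp [him.ne']
  have hx : ‖(z.re : ℂ)‖ ≤ 1 := by
    rw [Complex.norm_real, Real.norm_eq_abs]
    exact (Complex.abs_re_le_norm z).trans hz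
  have := re_lt_re_of_deriv_re_pos
    (F := fun t : ℝ => -neB (z.re + t * (z.im * Complex.I)) / (z.im * Complex.I))
    (F' := fun t => -deriv neB (z.re + t * (z.im * Complex.I)))
    (fun t _ => by
      have := ((hasDerivAt_comp_segment (a := z.re) (b := z.im * Complex.I)
        (differentiable_neB (z.re + t * (z.im * Complex.I))).hasDerivAt).neg).div_const
        (z.im * Complex.I)
      exact this.congr_deriv (by rw [neg_div, mul_div_assoc, div_self hne, mul_one]))
    (fun t ht => by
      have hmem : (z.re : ℂ) + t * (z.im * Complex.I) ∈ closedBall (0 : ℂ) 1 := by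
        have h1 := (convex_closedBall (0 : ℂ) 1).add_smul_sub_mem (x := (z.re : ℂ)) (y := z)
          (by simpa using hx) (by simpa using hz) (Ioo_subset_Icc_self ht)
        have e : z - z.re = z.im * Complex.I := by
          nth_rw 1 [← Complex.re_add_im z]; ring
        simpa [e] using h1
      have := deriv_neB_re_neg (mem_closedBall_zero_iff.1 hmem)
      rw [Complex.neg_re]
      linarith)
  simp only [Complex.ofReal_zero, zero_mul, add_zero, Complex.ofReal_one, one_mul,
    Complex.re_add_im] at this
  have e : ∀ c : ℂ, (-c / (z.im * Complex.I)).re = -c.im / z.im := by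
    intro c
    have : -c / (z.im * Complex.I) = ((z.im)⁻¹ : ℝ) * (c * Complex.I) := by
      push_cast
      field_simp
      rw [Complex.I_sq]; ring
    rw [this, Complex.re_ofReal_mul, Complex.mul_I_re]
    field_simp
  rw [e, e, neB_ofReal_im, neg_zero, zero_div, lt_div_iff₀ him] at this
  linarith

/-- `(1 - neB z) / z` as an entire function. -/
noncomputable def neH (z : ℂ) : ℂ := -dslope neB 0 z

theorem mul_neH (z : ℂ) : z * neH z = 1 - neB z := by
  have := sub_smul_dslope neB 0 z
  rw [neB_zero, sub_zero, smul_eq_mul] at this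
  rw [neH]
  linear_combination -this

theorem differentiable_neH : Differentiable ℂ neH := by
  have : Differentiable ℂ (dslope neB 0) := by
    rw [← differentiableOn_univ]
    exact (Complex.differentiableOn_dslope univ_mem).2 differentiable_neB.differentiableOn
  exact this.neg

/-- For z ≠ 0, (1 - B(z))/z is the mean of -B' over the segment from 0 to z. -/
theorem neH_ne_zero {z : ℂ} (hz : ‖z‖ ≤ 1) : neH z ≠ 0 := by
  intro h
  rcases eq_or_ne z 0 with rfl | hz0
  · rw [neH, dslope_same, neg_eq_zero] at h
    have := deriv_neB_re_neg hz
    simp [h] at this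
  have := re_lt_re_of_deriv_re_pos (F := fun t : ℝ => -neB (t * z) / z)
    (F' := fun t => -deriv neB (t * z))
    (fun t _ => by
      have := ((hasDerivAt_comp_ray (b := z)
        (differentiable_neB (t * z)).hasDerivAt).neg).div_const z
      exact this.congr_deriv (by field_simp))
    (fun t ht => by
      have := deriv_neB_re_neg (norm_ofReal_mul_le hz (Ioo_subset_Icc_self ht))
      rw [Complex.neg_re]
      linarith)
  have hB : neB z = 1 := by
    have := mul_neH z
    rw [h] at this
    linear_combination this
  simp [hB, neB_zero] at this

theorem deriv_inv_neB_sub_one {z : ℂ} (hz : ‖z‖ ≤ 1) :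
    deriv (fun z => (neB z)⁻¹ - 1) z = -deriv neB z / neB z ^ 2 :=
  (((differentiable_neB z).hasDerivAt.inv (neB_ne_zero hz)).sub_const 1).deriv

/-- `z neHat' / neHat` is starlike with respect to `1`. -/
theorem inv_neB_starlike {z : ℂ} (hz : ‖z‖ ≤ 1) (hz0 : z ≠ 0) :
    0 < (z * deriv (fun z => (neB z)⁻¹ - 1) z / ((neB z)⁻¹ - 1)).re := by
  -- Cancelling the common zero at the origin leaves a quotient analytic on the whole closed disk,
  -- to which the minimum principle applies.
  have hform : ∀ {w : ℂ}, ‖w‖ ≤ 1 → w ≠ 0 → w * deriv (fun z => (neB z)⁻¹ - 1) w / ((neB w)⁻¹ - 1)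
      = -deriv neB w / (neB w * neH w) := by
    intro w hw hw0
    rw [deriv_inv_neB_sub_one hw]
    have hB := neB_ne_zero hw
    have hH := neH_ne_zero hw
    have e : (neB w)⁻¹ - 1 = w * neH w / neB w := by
      rw [mul_neH]; field_simp
    rw [e]
    field_simp
  rw [hform hz hz0]
  refine re_pos_of_sphere (h := fun w => -deriv neB w / (neB w * neH w)) (fun w hw => ?_)
    (fun w hw => ?_) z (by simpa using hz)
  · have hw' : ‖w‖ ≤ 1 := by simpa using hw
    have : Differentiable ℂ (deriv neB) := by
      rw [← differentiableOn_univ]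
      exact differentiable_neB.differentiableOn.deriv isOpen_univ
    exact (this w).neg.div ((differentiable_neB w).mul (differentiable_neH w))
      (mul_ne_zero (neB_ne_zero hw') (neH_ne_zero hw'))
  · have hw1 : ‖w‖ = 1 := by simpa using hw
    have hw0 : w ≠ 0 := fun h => by simp [h] at hw1
    have hB := neB_ne_zero hw1.le
    have hH := neH_ne_zero hw1.le
    obtain ⟨U, V, hBe, hUV⟩ := exists_nearUV hw1
    have hn := sq_add_sq_of_norm_eq_one hw1
    -- Up to the positive factor |B(1 - B)|⁻², the real part becomes that of (φ|B|² - conj B)(1 -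
    -- conj B), which is the expression in `E3_pos`.
    have e : -deriv neB w / (neB w * neH w) =
        ((Complex.normSq (neB w * (1 - neB w)))⁻¹ : ℝ) *
        ((phiNe w * neB w - 1) * conj (neB w * (1 - neB w))) := by
      have h1 : phiNe w * neB w - 1 = -(w * deriv neB w) := by
        linear_combination mul_deriv_neB w
      have h2 : neB w * (1 - neB w) ≠ 0 := by
        rw [← mul_neH]; exact mul_ne_zero hB (mul_ne_zero hw0 hH)
      have h3 : conj (neB w * (1 - neB w)) ≠ 0 := (map_ne_zero _).2 h2
      rw [Complex.ofReal_inv, ← Complex.mul_conj, h1]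
      have h4 : neB w * (1 - neB w) = w * (neB w * neH w) := by rw [← mul_neH]; ring
      rw [h4] at h3 ⊢
      generalize conj (w * (neB w * neH w)) = c at h3
      field_simp
    have hpos : 0 < (Complex.normSq (neB w * (1 - neB w)))⁻¹ := by
      refine inv_pos.2 (Complex.normSq_pos.2 ?_)
      rw [← mul_neH]; exact mul_ne_zero hB (mul_ne_zero hw0 hH)
    rw [e, Complex.re_ofReal_mul]
    refine mul_pos hpos ?_
    have h3 := hUV.E3_pos
    have hy : w.im ^ 2 = 1 - w.re ^ 2 := by linarith
    have hφ : phiNe w = ((1 + 2 * w.re - 4 / 3 * w.re ^ 3 : ℝ) : ℂ) +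
        ((4 / 3 * w.im ^ 3 : ℝ) : ℂ) * Complex.I := by
      have hyc : (w.im : ℂ) ^ 2 = 1 - (w.re : ℂ) ^ 2 := by exact_mod_cast hy
      rw [phiNe]
      nth_rw 1 2 [← Complex.re_add_im w]
      push_cast
      linear_combination (-(w.re : ℂ) * w.im ^ 2 - w.im ^ 3 * Complex.I / 3) * Complex.I_sq +
        (w.re : ℂ) * hyc - (w.im : ℂ) * Complex.I * hyc
    have e2 : (phiNe w * neB w - 1) * conj (neB w * (1 - neB w)) =
        (phiNe w * (neB w * conj (neB w)) - conj (neB w)) * (1 - conj (neB w)) := by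
      simp only [map_mul, map_sub, map_one]; ring
    have hBc : conj (neB w) = (U : ℂ) - V * w.im * Complex.I := by
      rw [hBe]; apply Complex.ext <;> simp
    have hBB : neB w * conj (neB w) = ((U ^ 2 + w.im ^ 2 * V ^ 2 : ℝ) : ℂ) := by
      rw [hBc, hBe]
      push_cast
      linear_combination -(V : ℂ) ^ 2 * w.im ^ 2 * Complex.I_sq
    rw [e2, hBB, hBc, hφ]
    have e3 : ((((1 + 2 * w.re - 4 / 3 * w.re ^ 3 : ℝ) : ℂ) +
        ((4 / 3 * w.im ^ 3 : ℝ) : ℂ) * Complex.I) * ((U ^ 2 + w.im ^ 2 * V ^ 2 : ℝ) : ℂ) -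
        (U - V * w.im * Complex.I)) * (1 - (U - V * w.im * Complex.I)) =
        (((U ^ 2 + w.im ^ 2 * V ^ 2) * ((1 + 2 * w.re - 4 / 3 * w.re ^ 3) * (1 - U)
      - 4 / 3 * (w.im ^ 2) ^ 2 * V) - U + U ^ 2 - w.im ^ 2 * V ^ 2 : ℝ) : ℂ) +
      (((U ^ 2 + w.im ^ 2 * V ^ 2) * ((1 + 2 * w.re - 4 / 3 * w.re ^ 3) * (V * w.im)
        + 4 / 3 * w.im ^ 3 * (1 - U)) + V * w.im * (1 - 2 * U) : ℝ) : ℂ) * Complex.I := by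
      push_cast
      linear_combination ((U ^ 2 + w.im ^ 2 * V ^ 2) * (4 / 3 * w.im ^ 3) * V * w.im +
        (V * w.im) ^ 2 : ℂ) * Complex.I_sq
    rw [e3]
    simp only [Complex.add_re, Complex.ofReal_re, Complex.re_ofReal_mul, Complex.I_re, mul_zero,
      add_zero]
    rw [hy]
    exact h3

/-! ### The nephroid -/

/-- Equality here is the implicit equation of the nephroid. With q = z - z³/3, R = |z|² and y = Im
z, one has |q|² - 4/9 = (4/3)Ry² - (1-R)²(4-R)/9 and Im q = y(1 - R + (4/3)y²). The two sides agree
for R = 1; for R < 1 the term (1-R)²(4-R) makes the inequality strict. -/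
theorem nephroid_interior {z : ℂ} (hz : ‖z‖ < 1) :
    (Complex.normSq (z - z ^ 3 / 3) - 4 / 9) ^ 3 < 4 / 3 * (z - z ^ 3 / 3).im ^ 2 := by
  obtain ⟨x, y⟩ := z
  have hn : x ^ 2 + y ^ 2 < 1 := by
    have := Complex.sq_norm ⟨x, y⟩
    rw [Complex.normSq_mk] at this
    have h2 : ‖(⟨x, y⟩ : ℂ)‖ ^ 2 < 1 := by
      exact pow_lt_one₀ (norm_nonneg _) hz two_ne_zero
    nlinarith
  have e : (⟨x, y⟩ : ℂ) - (⟨x, y⟩ : ℂ) ^ 3 / 3 =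
      ⟨x - (x ^ 3 - 3 * x * y ^ 2) / 3, y - (3 * x ^ 2 * y - y ^ 3) / 3⟩ := by
    apply Complex.ext
    · rw [Complex.sub_re, Complex.div_ofNat_re]
      simp [pow_succ]; ring
    · rw [Complex.sub_im, Complex.div_ofNat_im]
      simp [pow_succ]; ring
  rw [e, Complex.normSq_mk]
  set R := x ^ 2 + y ^ 2 with hR
  have hR0 : 0 ≤ R := by positivity
  have e1 : (x - (x ^ 3 - 3 * x * y ^ 2) / 3) * (x - (x ^ 3 - 3 * x * y ^ 2) / 3) +
      (y - (3 * x ^ 2 * y - y ^ 3) / 3) * (y - (3 * x ^ 2 * y - y ^ 3) / 3) - 4 / 9 =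
      4 / 3 * R * y ^ 2 - (1 - R) ^ 2 * (4 - R) / 9 := by
    rw [hR]; ring
  have e2 : (y - (3 * x ^ 2 * y - y ^ 3) / 3) ^ 2 = y ^ 2 * (1 - R + 4 / 3 * y ^ 2) ^ 2 := by
    rw [hR]; ring
  rw [e1, e2]
  have hlt : 4 / 3 * R * y ^ 2 - (1 - R) ^ 2 * (4 - R) / 9 < 4 / 3 * R * y ^ 2 := by
    have : 0 < (1 - R) ^ 2 * (4 - R) := mul_pos (by nlinarith) (by linarith)
    linarith
  have h3 : (4 / 3 * R * y ^ 2 - (1 - R) ^ 2 * (4 - R) / 9) ^ 3 < (4 / 3 * R * y ^ 2) ^ 3 :=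
    Odd.strictMono_pow (by decide) hlt
  refine h3.trans_le ?_
  have hR3 : R ^ 3 ≤ 1 := pow_le_one₀ hR0 hn.le
  have hsq : (4 / 3 * y ^ 2) ^ 2 ≤ (1 - R + 4 / 3 * y ^ 2) ^ 2 := by
    apply pow_le_pow_left₀ (by positivity)
    linarith
  calc (4 / 3 * R * y ^ 2) ^ 3 = 4 / 3 * (y ^ 2 * (4 / 3 * y ^ 2) ^ 2) * R ^ 3 := by ring
    _ ≤ 4 / 3 * (y ^ 2 * (4 / 3 * y ^ 2) ^ 2) * 1 := by gcongr
    _ ≤ 4 / 3 * (y ^ 2 * (1 - R + 4 / 3 * y ^ 2) ^ 2) := by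
      rw [mul_one]; gcongr

/-- A ray that leaves a point of the nephroid in a direction between the exterior tangents stays
outside the nephroid. -/
theorem nephroid_exterior {x y a β s : ℝ} (hxy : x ^ 2 + y ^ 2 = 1) (hs : 0 ≤ s)
    (h1 : 0 ≤ 2 * x * a - (2 * x ^ 2 - 1) * β)
    (h2 : 0 ≤ 2 * x ^ 2 - 1 → 0 ≤ 2 * x * a + (2 * x ^ 2 - 1) * β) :
    4 / 3 * (y * (4 / 3 * y ^ 2 + s * β)) ^ 2 ≤
      ((2 * x - 4 / 3 * x ^ 3 + s * a) ^ 2 + (y * (4 / 3 * y ^ 2 + s * β)) ^ 2 - 4 / 9) ^ 3 := by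
  set v := 4 / 3 * y ^ 2 + s * β with hv
  set G := (2 * x - 4 / 3 * x ^ 3 + s * a) ^ 2 + (y * v) ^ 2 - 4 / 9 with hG
  have hx2 : x ^ 2 = 1 - y ^ 2 := by linarith
  have hy0 := sq_nonneg y
  have hx0 := sq_nonneg x
  have hk : 0 ≤ s * (3 - 2 * x ^ 2) := mul_nonneg hs (by linarith)
  -- the tangent-line bound
  have hkey : 4 / 9 * y ^ 2 + 2 / 3 * |v| ≤ G := by
    have eplus : G - 4 / 9 * y ^ 2 - 2 / 3 * v =
        2 / 3 * (s * (3 - 2 * x ^ 2)) * (2 * x * a - (2 * x ^ 2 - 1) * β) + (s * a) ^ 2 +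
        y ^ 2 * (s * β) ^ 2 := by
      have hy2 : y ^ 2 = 1 - x ^ 2 := by linarith
      rw [hG, mul_pow, hv, hy2]
      ring
    -- The tangent at the boundary point has direction ζ² = (2x² - 1, 2xy), so `h1` says that (a,
    -- yβ) points to its outer side; `h2` is the same condition for the mirrored vector (a, -yβ).
    -- The ordinate of the moving point is yv, so for v < 0 (and y ≠ 0) the ray has crossed the real
    -- axis. The mirrored condition is then used where 2x² ≥ 1, that is, towards the cusps;
    -- elsewhere `h1` suffices.
    rcases le_total 0 v with hv0 | hv0
    · rw [abs_of_nonneg hv0]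
      have hm1 := mul_nonneg hk h1
      have hm2 := mul_nonneg hy0 (sq_nonneg (s * β))
      have hm3 := sq_nonneg (s * a)
      rw [mul_assoc] at eplus
      linarith only [eplus, hm1, hm2, hm3]
    · rw [abs_of_nonpos hv0]
      have hb : s * β ≤ 0 := by linarith
      have eminus : G - 4 / 9 * y ^ 2 + 2 / 3 * v = (s * a) ^ 2 +
          4 / 3 * (3 - 2 * x ^ 2) * (x * (s * a)) + y ^ 2 * (v ^ 2 - (4 / 3 * y ^ 2) ^ 2) +
          2 / 3 * (v + 4 / 3 * y ^ 2) := by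
        have hy2 : y ^ 2 = 1 - x ^ 2 := by linarith
        rw [hG, mul_pow, hy2]
        ring
      have hT : y ^ 2 * (v ^ 2 - (4 / 3 * y ^ 2) ^ 2) + 2 / 3 * (v + 4 / 3 * y ^ 2) =
          y ^ 2 * (v + 4 / 3 * y ^ 2) ^ 2 +
          2 / 3 * (v + 4 / 3 * y ^ 2) * ((2 * x ^ 2 - 1) * (3 - 2 * x ^ 2)) := by
        have hy2 : y ^ 2 = 1 - x ^ 2 := by linarith
        rw [hy2]; ring
      have hTv : v + 4 / 3 * y ^ 2 = s * β + 8 / 3 * y ^ 2 := by rw [hv]; ring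
      have hm1 := mul_nonneg hk h1
      have hq : 0 ≤ y ^ 2 * (v + 4 / 3 * y ^ 2) ^ 2 := by positivity
      have hsa := sq_nonneg (s * a)
      have h32 : 0 ≤ 3 - 2 * x ^ 2 := by linarith
      suffices h : 0 ≤ 4 / 3 * (3 - 2 * x ^ 2) * (x * (s * a)) +
          2 / 3 * (v + 4 / 3 * y ^ 2) * ((2 * x ^ 2 - 1) * (3 - 2 * x ^ 2)) by
        linarith only [h, eminus, hT, hq, hsa]
      rcases le_total 0 (2 * x ^ 2 - 1) with hc | hc
      · have hm2 := mul_nonneg hk (h2 hc)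
        have : 0 ≤ y ^ 2 * ((2 * x ^ 2 - 1) * (3 - 2 * x ^ 2)) :=
          mul_nonneg hy0 (mul_nonneg hc h32)
        rw [hTv]
        have e : 4 / 3 * (3 - 2 * x ^ 2) * (x * (s * a)) + 2 / 3 * (s * β + 8 / 3 * y ^ 2) *
            ((2 * x ^ 2 - 1) * (3 - 2 * x ^ 2)) =
            2 / 3 * (s * (3 - 2 * x ^ 2) * (2 * x * a + (2 * x ^ 2 - 1) * β)) +
            16 / 9 * (y ^ 2 * ((2 * x ^ 2 - 1) * (3 - 2 * x ^ 2))) := by ring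
        rw [e]
        positivity
      · have h3 : 0 ≤ 2 * x * (s * a) - (2 * x ^ 2 - 1) * (s * β) := by
          have := mul_nonneg hs h1
          linarith only [this]
        have h4 : 0 ≤ (2 * x ^ 2 - 1) * (s * β) := mul_nonneg_of_nonpos_of_nonpos hc hb
        have h5 : 0 ≤ (1 - 2 * x ^ 2) * (-v) := mul_nonneg (by linarith) (by linarith)
        have h6 : 0 ≤ 2 * x * (s * a) + (2 * x ^ 2 - 1) * (v + 4 / 3 * y ^ 2) := by
          have e : (2 * x ^ 2 - 1) * (v + 4 / 3 * y ^ 2) =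
            (2 * x ^ 2 - 1) * (2 * v - s * β) := by rw [hv]; ring
          rw [e]
          linarith only [h3, h4, h5]
        have := mul_nonneg h32 h6
        linarith only [this]
  -- the arithmetic-geometric mean inequality
  have hv0 := abs_nonneg v
  have hamgm : 4 / 3 * (y ^ 2 * |v| ^ 2) ≤ (4 / 9 * y ^ 2 + 2 / 3 * |v|) ^ 3 := by
    -- The three numbers are (4/9)y², |v|/3 and |v|/3. They are equal for v = (4/3)y², the value at
    -- the starting point s = 0.
    have : (4 / 9 * y ^ 2 + 2 / 3 * |v|) ^ 3 - 4 / 3 * (y ^ 2 * |v| ^ 2) =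
        (4 / 9 * y ^ 2 - 1 / 3 * |v|) ^ 2 * (4 / 9 * y ^ 2 + 8 / 3 * |v|) := by ring
    have h2 : 0 ≤ (4 / 9 * y ^ 2 - 1 / 3 * |v|) ^ 2 * (4 / 9 * y ^ 2 + 8 / 3 * |v|) := by positivity
    linarith
  rw [sq_abs] at hamgm
  rw [mul_pow]
  exact hamgm.trans (pow_le_pow_left₀ (by positivity) hkey 3)

theorem nephroid_circle {z : ℂ} (hz : ‖z‖ = 1) :
    z - z ^ 3 / 3 = ((2 * z.re - 4 / 3 * z.re ^ 3 : ℝ) : ℂ) +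
      ((z.im * (4 / 3 * z.im ^ 2) : ℝ) : ℂ) * Complex.I := by
  have hn := sq_add_sq_of_norm_eq_one hz
  have hyc : (z.im : ℂ) ^ 2 = 1 - (z.re : ℂ) ^ 2 := by
    have hy : z.im ^ 2 = 1 - z.re ^ 2 := by linarith
    exact_mod_cast hy
  nth_rw 1 2 [← Complex.re_add_im z]
  push_cast
  linear_combination (-(z.re : ℂ) * z.im ^ 2 - z.im ^ 3 * Complex.I / 3) * Complex.I_sq +
        (z.re : ℂ) * hyc - (z.im : ℂ) * Complex.I * hyc

/-- No ray from a boundary point of the nephroid in the direction of the logarithmic derivative of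
`1 / neB` meets the interior. -/
theorem no_contact_neB {ω ζ : ℂ} {m : ℝ} (hω : ‖ω‖ < 1) (hζ : ‖ζ‖ = 1) (hm : 1 ≤ m)
    (h : 1 - phiNe ω * neB ζ = m * (1 - phiNe ζ * neB ζ)) : False := by
  obtain ⟨U, V, hB, hUV⟩ := exists_nearUV hζ
  have hn := sq_add_sq_of_norm_eq_one hζ
  have hB0 := neB_ne_zero hζ.le
  set x := ζ.re with hx
  set y := ζ.im with hy
  have hy2 : 1 - x ^ 2 = y ^ 2 := by linarith
  set W := U ^ 2 + y ^ 2 * V ^ 2 with hW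
  have hWB : Complex.normSq (neB ζ) = W := by
    rw [hB, Complex.normSq_apply, hW]; simp; ring
  have hW0 : 0 < W := hWB ▸ Complex.normSq_pos.2 hB0
  have h1 := hUV.E1_pos
  have h2 := hUV.E2_pos
  rw [hy2] at h1 h2
  -- The vector (a, yβ) is φ(ζ) - 1/B(ζ), since 1/B = (U - iyV)/W.
  set a := 1 + 2 * x - 4 / 3 * x ^ 3 - U / W with ha
  set β := 4 / 3 * y ^ 2 + V / W with hβ
  have hc1 : 0 ≤ 2 * x * a - (2 * x ^ 2 - 1) * β := by
    have e : 2 * x * a - (2 * x ^ 2 - 1) * β =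
        ((2 * x + 4 / 3) * W - 2 * x * U - (2 * x ^ 2 - 1) * V) / W := by
      rw [ha, hβ, ← hy2]; field_simp; ring
    rw [e]; exact (div_pos h1 hW0).le
  have hc2 : 0 ≤ 2 * x ^ 2 - 1 → 0 ≤ 2 * x * a + (2 * x ^ 2 - 1) * β := fun hc => by
    have e : 2 * x * a + (2 * x ^ 2 - 1) * β =
        ((2 * x - 4 / 3 + 8 * x ^ 2 - 16 / 3 * x ^ 4) * W - 2 * x * U + (2 * x ^ 2 - 1) * V) / W := by
      rw [ha, hβ, ← hy2]; field_simp; ring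
    rw [e]; exact (div_pos (h2 hc) hW0).le
  have hext := nephroid_exterior hn (sub_nonneg.2 hm) hc1 hc2
  have hint := nephroid_interior hω
  have hinv : (neB ζ)⁻¹ = ((U / W : ℝ) : ℂ) - ((y * (V / W) : ℝ) : ℂ) * Complex.I := by
    rw [Complex.inv_def, hWB, hB]
    apply Complex.ext <;> simp <;> ring
  have hpt : ω - ω ^ 3 / 3 = ((2 * x - 4 / 3 * x ^ 3 + (m - 1) * a : ℝ) : ℂ) +
      ((y * (4 / 3 * y ^ 2 + (m - 1) * β) : ℝ) : ℂ) * Complex.I := by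
    have e : ω - ω ^ 3 / 3 = ζ - ζ ^ 3 / 3 + (m - 1) * (1 + (ζ - ζ ^ 3 / 3) - (neB ζ)⁻¹) := by
      have hmul : neB ζ * (neB ζ)⁻¹ = 1 := mul_inv_cancel₀ hB0
      have : phiNe ω = phiNe ζ + (m - 1) * (phiNe ζ - (neB ζ)⁻¹) := by
        linear_combination (-(neB ζ)⁻¹) * h + (m * phiNe ζ - phiNe ω) * hmul
      rw [phiNe, phiNe] at this
      linear_combination this
    rw [e, nephroid_circle hζ, hinv, ← hx, ← hy, ha, hβ]
    push_cast
    ring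
  rw [hpt, Complex.normSq_add_mul_I] at hint
  simp only [Complex.add_im, Complex.ofReal_im, Complex.im_ofReal_mul, Complex.I_im, mul_one,
    zero_add] at hint
  exact hext.not_gt hint

/-! ### Structure of the class `𝒞_Ne` -/

/-- Schwarz functions: analytic self-maps of the unit disk that fix `0`. -/
structure IsSchwarz (w : ℂ → ℂ) : Prop where
  differentiableOn : DifferentiableOn ℂ w (ball 0 1)
  map_zero : w 0 = 0
  norm_lt_one : ∀ z ∈ ball (0 : ℂ) 1, ‖w z‖ < 1

theorem IsSchwarz.norm_le {w : ℂ → ℂ} (hw : IsSchwarz w) {z : ℂ} (hz : ‖z‖ < 1) : ‖w z‖ ≤ ‖z‖ :=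
  Complex.norm_le_norm_of_mapsTo_ball hw.differentiableOn
    (fun y hy => by simpa using (hw.norm_lt_one y hy).le) hw.map_zero hz

theorem IsSchwarz.eq_mul_of_norm_eq {w : ℂ → ℂ} (hw : IsSchwarz w) {z : ℂ} (hz0 : z ≠ 0)
    (hz : ‖z‖ < 1) (h : ‖w z‖ = ‖z‖) :
    ∃ x : ℂ, ‖x‖ = 1 ∧ ∀ z ∈ ball (0 : ℂ) 1, w z = x * z :=
  eq_mul_of_schwarz_norm_eq hw.differentiableOn hw.map_zero hw.norm_lt_one hz0 hz h

theorem ball_mem_nhds_of_norm_lt {z : ℂ} (hz : z ∈ ball (0 : ℂ) 1) : ball (0 : ℂ) 1 ∈ 𝓝 z :=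
  isOpen_ball.mem_nhds hz

/-- For `f` in the class, `f'` is an exponential, so in particular it has no zeros. -/
theorem exists_log_deriv {f : ℂ → ℂ} (hf : f ∈ ClassCNe) : ∃ L ω : ℂ → ℂ,
    DifferentiableOn ℂ L (ball 0 1) ∧ L 0 = 0 ∧
    (∀ z ∈ ball (0 : ℂ) 1, deriv f z = Complex.exp (L z)) ∧
    ∀ z ∈ ball (0 : ℂ) 1, ‖ω z‖ < 1 ∧ z * deriv L z = ω z - ω z ^ 3 / 3 := by
  obtain ⟨⟨hfd, hf0, hf1⟩, hJ, -, ω, -, hω0, hω1, hJω⟩ := hf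
  set J : ℂ → ℂ := fun z => 1 + z * deriv (deriv f) z / deriv f z with hJdef
  have h0 : (0 : ℂ) ∈ ball (0 : ℂ) 1 := by simp
  have hds : DifferentiableOn ℂ (dslope J 0) (ball 0 1) :=
    (Complex.differentiableOn_dslope (ball_mem_nhds_of_norm_lt h0)).2 hJ
  -- L is the primitive of (J - 1)/z with L(0) = 0, the candidate for log f'. It exists before
  -- anything is known about zeros of f'.
  obtain ⟨L, hL0, hL⟩ := hds.isExactOn_ball.with_val_at 0 0
  have hfd' : DifferentiableOn ℂ (deriv f) (ball 0 1) := hfd.deriv isOpen_ball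
  have hJ0 : J 0 = 1 := by simp [hJdef]
  have hLz : ∀ z ∈ ball (0 : ℂ) 1, z * deriv L z = J z - 1 := fun z hz => by
    rw [(hL z hz).deriv]
    have := sub_smul_dslope J 0 z
    rwa [sub_zero, smul_eq_mul, hJ0] at this
  set Φ : ℂ → ℂ := fun z => deriv f z * Complex.exp (-L z) with hΦ
  have hLd : DifferentiableOn ℂ L (ball 0 1) :=
    fun z hz => (hL z hz).differentiableAt.differentiableWithinAt
  have hΦd : DifferentiableOn ℂ Φ (ball 0 1) := hfd'.mul hLd.neg.cexp
  have hΦ' : ∀ z ∈ ball (0 : ℂ) 1, z ≠ 0 → deriv f z ≠ 0 → deriv Φ z = 0 := fun z hz hz0 hne => by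
    have h1 : HasDerivAt Φ (deriv (deriv f) z * Complex.exp (-L z) +
        deriv f z * (Complex.exp (-L z) * -deriv L z)) z :=
      ((hfd'.differentiableAt (ball_mem_nhds_of_norm_lt hz)).hasDerivAt).mul
        (hL z hz).differentiableAt.hasDerivAt.neg.cexp
    rw [h1.deriv]
    have h2 := hLz z hz
    simp only [hJdef, add_sub_cancel_left] at h2
    have h3 : deriv f z * deriv L z = deriv (deriv f) z := by
      apply mul_left_cancel₀ hz0
      rw [mul_left_comm, h2]
      field_simp
    linear_combination (-Complex.exp (-L z)) * h3
  -- Where f' = 0, division by zero makes J = 1 and the computation of Φ' fails. Near the origin f'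
  -- ≠ 0, and the identity theorem extends Φ' = 0 to the disk.
  have hne0 : ∀ᶠ z in 𝓝[≠] (0 : ℂ), deriv Φ z = 0 := by
    have hc : ContinuousAt (deriv f) 0 :=
      (hfd'.differentiableAt (ball_mem_nhds_of_norm_lt h0)).continuousAt
    have h1 : ∀ᶠ z in 𝓝 (0 : ℂ), deriv f z ≠ 0 := hc.eventually_ne (by simp [hf1])
    filter_upwards [nhdsWithin_le_nhds h1, nhdsWithin_le_nhds (ball_mem_nhds_of_norm_lt h0),
      self_mem_nhdsWithin] with z a b c
    exact hΦ' z b c a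
  have hΦan : AnalyticOnNhd ℂ (deriv Φ) (ball 0 1) :=
    (hΦd.deriv isOpen_ball).analyticOnNhd isOpen_ball
  have hΦ0 : EqOn (deriv Φ) 0 (ball 0 1) :=
    hΦan.eqOn_zero_of_preconnected_of_frequently_eq_zero
      (convex_ball (0 : ℂ) 1).isPreconnected h0 hne0.frequently
  have hconst : ∀ z ∈ ball (0 : ℂ) 1, Φ z = 1 := fun z hz => by
    have := isOpen_ball.is_const_of_deriv_eq_zero (convex_ball (0 : ℂ) 1).isPreconnected hΦd hΦ0
      hz h0
    rw [this, hΦ]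
    simp [hf1, hL0]
  refine ⟨L, ω, hLd, hL0, fun z hz => ?_, fun z hz => ⟨hω1 z hz, ?_⟩⟩
  · have h1 := hconst z hz
    have he : Complex.exp (L z) * Complex.exp (-L z) = 1 := by rw [← Complex.exp_add]; simp
    simp only [hΦ] at h1
    linear_combination Complex.exp (L z) * h1 - deriv f z * he
  · rw [hLz z hz, hJω z hz, phiNe]; ring

theorem differentiableOn_dslope_zero {f : ℂ → ℂ} (hf : DifferentiableOn ℂ f (ball 0 1)) :
    DifferentiableOn ℂ (dslope f 0) (ball 0 1) :=
  (Complex.differentiableOn_dslope (ball_mem_nhds_of_norm_lt (by simp))).2 hf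

theorem mul_dslope_zero {f : ℂ → ℂ} (hf0 : f 0 = 0) (z : ℂ) : z * dslope f 0 z = f z := by
  have := sub_smul_dslope f 0 z
  rwa [hf0, sub_zero, sub_zero, smul_eq_mul] at this

theorem mul_deriv_dslope_zero {f : ℂ → ℂ} (hf : DifferentiableOn ℂ f (ball 0 1)) (hf0 : f 0 = 0)
    {z : ℂ} (hz : z ∈ ball (0 : ℂ) 1) :
    z * deriv (dslope f 0) z = deriv f z - dslope f 0 z := by
  have h1 : HasDerivAt (fun z => z * dslope f 0 z)
      (1 * dslope f 0 z + z * deriv (dslope f 0) z) z :=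
    (hasDerivAt_id' z).mul ((differentiableOn_dslope_zero hf).differentiableAt
      (ball_mem_nhds_of_norm_lt hz)).hasDerivAt
  have h2 : (fun z => z * dslope f 0 z) = f := funext (mul_dslope_zero hf0)
  rw [h2] at h1
  rw [h1.deriv]
  ring

theorem idQuot_eq_dslope {f : ℂ → ℂ} (hf0 : f 0 = 0) (hf1 : deriv f 0 = 1) :
    idQuot f = dslope f 0 := by
  funext z
  rw [idQuot]
  split_ifs with h
  · rw [h, dslope_same, hf1]
  · rw [dslope_of_ne _ h, slope_def_field, hf0, sub_zero, sub_zero]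

theorem idQuot_neHat : idQuot neHat = neK :=
  idQuot_eq_dslope neHat_zero (by rw [deriv_neHat, neExp_zero, Complex.exp_zero])

theorem starQuot_neHat {z : ℂ} (hz : ‖z‖ ≤ 1) : starQuot neHat z = (neB z)⁻¹ := by
  rw [starQuot]
  split_ifs with h
  · rw [h, neB_zero, inv_one]
  · have := neK_ne_zero hz
    rw [deriv_neHat, ← mul_neK, neB, Complex.exp_neg]
    have he := Complex.exp_ne_zero (neExp z)
    field_simp

theorem differentiableOn_inv_neB : DifferentiableOn ℂ (fun z => (neB z)⁻¹) (ball 0 1) :=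
  fun z hz => ((differentiable_neB z).inv
    (neB_ne_zero (by simpa using (mem_ball_zero_iff.1 hz).le))).differentiableWithinAt

/-- For the boundary point q = ζ - ζ³/3 with y = Im ζ, |mq|² - 4/9 = (m²-1)(4/9) + m²(4/3)y². Its
cube is at least m⁶((4/3)y²)³, hence at least m²((4/3)y²)³ = (4/3)(Im mq)², so mq violates
`nephroid_interior`. -/
theorem neExp_no_contact {ω ζ : ℂ} {m : ℝ} (hω : ‖ω‖ < 1) (hζ : ‖ζ‖ = 1) (hm : 1 ≤ m)
    (h : ω - ω ^ 3 / 3 = m * (ζ - ζ ^ 3 / 3)) : False := by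
  have hint := nephroid_interior hω
  have hn := sq_add_sq_of_norm_eq_one hζ
  set x := ζ.re
  set y := ζ.im
  have hx2 : x ^ 2 = 1 - y ^ 2 := by linarith
  have e : (m : ℂ) * (ζ - ζ ^ 3 / 3) = ((m * (2 * x - 4 / 3 * x ^ 3) : ℝ) : ℂ) +
      ((m * (y * (4 / 3 * y ^ 2)) : ℝ) : ℂ) * Complex.I := by
    rw [nephroid_circle hζ]; push_cast; ring
  rw [h, e, Complex.normSq_add_mul_I] at hint
  simp only [Complex.add_im, Complex.ofReal_im, Complex.im_ofReal_mul, Complex.I_im, mul_one,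
    zero_add] at hint
  have hm2 : 1 ≤ m ^ 2 := one_le_pow₀ hm
  have hS : (m * (2 * x - 4 / 3 * x ^ 3)) ^ 2 + (m * (y * (4 / 3 * y ^ 2))) ^ 2 - 4 / 9 =
      (m ^ 2 - 1) * (4 / 9) + m ^ 2 * (4 / 3 * y ^ 2) := by
    have : (2 * x - 4 / 3 * x ^ 3) ^ 2 = (1 - y ^ 2) * (2 / 3 + 4 / 3 * y ^ 2) ^ 2 := by
      have e' : (2 * x - 4 / 3 * x ^ 3) ^ 2 = x ^ 2 * (2 - 4 / 3 * x ^ 2) ^ 2 := by ring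
      rw [e', hx2]; ring
    rw [mul_pow, this]; ring
  rw [hS] at hint
  have h1 : m ^ 2 * (4 / 3 * y ^ 2) ≤ (m ^ 2 - 1) * (4 / 9) + m ^ 2 * (4 / 3 * y ^ 2) := by
    linarith
  have h2 := pow_le_pow_left₀ (by positivity) h1 3
  have h3 : 4 / 3 * (m * (y * (4 / 3 * y ^ 2))) ^ 2 = m ^ 2 * (4 / 3 * y ^ 2) ^ 3 := by ring
  have h4 : m ^ 2 * (4 / 3 * y ^ 2) ^ 3 ≤ (m ^ 2 * (4 / 3 * y ^ 2)) ^ 3 := by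
    rw [mul_pow (m ^ 2)]
    gcongr
    calc m ^ 2 = (m ^ 2) ^ 1 := by ring
      _ ≤ (m ^ 2) ^ 3 := pow_le_pow_right₀ hm2 (by norm_num)
  rw [h3] at hint
  exact (h4.trans h2).not_gt hint

/-- `f' ≺ neHat'`, in logarithmic form. -/
theorem exists_schwarz_deriv {f : ℂ → ℂ} (hf : f ∈ ClassCNe) : ∃ w, IsSchwarz w ∧
    ∀ z ∈ ball (0 : ℂ) 1, deriv f z = Complex.exp (neExp (w z)) := by
  obtain ⟨L, ω, hLd, hL0, hfL, hω⟩ := exists_log_deriv hf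
  obtain ⟨w, hw1, hw2, hw3, hw4⟩ := exists_schwarz_of_no_contact differentiable_neExp
    (fun z hz => by
      rw [(hasDerivAt_neExp z).deriv]
      have h1 : ‖z‖ ^ 2 ≤ 1 := pow_le_one₀ (norm_nonneg _) (by simpa using hz)
      have h2 : (z ^ 2 / 3).re ≤ ‖z ^ 2 / 3‖ := Complex.re_le_norm _
      rw [norm_div, norm_pow, RCLike.norm_ofNat] at h2
      rw [Complex.sub_re, Complex.one_re]
      linarith) hLd (by rw [hL0, neExp_zero]) (fun z₀ ζ₀ m hz hζ hm h1 h2 => by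
      obtain ⟨h3, h4⟩ := hω z₀ (by simpa using hz)
      rw [h4, (hasDerivAt_neExp ζ₀).deriv] at h2
      exact neExp_no_contact h3 hζ hm (by rw [h2]; ring))
  exact ⟨w, ⟨hw1, hw2, hw3⟩, fun z hz => by rw [hfL z hz, hw4 z hz]⟩

/-- `f(z) / (z f'(z)) ≺ neB`. -/
theorem exists_schwarz_neB {f : ℂ → ℂ} (hf : f ∈ ClassCNe) : ∃ w, IsSchwarz w ∧
    ∀ z ∈ ball (0 : ℂ) 1, dslope f 0 z = deriv f z * neB (w z) := by
  obtain ⟨L, ω, hLd, hL0, hfL, hω⟩ := exists_log_deriv hf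
  obtain ⟨⟨hfd, hf0, hf1⟩, -⟩ := hf
  have hbd : DifferentiableOn ℂ (fun z => -(dslope f 0 z * Complex.exp (-L z))) (ball 0 1) :=
    ((differentiableOn_dslope_zero hfd).mul hLd.neg.cexp).neg
  -- The signs are reversed because Re B' < 0, whereas the contact lemma asks for a positive real
  -- part.
  obtain ⟨w, hw1, hw2, hw3, hw4⟩ := exists_schwarz_of_no_contact
    (g := fun z => -neB z) (p := fun z => -(dslope f 0 z * Complex.exp (-L z)))
    differentiable_neB.neg (fun z hz => by
      rw [deriv.fun_neg, Complex.neg_re]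
      linarith [deriv_neB_re_neg (mem_closedBall_zero_iff.1 hz)]) hbd
    (by simp [hf1, hL0, neB_zero]) (fun z₀ ζ₀ m hz hζ hm h1 h2 => by
      have hz' : z₀ ∈ ball (0 : ℂ) 1 := by simpa using hz
      obtain ⟨h3, h4⟩ := hω z₀ hz'
      have hnhds := ball_mem_nhds_of_norm_lt hz'
      have h5 := ((((differentiableOn_dslope_zero hfd).differentiableAt hnhds).hasDerivAt).mul
        (hLd.differentiableAt hnhds).hasDerivAt.neg.cexp).neg
      have h6 : deriv (fun z => -(dslope f 0 z * Complex.exp (-L z))) z₀ = _ := h5.deriv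
      rw [h6, deriv.fun_neg, Pi.neg_apply] at h2
      -- Both b = f/(zf') and B satisfy equations of the form zu' = 1 - φu, with φ(ω z₀) and φ(ζ₀)
      -- as coefficients; substituting the contact relations gives the required identity.
      refine no_contact_neB h3 hζ hm ?_
      have h7 := mul_deriv_dslope_zero hfd hf0 hz'
      rw [hfL z₀ hz'] at h7
      have he : Complex.exp (L z₀) * Complex.exp (-L z₀) = 1 := by rw [← Complex.exp_add]; simp
      have h8 := mul_deriv_neB ζ₀
      have h9 : phiNe (ω z₀) = 1 + z₀ * deriv L z₀ := by rw [h4, phiNe]; ring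
      rw [h9]
      linear_combination -h2 - (1 + z₀ * deriv L z₀) * h1 + m * h8
        - Complex.exp (-L z₀) * h7 - he)
  refine ⟨w, ⟨hw1, hw2, hw3⟩, fun z hz => ?_⟩
  have h := hw4 z hz
  have he : Complex.exp (L z) * Complex.exp (-L z) = 1 := by rw [← Complex.exp_add]; simp
  rw [hfL z hz]
  linear_combination -Complex.exp (L z) * h - dslope f 0 z * he

theorem injOn_neB : InjOn neB (closedBall 0 1) := by
  intro x hx y hy h
  refine injOn_of_deriv_re_pos (g := fun z => -neB z) (convex_closedBall (0 : ℂ) 1)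
    (fun z _ => (differentiable_neB z).hasDerivAt.neg) (fun z hz => ?_) hx hy (by simp [h])
  rw [Complex.neg_re]
  linarith [deriv_neB_re_neg (mem_closedBall_zero_iff.1 hz)]

/-- `f(z) / z ≺ neK`. -/
theorem exists_schwarz_neK {f : ℂ → ℂ} (hf : f ∈ ClassCNe) : ∃ w, IsSchwarz w ∧
    ∀ z ∈ ball (0 : ℂ) 1, dslope f 0 z = neK (w z) := by
  obtain ⟨w₂, hw₂, hB⟩ := exists_schwarz_neB hf
  obtain ⟨⟨hfd, hf0, hf1⟩, -⟩ := hf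
  obtain ⟨w, hw1, hw2, hw3, hw4⟩ := exists_schwarz_of_no_contact differentiable_neK
    (fun z hz => deriv_neK_re_pos (mem_closedBall_zero_iff.1 hz))
    (differentiableOn_dslope_zero hfd) (by rw [dslope_same, hf1, neK_zero])
    (fun z₀ ζ₀ m hz hζ hm h1 h2 => by
      have hz' : z₀ ∈ ball (0 : ℂ) 1 := by simpa using hz
      have hK := neK_ne_zero hζ.le
      have hBζ := neB_ne_zero hζ.le
      have hw2lt := hw₂.norm_lt_one z₀ hz'
      have hBw := neB_ne_zero hw2lt.le
      have h3 := hB z₀ hz'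
      rw [mul_deriv_dslope_zero hfd hf0 hz', mul_deriv_neK] at h2
      have h4 : deriv f z₀ = neK ζ₀ * (neB (w₂ z₀))⁻¹ := by
        rw [← h1, h3]; field_simp
      have h5 : Complex.exp (neExp ζ₀) = neK ζ₀ * (neB ζ₀)⁻¹ := by
        rw [neB, Complex.exp_neg]
        have he := Complex.exp_ne_zero (neExp ζ₀)
        field_simp
      have h6 : (neB (w₂ z₀))⁻¹ - 1 = m * ((neB ζ₀)⁻¹ - 1) := by
        apply mul_left_cancel₀ hK
        rw [h4, h5, h1] at h2
        linear_combination h2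
      have hm0 : 0 < m := by linarith
      -- By `h6`, dividing the value at w₂ z₀ by m ≥ 1 gives 1/B(ζ₀) - 1. Starlikeness produces a
      -- point ζ with |ζ| ≤ |w₂ z₀| < 1 and the same value, against the injectivity of B on the
      -- closed disk.
      obtain ⟨ζ, hζ1, hζ2⟩ := exists_mul_eq_of_starlike (g := fun z => (neB z)⁻¹ - 1)
        (fun z hz => (((differentiable_neB.analyticAt z).inv
          (neB_ne_zero (mem_closedBall_zero_iff.1 hz)))).sub analyticAt_const)
        (fun z hz hz0 => inv_neB_starlike (mem_closedBall_zero_iff.1 hz) hz0)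
        (by simp [neB_zero]) hw2lt.le (c := m⁻¹)
        ⟨by positivity, inv_le_one_of_one_le₀ hm⟩
      have hmc : (m : ℂ) ≠ 0 := by exact_mod_cast hm0.ne'
      have h7 : (neB ζ)⁻¹ = (neB ζ₀)⁻¹ := by
        rw [h6] at hζ2
        push_cast at hζ2
        rw [inv_mul_cancel_left₀ hmc] at hζ2
        linear_combination hζ2
      have h8 : ζ = ζ₀ := injOn_neB (by simpa using hζ1.trans hw2lt.le) (by simp [hζ])
        (inv_injective h7)
      rw [h8, hζ] at hζ1
      linarith)
  exact ⟨w, ⟨hw1, hw2, hw3⟩, hw4⟩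

/-! ### The subordination theorem -/

theorem subordinate_starQuot {f : ℂ → ℂ} (hf : f ∈ ClassCNe) :
    Subordinate (starQuot f) (starQuot neHat) := by
  obtain ⟨w₁, hw₁, hE⟩ := exists_schwarz_deriv hf
  obtain ⟨w, hw, hB⟩ := exists_schwarz_neB hf
  obtain ⟨⟨hfd, hf0, hf1⟩, -⟩ := hf
  have hlt : ∀ {z : ℂ}, z ∈ ball (0 : ℂ) 1 → ‖w z‖ ≤ 1 := fun hz => (hw.norm_lt_one _ hz).le
  have hq : ∀ z ∈ ball (0 : ℂ) 1, starQuot f z = (neB (w z))⁻¹ := fun z hz => by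
    rw [starQuot]
    split_ifs with h
    · rw [h, hw.map_zero, neB_zero, inv_one]
    · rw [← mul_dslope_zero hf0, hB z hz, hE z hz]
      have := neB_ne_zero (hlt hz)
      have := Complex.exp_ne_zero (neExp (w₁ z))
      field_simp
  refine ⟨?_, ?_, w, hw.differentiableOn, hw.map_zero, hw.norm_lt_one, fun z hz => ?_⟩
  · refine (differentiableOn_inv_neB.comp hw.differentiableOn fun z hz => ?_).congr hq
    simpa using hw.norm_lt_one z hz
  · exact differentiableOn_inv_neB.congr fun z hz => starQuot_neHat (mem_ball_zero_iff.1 hz).le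
  · rw [hq z hz, starQuot_neHat (hlt hz)]

theorem subordinate_idQuot {f : ℂ → ℂ} (hf : f ∈ ClassCNe) :
    Subordinate (idQuot f) (idQuot neHat) := by
  obtain ⟨w, hw, hK⟩ := exists_schwarz_neK hf
  obtain ⟨⟨hfd, hf0, hf1⟩, -⟩ := hf
  rw [idQuot_neHat, idQuot_eq_dslope hf0 hf1]
  exact ⟨differentiableOn_dslope_zero hfd, differentiable_neK.differentiableOn, w,
    hw.differentiableOn, hw.map_zero, hw.norm_lt_one, hK⟩

/-! ### Growth of the extremal functions on circles -/

theorem sub_cube_strictMonoOn : StrictMonoOn (fun x : ℝ => x - x ^ 3 / 9) (Icc (-1) 1) := by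
  have hd : ∀ x : ℝ, HasDerivAt (fun x : ℝ => x - x ^ 3 / 9) (1 - x ^ 2 / 3) x := fun x =>
    ((hasDerivAt_id' x).sub ((hasDerivAt_pow 3 x).div_const 9)).congr_deriv (by push_cast; ring)
  apply strictMonoOn_of_deriv_pos (convex_Icc _ _)
  · exact fun x _ => (hd x).continuousAt.continuousWithinAt
  · intro x hx
    rw [interior_Icc] at hx
    rw [(hd x).deriv]
    nlinarith [hx.1, hx.2]

/-- With x = Re ζ and r = |ζ|, the right side minus the left is (r - x)(1 - (r + 2x)²/9), and |r +
2x| ≤ 3. -/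
theorem neExp_re_le {ζ : ℂ} (hζ : ‖ζ‖ ≤ 1) : (neExp ζ).re ≤ ‖ζ‖ - ‖ζ‖ ^ 3 / 9 := by
  have e : (neExp ζ).re = ζ.re - ζ.re ^ 3 / 9 + ζ.re * ζ.im ^ 2 / 3 := by
    rw [neExp, Complex.sub_re, Complex.div_ofNat_re]
    simp [pow_succ]; ring
  have hn : ζ.im ^ 2 = ‖ζ‖ ^ 2 - ζ.re ^ 2 := by
    rw [Complex.sq_norm, Complex.normSq_apply]; ring
  have hx := abs_le.1 (Complex.abs_re_le_norm ζ)
  rw [e, hn]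
  set x := ζ.re
  set r := ‖ζ‖
  have hr : 0 ≤ r := norm_nonneg ζ
  have hx2 : x ^ 2 ≤ r ^ 2 := sq_le_sq' hx.1 hx.2
  have hr2 : r ^ 2 ≤ 1 := pow_le_one₀ hr hζ
  have hq : 0 ≤ 1 - 1 / 9 * (r ^ 2 + 4 * x * r + 4 * x ^ 2) := by
    nlinarith [sq_nonneg (x - r)]
  have := mul_nonneg (sub_nonneg.2 hx.2) hq
  nlinarith

theorem neExp_neg (z : ℂ) : neExp (-z) = -neExp z := by rw [neExp, neExp]; ring

theorem neExp_re_le_of_norm_le {ζ : ℂ} {r : ℝ} (h : ‖ζ‖ ≤ r) (hr : r ≤ 1) :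
    (neExp ζ).re ≤ r - r ^ 3 / 9 ∧ ((neExp ζ).re = r - r ^ 3 / 9 → ‖ζ‖ = r) := by
  have h0 := norm_nonneg ζ
  have h1 := neExp_re_le (h.trans hr)
  have hm : ‖ζ‖ < r → ‖ζ‖ - ‖ζ‖ ^ 3 / 9 < r - r ^ 3 / 9 := fun hlt =>
    sub_cube_strictMonoOn (mem_Icc.2 ⟨by linarith, by linarith⟩)
      (mem_Icc.2 ⟨by linarith, hr⟩) hlt
  rcases h.eq_or_lt with heq | hlt
  · exact ⟨heq ▸ h1, fun _ => heq⟩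
  · exact ⟨(h1.trans_lt (hm hlt)).le, fun he => by linarith [hm hlt]⟩

theorem deriv_neHat_ofReal_re (r : ℝ) : (deriv neHat (r : ℂ)).re = Real.exp (r - r ^ 3 / 9) := by
  rw [deriv_neHat, neExp_ofReal, ← Complex.ofReal_exp, Complex.ofReal_re]

theorem deriv_neHat_neg_ofReal_re (r : ℝ) :
    (deriv neHat (-(r : ℂ))).re = Real.exp (-(r - r ^ 3 / 9)) := by
  rw [← Complex.ofReal_neg, deriv_neHat_ofReal_re]
  congr 1; ring

theorem neHat_ofReal_re (r : ℝ) : (neHat (r : ℂ)).re = r * (neK r).re := by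
  rw [← mul_neK, Complex.re_ofReal_mul]

theorem neg_neHat_neg_ofReal_re (r : ℝ) :
    (-neHat (-(r : ℂ))).re = r * (neK (-(r : ℂ))).re := by
  rw [← mul_neK, neg_mul, neg_neg, Complex.re_ofReal_mul]

theorem neHat_conj (z : ℂ) : neHat (conj z) = conj (neHat z) := by
  have h1 : ∀ z, HasDerivAt (conj ∘ neHat ∘ conj) (Complex.exp (neExp z)) z := fun z => by
    have := (hasDerivAt_neHat (conj z)).conj_conj
    rw [Complex.conj_conj] at this
    exact this.congr_deriv (by rw [← Complex.exp_conj]; simp [neExp, Complex.conj_ofNat])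
  have h2 : EqOn (conj ∘ neHat ∘ conj) neHat univ :=
    isOpen_univ.eqOn_of_deriv_eq isPreconnected_univ
      (fun z _ => (h1 z).differentiableAt.differentiableWithinAt)
      differentiable_neHat.differentiableOn
      (fun z _ => by rw [(h1 z).deriv, deriv_neHat]) (mem_univ 0) (by simp [neHat_zero])
  have := h2 (mem_univ z)
  simp only [Function.comp_apply] at this
  rw [← this, Complex.conj_conj]

theorem neK_conj (z : ℂ) : neK (conj z) = conj (neK z) := by
  rcases eq_or_ne z 0 with rfl | hz
  · simp [neK_zero]
  · apply mul_left_cancel₀ ((map_ne_zero conj).2 hz)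
    rw [mul_neK, ← map_mul, mul_neK, neHat_conj]

theorem neK_ofReal (x : ℝ) : neK x = ((neK x).re : ℂ) :=
  Complex.ext (by simp) (by simp [neK_ofReal_im])

theorem abs_le_one_of_mem_Icc {x : ℝ} (hx : x ∈ Icc (-1 : ℝ) 1) : ‖(x : ℂ)‖ ≤ 1 := by
  rw [Complex.norm_real, Real.norm_eq_abs]
  exact abs_le.2 hx

theorem neK_ofReal_strictMonoOn : StrictMonoOn (fun x : ℝ => (neK x).re) (Icc (-1) 1) := by
  have hd : ∀ x : ℝ, HasDerivAt (fun x : ℝ => (neK x).re) (deriv neK x).re x := fun x => by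
    have := hasDerivAt_comp_ray (g := neK) (b := 1) (t := x)
      (by rw [mul_one]; exact (differentiable_neK x).hasDerivAt)
    simp only [mul_one] at this
    exact hasDerivAt_re this
  apply strictMonoOn_of_deriv_pos (convex_Icc _ _)
  · exact fun x _ => (hd x).continuousAt.continuousWithinAt
  · intro x hx
    rw [interior_Icc] at hx
    rw [(hd x).deriv]
    exact deriv_neK_re_pos (abs_le_one_of_mem_Icc (Ioo_subset_Icc_self hx))

theorem mul_deriv_neK_div {z : ℂ} (hz : ‖z‖ ≤ 1) :
    z * deriv neK z / neK z = (neB z)⁻¹ - 1 := by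
  have h := neK_ne_zero hz
  rw [mul_deriv_neK, neB, Complex.exp_neg]
  have he := Complex.exp_ne_zero (neExp z)
  field_simp

theorem inv_neB_im_pos {z : ℂ} (hz : ‖z‖ ≤ 1) (him : 0 < z.im) : 0 < ((neB z)⁻¹ - 1).im := by
  rw [Complex.sub_im, Complex.inv_im, Complex.one_im, sub_zero]
  exact div_pos (neg_pos.2 (neB_im_neg hz him)) (Complex.normSq_pos.2 (neB_ne_zero hz))

/-- The derivative of |K|² in θ is -2|K|² Im(zK'/K), and zK'/K = 1/B - 1 has positive imaginary part
in the upper half disk. -/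
theorem antitoneOn_norm_neK_circle {r : ℝ} (hr0 : 0 < r) (hr : r ≤ 1) :
    AntitoneOn (fun θ : ℝ => ‖neK (r * Complex.exp (θ * Complex.I))‖ ^ 2) (Icc 0 Real.pi) := by
  have hn : ∀ θ : ℝ, ‖(r : ℂ) * Complex.exp (θ * Complex.I)‖ ≤ 1 := fun θ => by
    rw [norm_mul, Complex.norm_exp_ofReal_mul_I, mul_one, Complex.norm_real, Real.norm_eq_abs,
      abs_of_pos hr0]
    exact hr
  have hd : ∀ θ : ℝ, HasDerivAt (fun θ : ℝ => ‖neK (r * Complex.exp (θ * Complex.I))‖ ^ 2)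
      (-2 * (Complex.normSq (neK (r * Complex.exp (θ * Complex.I))) *
        ((neB (r * Complex.exp (θ * Complex.I)))⁻¹ - 1).im)) θ := fun θ => by
    have he : HasDerivAt (fun θ : ℝ => (r : ℂ) * Complex.exp (θ * Complex.I))
        (r * (Complex.exp (θ * Complex.I) * Complex.I)) θ :=
      (hasDerivAt_comp_ray (g := Complex.exp) (b := Complex.I)
        (Complex.hasDerivAt_exp _)).const_mul (r : ℂ)
    set ζ := (r : ℂ) * Complex.exp (θ * Complex.I) with hζ
    have h := (HasDerivAt.comp θ (differentiable_neK ζ).hasDerivAt he).norm_sq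
    refine h.congr_deriv ?_
    have hK : neK ζ ≠ 0 := neK_ne_zero (hn θ)
    have e : deriv neK ζ * (r * (Complex.exp (θ * Complex.I) * Complex.I)) =
        neK ζ * ((neB ζ)⁻¹ - 1) * Complex.I := by
      rw [← mul_deriv_neK_div (hn θ), ← mul_assoc (r : ℂ), ← hζ]
      field_simp
    rw [e, Complex.inner, Function.comp_apply, ← hζ]
    simp only [Complex.mul_re, Complex.mul_im, Complex.conj_re, Complex.conj_im, Complex.I_re,
      Complex.I_im, Complex.normSq_apply]
    ring
  apply antitoneOn_of_deriv_nonpos (convex_Icc _ _)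
  · exact fun θ _ => (hd θ).continuousAt.continuousWithinAt
  · exact fun θ _ => (hd θ).differentiableAt.differentiableWithinAt
  · intro θ hθ
    rw [interior_Icc] at hθ
    rw [(hd θ).deriv]
    have him : 0 < ((r : ℂ) * Complex.exp (θ * Complex.I)).im := by
      rw [Complex.im_ofReal_mul, Complex.exp_ofReal_mul_I_im]
      exact mul_pos hr0 (Real.sin_pos_of_mem_Ioo hθ)
    have := mul_nonneg (Complex.normSq_nonneg (neK (r * Complex.exp (θ * Complex.I))))
      (inv_neB_im_pos (hn θ) him).le
    linarith

theorem neK_neg_norm_le_norm {ζ : ℂ} (hζ : ‖ζ‖ ≤ 1) :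
    (neK (-(‖ζ‖ : ℂ))).re ≤ ‖neK ζ‖ ∧ ‖neK ζ‖ ≤ (neK (‖ζ‖ : ℂ)).re := by
  rcases eq_or_ne ζ 0 with rfl | h0
  · simp [neK_zero]
  have hr0 : 0 < ‖ζ‖ := norm_pos_iff.2 h0
  wlog him : 0 ≤ ζ.im generalizing ζ
  · have := this (ζ := conj ζ) (by simpa using hζ) (by simpa using h0) (by simpa using hr0)
      (by simp only [Complex.conj_im]; linarith)
    rwa [neK_conj, Complex.norm_conj, Complex.norm_conj] at this
  have hanti := antitoneOn_norm_neK_circle hr0 hζ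
  have hpi := Real.pi_pos.le
  have harg : ζ.arg ∈ Icc 0 Real.pi := ⟨Complex.arg_nonneg_iff.2 him, Complex.arg_le_pi ζ⟩
  have h1 := hanti harg (right_mem_Icc.2 hpi) harg.2
  have h2 := hanti (left_mem_Icc.2 hpi) harg harg.1
  simp only [Complex.norm_mul_exp_arg_mul_I, Complex.exp_pi_mul_I, Complex.ofReal_zero, zero_mul,
    Complex.exp_zero, mul_one, mul_neg] at h1 h2
  have hre : ∀ x : ℝ, x ∈ Icc (-1 : ℝ) 1 → ‖neK x‖ = (neK x).re := fun x hx => by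
    rw [neK_ofReal, Complex.norm_real, Real.norm_eq_abs, Complex.ofReal_re,
      abs_of_pos (neK_re_pos (abs_le_one_of_mem_Icc hx))]
  have h3 := hre (-‖ζ‖) ⟨by linarith, by linarith⟩
  have h4 := hre ‖ζ‖ ⟨by linarith, hζ⟩
  rw [Complex.ofReal_neg] at h3
  rw [← h3, ← h4]
  exact ⟨le_of_sq_le_sq h1 (norm_nonneg _), le_of_sq_le_sq h2 (norm_nonneg _)⟩

theorem neK_norm_bounds {ζ : ℂ} {r : ℝ} (h : ‖ζ‖ ≤ r) (hr : r ≤ 1) :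
    ((neK (-(r : ℂ))).re ≤ ‖neK ζ‖ ∧ ‖neK ζ‖ ≤ (neK (r : ℂ)).re) ∧
    (‖neK ζ‖ = (neK (-(r : ℂ))).re → ‖ζ‖ = r) ∧ (‖neK ζ‖ = (neK (r : ℂ)).re → ‖ζ‖ = r) := by
  have h0 := norm_nonneg ζ
  obtain ⟨h1, h2⟩ := neK_neg_norm_le_norm (h.trans hr)
  rcases h.eq_or_lt with heq | hlt
  · rw [heq] at h1 h2
    exact ⟨⟨h1, h2⟩, fun _ => heq, fun _ => heq⟩
  · have h3 := neK_ofReal_strictMonoOn (mem_Icc.2 ⟨by linarith, by linarith⟩)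
      (mem_Icc.2 ⟨by linarith, hr⟩) hlt
    have h4 := neK_ofReal_strictMonoOn (mem_Icc.2 ⟨by linarith, by linarith⟩)
      (mem_Icc.2 ⟨by linarith, by linarith⟩) (neg_lt_neg hlt)
    simp only [Complex.ofReal_neg] at h3 h4
    exact ⟨⟨by linarith, by linarith⟩, fun h => by linarith, fun h => by linarith⟩

/-! ### The argument of the extremal function -/

theorem neK_mem_slitPlane {z : ℂ} (hz : ‖z‖ ≤ 1) : neK z ∈ Complex.slitPlane :=
  Or.inl (neK_re_pos hz)

/-- The derivative of arg K(tζ), multiplied by t, is Im(zK'/K) = Im(1/B - 1) at z = tζ, positive in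
the upper half disk. -/
theorem strictMonoOn_arg_neK_ray {ζ : ℂ} (hζ : ‖ζ‖ ≤ 1) (him : 0 < ζ.im) :
    StrictMonoOn (fun t : ℝ => Complex.arg (neK (t * ζ))) (Icc 0 1) := by
  have hd : ∀ t ∈ Icc (0 : ℝ) 1, HasDerivAt (fun t : ℝ => Complex.arg (neK (t * ζ)))
      (deriv neK (t * ζ) * ζ / neK (t * ζ)).im t := fun t ht => by
    have h1 := (hasDerivAt_comp_ray (b := ζ) (differentiable_neK (t * ζ)).hasDerivAt).clog_real
      (neK_mem_slitPlane (norm_ofReal_mul_le hζ ht))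
    have e : (fun t : ℝ => Complex.arg (neK (t * ζ))) =
        fun t : ℝ => (Complex.log (neK (t * ζ))).im := by
      funext t; rw [Complex.log_im]
    rw [e]
    exact Complex.imCLM.hasFDerivAt.comp_hasDerivAt t h1
  apply strictMonoOn_of_deriv_pos (convex_Icc _ _)
  · exact fun t ht => (hd t ht).continuousAt.continuousWithinAt
  · intro t ht
    rw [interior_Icc] at ht
    have ht' := Ioo_subset_Icc_self ht
    have hn := norm_ofReal_mul_le hζ ht'
    rw [(hd t ht').deriv]
    have ht0 : (t : ℂ) ≠ 0 := by exact_mod_cast ht.1.ne'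
    have e : deriv neK (t * ζ) * ζ / neK (t * ζ) = (t⁻¹ : ℝ) * ((neB (t * ζ))⁻¹ - 1) := by
      rw [← mul_deriv_neK_div hn]
      push_cast
      field_simp
    rw [e, Complex.im_ofReal_mul]
    refine mul_pos (inv_pos.2 ht.1) (inv_neB_im_pos hn ?_)
    rw [Complex.im_ofReal_mul]
    exact mul_pos ht.1 him

theorem arg_neK_pos {ζ : ℂ} (hζ : ‖ζ‖ ≤ 1) (him : 0 < ζ.im) : 0 < Complex.arg (neK ζ) := by
  have := strictMonoOn_arg_neK_ray hζ him (left_mem_Icc.2 zero_le_one)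
    (right_mem_Icc.2 zero_le_one) one_pos
  simpa [neK_zero] using this

theorem abs_arg_neK_conj {ζ : ℂ} (hζ : ‖ζ‖ ≤ 1) :
    |Complex.arg (neK (conj ζ))| = |Complex.arg (neK ζ)| := by
  rw [neK_conj, Complex.arg_conj, if_neg, abs_neg]
  exact Complex.slitPlane_arg_ne_pi (neK_mem_slitPlane hζ)

/-- In the upper half disk ζ is pushed outwards along its ray to |ζ| = r, which raises arg K
strictly unless |ζ| = r already. On the real axis arg K vanishes, while M > 0 because of the point
ri. -/
theorem abs_arg_neK_le {ζ : ℂ} {r M : ℝ} (h : ‖ζ‖ ≤ r) (hr0 : 0 < r) (hr : r ≤ 1)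
    (hM : M ∈ upperBounds ((fun ζ => Complex.arg (neK ζ)) '' sphere 0 r)) :
    |Complex.arg (neK ζ)| ≤ M ∧ (|Complex.arg (neK ζ)| = M → ‖ζ‖ = r) := by
  wlog him : 0 ≤ ζ.im generalizing ζ
  · have := this (ζ := conj ζ) (by simpa using h) (by simp only [Complex.conj_im]; linarith)
    rwa [abs_arg_neK_conj (h.trans hr), Complex.norm_conj] at this
  rcases him.eq_or_lt with h0 | hpos
  · have hz : ζ = ((ζ.re : ℝ) : ℂ) := Complex.ext (by simp) (by simp [← h0])
    have hK : Complex.arg (neK ζ) = 0 := by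
      have hp := neK_re_pos (h.trans hr)
      rw [hz] at hp ⊢
      rw [neK_ofReal]
      exact Complex.arg_ofReal_of_nonneg hp.le
    have hri : ‖(r : ℂ) * Complex.I‖ = r := by simp [abs_of_pos hr0]
    have hMpos : 0 < M := (arg_neK_pos (ζ := r * Complex.I) (by rw [hri]; exact hr)
      (by simpa using hr0)).trans_le (hM ⟨_, by simp [abs_of_pos hr0], rfl⟩)
    rw [hK, abs_zero]
    exact ⟨hMpos.le, fun he => absurd he hMpos.ne⟩
  · have hζ0 : 0 < ‖ζ‖ := norm_pos_iff.2 fun h => by simp [h] at hpos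
    set ζ' : ℂ := ((r / ‖ζ‖ : ℝ) : ℂ) * ζ with hζ'
    have hn : ‖ζ'‖ = r := by
      rw [hζ', norm_mul, Complex.norm_real, Real.norm_eq_abs, abs_of_pos (by positivity)]
      field_simp
    have him' : 0 < ζ'.im := by
      rw [hζ', Complex.im_ofReal_mul]; positivity
    have ht : ζ = ((‖ζ‖ / r : ℝ) : ℂ) * ζ' := by
      rw [hζ', ← mul_assoc, ← Complex.ofReal_mul]
      have : ‖ζ‖ / r * (r / ‖ζ‖) = 1 := by field_simp
      rw [this]; simp
    have htm : ‖ζ‖ / r ∈ Icc (0 : ℝ) 1 := ⟨by positivity, (div_le_one hr0).2 h⟩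
    have hmono := strictMonoOn_arg_neK_ray (hn.le.trans hr) him'
    have hle : Complex.arg (neK ζ') ≤ M := hM ⟨ζ', by simp [hn], rfl⟩
    rw [abs_of_pos (arg_neK_pos (h.trans hr) hpos)]
    have h1 := hmono.monotoneOn htm (right_mem_Icc.2 zero_le_one) htm.2
    simp only [← ht, Complex.ofReal_one, one_mul] at h1
    refine ⟨h1.trans hle, fun he => ?_⟩
    rcases h.eq_or_lt with heq | hlt
    · exact heq
    have h2 := hmono htm (right_mem_Icc.2 zero_le_one) ((div_lt_one hr0).2 hlt)
    simp only [← ht, Complex.ofReal_one, one_mul] at h2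
    linarith

theorem exists_isGreatest_arg_neK {r : ℝ} (hr0 : 0 ≤ r) (hr : r ≤ 1) :
    ∃ M, IsGreatest ((fun ζ => Complex.arg (neK ζ)) '' sphere 0 r) M := by
  have hc : ContinuousOn (fun ζ => Complex.arg (neK ζ)) (sphere 0 r) := fun ζ hζ => by
    have hn : ‖ζ‖ ≤ 1 := (mem_sphere_zero_iff_norm.1 hζ).le.trans hr
    exact ((Complex.continuousAt_arg (neK_mem_slitPlane hn)).comp
      (differentiable_neK ζ).continuousAt).continuousWithinAt
  exact ((isCompact_sphere (0 : ℂ) r).image_of_continuousOn hc).exists_isGreatest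
    (((NormedSpace.sphere_nonempty).2 hr0).image _)

/-! ### The covering radius -/

/-- The exponential in the integral is replaced by its first eleven Taylor terms. The argument t³/9
- t has modulus at most 1, so the error is at most 12/(11! · 11) < 3 · 10⁻⁸; the polynomial is
integrated exactly. -/
theorem neg_neHat_neg_one_re : |(-neHat (-1)).re - 0.645159| < 0.0000005 := by
  have h1 : (-neHat (-1)).re = ∫ t in (0 : ℝ)..1, Real.exp (t ^ 3 / 9 - t) := by
    have : neHat (-1) = ((∫ t in (0 : ℝ)..1, -Real.exp (t ^ 3 / 9 - t) : ℝ) : ℂ) := by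
      rw [neHat, ← intervalIntegral.integral_ofReal]
      congr 1
      funext t
      push_cast
      rw [mul_neg_one]
      congr 2
      ring
    rw [this, ← Complex.ofReal_neg, Complex.ofReal_re, intervalIntegral.integral_neg, neg_neg]
  have h2 : ∀ t : ℝ, ∑ j ∈ Finset.range 11, (t ^ 3 / 9 - t) ^ j / (j.factorial : ℝ) =
      ∑ j ∈ Finset.range 11, ∑ i ∈ Finset.range (j + 1),
        ((1 / 9) ^ i * (-1) ^ (j - i) * (j.choose i : ℝ) / (j.factorial : ℝ)) *
          t ^ (3 * i + (j - i)) := by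
    intro t
    refine Finset.sum_congr rfl fun j _ => ?_
    rw [sub_eq_add_neg, add_pow, Finset.sum_div]
    refine Finset.sum_congr rfl fun i _ => ?_
    rw [neg_pow t, pow_add, pow_mul, one_div]
    ring
  have h3 : ∫ t in (0 : ℝ)..1, ∑ j ∈ Finset.range 11, (t ^ 3 / 9 - t) ^ j / (j.factorial : ℝ) =
      ∑ j ∈ Finset.range 11, ∑ i ∈ Finset.range (j + 1),
        ((1 / 9) ^ i * (-1) ^ (j - i) * (j.choose i : ℝ) / (j.factorial : ℝ)) *
          (1 / ((3 * i + (j - i) : ℕ) + 1)) := by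
    simp_rw [h2]
    rw [intervalIntegral.integral_finsetSum fun j _ =>
      Continuous.intervalIntegrable (by fun_prop) _ _]
    refine Finset.sum_congr rfl fun j _ => ?_
    rw [intervalIntegral.integral_finsetSum fun i _ =>
      Continuous.intervalIntegrable (by fun_prop) _ _]
    refine Finset.sum_congr rfl fun i _ => ?_
    rw [intervalIntegral.integral_const_mul, integral_pow]
    simp
  have h4 : |(∫ t in (0 : ℝ)..1, Real.exp (t ^ 3 / 9 - t)) -
      ∫ t in (0 : ℝ)..1, ∑ j ∈ Finset.range 11, (t ^ 3 / 9 - t) ^ j / (j.factorial : ℝ)| ≤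
        3 / 100000000 := by
    rw [← intervalIntegral.integral_sub (Continuous.intervalIntegrable (by fun_prop) _ _)
      (Continuous.intervalIntegrable (by fun_prop) _ _)]
    have := intervalIntegral.norm_integral_le_of_norm_le_const (a := (0 : ℝ)) (b := 1)
      (C := 3 / 100000000)
      (f := fun t => Real.exp (t ^ 3 / 9 - t) -
        ∑ j ∈ Finset.range 11, (t ^ 3 / 9 - t) ^ j / (j.factorial : ℝ)) (fun t ht => by
        rw [uIoc_of_le zero_le_one] at ht
        have ht3 : t ^ 3 ≤ 1 := pow_le_one₀ ht.1.le ht.2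
        have ht0 : 0 ≤ t ^ 3 := pow_nonneg ht.1.le 3
        have hu : |t ^ 3 / 9 - t| ≤ 1 :=
          abs_le.2 ⟨by linarith [ht.2], by linarith [ht.1]⟩
        refine (Real.exp_bound hu (n := 11) (by norm_num)).trans ?_
        have hp : |t ^ 3 / 9 - t| ^ 11 ≤ 1 := pow_le_one₀ (abs_nonneg _) hu
        have hc : ((Nat.succ 11 : ℕ) : ℝ) / ((Nat.factorial 11 : ℕ) * (11 : ℕ)) ≤ 3 / 100000000 := by
          norm_num [Nat.factorial]
        have hc0 : 0 ≤ ((Nat.succ 11 : ℕ) : ℝ) / ((Nat.factorial 11 : ℕ) * (11 : ℕ)) := by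
          positivity
        calc _ ≤ 1 * (((Nat.succ 11 : ℕ) : ℝ) / ((Nat.factorial 11 : ℕ) * (11 : ℕ))) := by gcongr
          _ ≤ _ := by rw [one_mul]; exact hc)
    simpa using this
  rw [h1]
  rw [h3] at h4
  norm_num [Finset.sum_range_succ, Nat.choose, Nat.factorial] at h4
  rw [abs_le] at h4
  rw [abs_lt]
  constructor <;> norm_num at h4 ⊢ <;> linarith [h4.1, h4.2]

/-! ### Rotations -/

theorem norm_mul_lt_one {x z : ℂ} (hx : ‖x‖ = 1) (hz : ‖z‖ < 1) : ‖x * z‖ < 1 := by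
  rwa [norm_mul, hx, one_mul]

theorem isRotationOf_of_deriv {f : ℂ → ℂ} (hf : f ∈ ClassCNe) {x : ℂ} (hx : ‖x‖ = 1)
    (h : ∀ z ∈ ball (0 : ℂ) 1, deriv f z = Complex.exp (neExp (x * z))) :
    IsRotationOf f neHat := by
  obtain ⟨⟨hfd, hf0, -⟩, -⟩ := hf
  have hx0 : x ≠ 0 := fun h => by simp [h] at hx
  have hd : ∀ z, HasDerivAt (fun z => x⁻¹ * neHat (x * z)) (Complex.exp (neExp (x * z))) z := by
    intro z
    have h1 : HasDerivAt (fun z => x * z) x z := by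
      simpa using (hasDerivAt_id' z).const_mul x
    have h2 : HasDerivAt neHat (Complex.exp (neExp (x * z))) (x * z) := hasDerivAt_neHat _
    exact ((h2.comp z h1).const_mul x⁻¹).congr_deriv (by field_simp)
  refine ⟨x, hx, isOpen_ball.eqOn_of_deriv_eq (convex_ball (0 : ℂ) 1).isPreconnected hfd
    (fun z _ => (hd z).differentiableAt.differentiableWithinAt)
    (fun z hz => by rw [(hd z).deriv, h z hz]) (by simp : (0 : ℂ) ∈ ball (0 : ℂ) 1) ?_⟩
  simp [hf0, neHat_zero]

theorem isRotationOf_of_dslope {f : ℂ → ℂ} (hf0 : f 0 = 0) {x : ℂ} (hx : ‖x‖ = 1)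
    (h : ∀ z ∈ ball (0 : ℂ) 1, dslope f 0 z = neK (x * z)) : IsRotationOf f neHat := by
  have hx0 : x ≠ 0 := fun h => by simp [h] at hx
  refine ⟨x, hx, fun z hz => ?_⟩
  rw [← mul_dslope_zero hf0, h z hz, ← mul_neK]
  field_simp

theorem deriv_of_rotation {f : ℂ → ℂ} {x : ℂ} (hx : ‖x‖ = 1)
    (h : ∀ z ∈ ball (0 : ℂ) 1, f z = x⁻¹ * neHat (x * z)) {z : ℂ} (hz : z ∈ ball (0 : ℂ) 1) :
    deriv f z = deriv neHat (x * z) := by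
  have hx0 : x ≠ 0 := fun h => by simp [h] at hx
  have h1 : HasDerivAt (fun z => x * z) x z := by
    simpa using (hasDerivAt_id' z).const_mul x
  have h2 := ((differentiable_neHat (x * z)).hasDerivAt.comp z h1).const_mul x⁻¹
  have h3 : f =ᶠ[𝓝 z] fun z => x⁻¹ * neHat (x * z) := by
    filter_upwards [ball_mem_nhds_of_norm_lt hz] with y hy using h y hy
  rw [h3.deriv_eq]
  have h4 : deriv (fun z => x⁻¹ * neHat (x * z)) z = _ := h2.deriv
  rw [h4]
  field_simp

theorem dslope_of_rotation {f : ℂ → ℂ} (hf1 : deriv f 0 = 1) {x : ℂ} (hx : ‖x‖ = 1)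
    (h : ∀ z ∈ ball (0 : ℂ) 1, f z = x⁻¹ * neHat (x * z)) {z : ℂ} (hz : z ∈ ball (0 : ℂ) 1) :
    dslope f 0 z = neK (x * z) := by
  have hx0 : x ≠ 0 := fun h => by simp [h] at hx
  rcases eq_or_ne z 0 with rfl | hz0
  · rw [dslope_same, hf1, mul_zero, neK_zero]
  · rw [dslope_of_ne _ hz0, slope_def_field, h z hz, h 0 (by simp), mul_zero, neHat_zero,
      ← mul_neK (x * z)]
    field_simp
    simp
    ring

/-- A point of prescribed modulus that a rotation moves to a given point. -/
theorem exists_preimage_rotation {x ζ : ℂ} (hx : ‖x‖ = 1) (hζ0 : ζ ≠ 0) (hζ : ‖ζ‖ < 1) :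
    ∃ z : ℂ, z ≠ 0 ∧ ‖z‖ < 1 ∧ ‖z‖ = ‖ζ‖ ∧ x * z = ζ := by
  have hx0 : x ≠ 0 := fun h => by simp [h] at hx
  have hn : ‖x⁻¹ * ζ‖ = ‖ζ‖ := by rw [norm_mul, norm_inv, hx, inv_one, one_mul]
  exact ⟨x⁻¹ * ζ, mul_ne_zero (inv_ne_zero hx0) hζ0, by rwa [hn], hn, by field_simp⟩

/-! ### Distortion -/

theorem distortion {f : ℂ → ℂ} (hf : f ∈ ClassCNe) {z : ℂ} (hz : ‖z‖ < 1) :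
    ((deriv neHat (-(‖z‖ : ℂ))).re ≤ ‖deriv f z‖ ∧ ‖deriv f z‖ ≤ (deriv neHat (‖z‖ : ℂ)).re) ∧
    (z ≠ 0 → ‖deriv f z‖ = (deriv neHat (-(‖z‖ : ℂ))).re → IsRotationOf f neHat) ∧
    (z ≠ 0 → ‖deriv f z‖ = (deriv neHat (‖z‖ : ℂ)).re → IsRotationOf f neHat) := by
  obtain ⟨w, hw, h⟩ := exists_schwarz_deriv hf
  have hle := hw.norm_le hz
  obtain ⟨h1, h2⟩ := neExp_re_le_of_norm_le hle hz.le
  -- E is odd, so the lower bound at w z is the upper bound at -w z.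
  obtain ⟨h3, h4⟩ := neExp_re_le_of_norm_le (ζ := -w z) (by rwa [norm_neg]) hz.le
  rw [neExp_neg, Complex.neg_re, norm_neg] at h4
  rw [neExp_neg, Complex.neg_re] at h3
  have hrot : z ≠ 0 → ‖w z‖ = ‖z‖ → IsRotationOf f neHat := fun hz0 heq => by
    obtain ⟨x, hx, hwx⟩ := hw.eq_mul_of_norm_eq hz0 hz heq
    exact isRotationOf_of_deriv hf hx fun y hy => by rw [h y hy, hwx y hy]
  rw [deriv_neHat_ofReal_re, deriv_neHat_neg_ofReal_re, h z (by simpa using hz), Complex.norm_exp,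
    Real.exp_le_exp, Real.exp_le_exp, Real.exp_eq_exp, Real.exp_eq_exp]
  exact ⟨⟨by linarith, h1⟩, fun hz0 he => hrot hz0 (h4 (by linarith)),
    fun hz0 he => hrot hz0 (h2 he)⟩

/-! ### Growth -/

theorem growth {f : ℂ → ℂ} (hf : f ∈ ClassCNe) {z : ℂ} (hz : ‖z‖ < 1) :
    ((-neHat (-(‖z‖ : ℂ))).re ≤ ‖f z‖ ∧ ‖f z‖ ≤ (neHat (‖z‖ : ℂ)).re) ∧
    (z ≠ 0 → ‖f z‖ = (-neHat (-(‖z‖ : ℂ))).re → IsRotationOf f neHat) ∧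
    (z ≠ 0 → ‖f z‖ = (neHat (‖z‖ : ℂ)).re → IsRotationOf f neHat) := by
  obtain ⟨w, hw, h⟩ := exists_schwarz_neK hf
  have hf0 : f 0 = 0 := hf.1.2.1
  obtain ⟨⟨h1, h2⟩, h3, h4⟩ := neK_norm_bounds (hw.norm_le hz) hz.le
  have hrot : z ≠ 0 → ‖w z‖ = ‖z‖ → IsRotationOf f neHat := fun hz0 heq => by
    obtain ⟨x, hx, hwx⟩ := hw.eq_mul_of_norm_eq hz0 hz heq
    exact isRotationOf_of_dslope hf0 hx fun y hy => by rw [h y hy, hwx y hy]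
  rw [neHat_ofReal_re, neg_neHat_neg_ofReal_re, ← mul_dslope_zero hf0 z, norm_mul,
    h z (by simpa using hz)]
  have hn := norm_nonneg z
  refine ⟨⟨by gcongr, by gcongr⟩, fun hz0 he => hrot hz0 (h3 ?_), fun hz0 he => hrot hz0 (h4 ?_)⟩ <;>
  exact mul_left_cancel₀ (norm_ne_zero_iff.2 hz0) he

/-! ### Rotation -/

theorem rotation_bound {f : ℂ → ℂ} (hf : f ∈ ClassCNe) {z : ℂ} (hz : ‖z‖ < 1) {M : ℝ}
    (hM : IsGreatest ((fun ζ => Complex.arg (idQuot neHat ζ)) '' sphere 0 ‖z‖) M) :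
    |Complex.arg (idQuot f z)| ≤ M ∧
      (z ≠ 0 → |Complex.arg (idQuot f z)| = M → IsRotationOf f neHat) := by
  obtain ⟨w, hw, h⟩ := exists_schwarz_neK hf
  have hf0 : f 0 = 0 := hf.1.2.1
  rw [idQuot_neHat] at hM
  rw [idQuot_eq_dslope hf0 hf.1.2.2, h z (by simpa using hz)]
  rcases eq_or_ne z 0 with rfl | hz0
  · refine ⟨?_, fun h => absurd rfl h⟩
    have := hM.2 ⟨0, by simp, rfl⟩
    simpa [hw.map_zero, neK_zero] using this
  obtain ⟨h1, h2⟩ := abs_arg_neK_le (hw.norm_le hz) (norm_pos_iff.2 hz0) hz.le hM.2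
  refine ⟨h1, fun _ he => ?_⟩
  obtain ⟨x, hx, hwx⟩ := hw.eq_mul_of_norm_eq hz0 hz (h2 he)
  exact isRotationOf_of_dslope hf0 hx fun y hy => by rw [h y hy, hwx y hy]

theorem exists_arg_eq_of_rotation {f : ℂ → ℂ} (hf : f ∈ ClassCNe) (hrot : IsRotationOf f neHat) :
    ∃ z : ℂ, z ≠ 0 ∧ ‖z‖ < 1 ∧
      IsGreatest ((fun ζ => Complex.arg (idQuot neHat ζ)) '' sphere 0 ‖z‖)
        |Complex.arg (idQuot f z)| := by
  obtain ⟨x, hx, h⟩ := hrot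
  obtain ⟨M, ⟨ζ, hζ, hζM⟩, hMu⟩ :=
    exists_isGreatest_arg_neK (r := 1 / 2) (by norm_num) (by norm_num)
  have hζn : ‖ζ‖ = 1 / 2 := by simpa using hζ
  obtain ⟨z, hz0, hz1, hzn, hxz⟩ := exists_preimage_rotation hx
    (fun h => by norm_num [h] at hζn) (by rw [hζn]; norm_num : ‖ζ‖ < 1)
  refine ⟨z, hz0, hz1, ?_⟩
  have hM0 : 0 ≤ M := (abs_nonneg _).trans
    (abs_arg_neK_le hζn.le (by norm_num) (by norm_num) hMu).1
  simp only at hζM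
  rw [idQuot_neHat, idQuot_eq_dslope hf.1.2.1 hf.1.2.2,
    dslope_of_rotation hf.1.2.2 hx h (by simpa using hz1), hxz, hζM, abs_of_nonneg hM0, hzn, hζn]
  exact ⟨⟨ζ, hζ, hζM⟩, hMu⟩

/-! ### Covering -/

theorem hasDerivAt_neg_neHat_neg (r : ℝ) :
    HasDerivAt (fun r : ℝ => (-neHat (-(r : ℂ))).re) (Real.exp (-(r - r ^ 3 / 9))) r := by
  have h := hasDerivAt_comp_ray (g := neHat) (b := -1) (t := r)
    (differentiable_neHat _).hasDerivAt
  have h1 := hasDerivAt_re h.neg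
  have e : (fun r : ℝ => (-neHat (-(r : ℂ))).re) = fun s : ℝ => (-neHat (s * -1)).re := by
    funext s; rw [mul_neg_one]
  rw [e]
  refine h1.congr_deriv ?_
  rw [mul_neg_one, mul_neg_one, neg_neg, deriv_neHat_neg_ofReal_re]

theorem strictMono_neg_neHat_neg : StrictMono (fun r : ℝ => (-neHat (-(r : ℂ))).re) :=
  strictMono_of_deriv_pos fun r => by
    rw [(hasDerivAt_neg_neHat_neg r).deriv]; exact Real.exp_pos _

theorem continuous_neg_neHat_neg : Continuous (fun r : ℝ => (-neHat (-(r : ℂ))).re) :=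
  continuous_iff_continuousAt.2 fun r => (hasDerivAt_neg_neHat_neg r).continuousAt

theorem neg_neHat_neg_one_pos : 0 < (-neHat (-1)).re := by
  have := strictMono_neg_neHat_neg one_pos
  simpa [neHat_zero] using this

/-- Below the covering radius there is room for a radius `< 1`. -/
theorem exists_lt_neg_neHat_neg {a : ℝ} (ha : a < (-neHat (-1)).re) :
    ∃ r : ℝ, 0 < r ∧ r < 1 ∧ a < (-neHat (-(r : ℂ))).re := by
  have h1 : ∀ᶠ r : ℝ in 𝓝 1, a < (-neHat (-(r : ℂ))).re :=
    continuous_neg_neHat_neg.continuousAt.eventually (lt_mem_nhds (by simpa using ha))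
  have h2 : ∀ᶠ r : ℝ in 𝓝[<] 1, a < (-neHat (-(r : ℂ))).re := h1.filter_mono nhdsWithin_le_nhds
  have h3 : ∀ᶠ r : ℝ in 𝓝[<] 1, r ∈ Ioo (0 : ℝ) 1 := Ioo_mem_nhdsLT one_pos
  obtain ⟨r, hr, hr'⟩ := (h2.and h3).exists
  exact ⟨r, hr'.1, hr'.2, hr⟩

theorem deriv_re_pos_of_mem {f : ℂ → ℂ} (hf : f ∈ ClassCNe) {z : ℂ} (hz : z ∈ ball (0 : ℂ) 1) :
    0 < (deriv f z).re := by
  obtain ⟨w, hw, h⟩ := exists_schwarz_deriv hf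
  rw [h z hz]
  exact exp_neExp_re_pos (hw.norm_lt_one z hz).le

theorem hasDerivAt_of_mem {f : ℂ → ℂ} (hf : f ∈ ClassCNe) {z : ℂ} (hz : z ∈ ball (0 : ℂ) 1) :
    HasDerivAt f (deriv f z) z :=
  (hf.1.1.differentiableAt (ball_mem_nhds_of_norm_lt hz)).hasDerivAt

theorem injOn_of_mem {f : ℂ → ℂ} (hf : f ∈ ClassCNe) : InjOn f (ball 0 1) :=
  injOn_of_deriv_re_pos (convex_ball _ _) (fun _ hz => hasDerivAt_of_mem hf hz)
    (fun _ hz => deriv_re_pos_of_mem hf hz)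

theorem deriv_ne_zero_of_mem {f : ℂ → ℂ} (hf : f ∈ ClassCNe) {z : ℂ} (hz : z ∈ ball (0 : ℂ) 1) :
    deriv f z ≠ 0 := fun h => by
  have := deriv_re_pos_of_mem hf hz
  simp [h] at this

theorem isOpen_image_of_mem {f : ℂ → ℂ} (hf : f ∈ ClassCNe) : IsOpen (f '' ball 0 1) := by
  rw [isOpen_iff_mem_nhds]
  rintro _ ⟨ζ, hζ, rfl⟩
  rw [← (hf.1.1.analyticAt (ball_mem_nhds_of_norm_lt hζ)).hasStrictDerivAt.map_nhds_eq
    (deriv_ne_zero_of_mem hf hζ)]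
  exact image_mem_map (ball_mem_nhds_of_norm_lt hζ)

theorem isClosed_image_closedBall {f : ℂ → ℂ} (hf : f ∈ ClassCNe) {r : ℝ} (hr : r < 1) :
    IsClosed (f '' closedBall 0 r) :=
  ((isCompact_closedBall (0 : ℂ) r).image_of_continuousOn
    (hf.1.1.continuousOn.mono (closedBall_subset_ball hr))).isClosed

/-- The image is open, and by the lower growth bound it is also relatively closed in the disk:
values of modulus below -`neHat`(-r) come from |z| ≤ r, whose image is compact. -/
theorem covering {f : ℂ → ℂ} (hf : f ∈ ClassCNe) :
    ball (0 : ℂ) (-neHat (-1)).re ⊆ f '' ball 0 1 := by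
  refine (convex_ball (0 : ℂ) _).isPreconnected.subset_of_closure_inter_subset
    (isOpen_image_of_mem hf) ⟨0, by simpa using neg_neHat_neg_one_pos, 0, by simp, hf.1.2.1⟩ ?_
  rintro v ⟨hv, hv1⟩
  obtain ⟨r, hr0, hr1, hvr⟩ := exists_lt_neg_neHat_neg (mem_ball_zero_iff.1 hv1)
  have h1 : v ∈ closure (ball (0 : ℂ) (-neHat (-(r : ℂ))).re ∩ f '' ball 0 1) :=
    isOpen_ball.inter_closure ⟨by simpa using hvr, hv⟩
  have h2 : ball (0 : ℂ) (-neHat (-(r : ℂ))).re ∩ f '' ball 0 1 ⊆ f '' closedBall 0 r := by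
    rintro _ ⟨h, z, hz, rfl⟩
    refine ⟨z, ?_, rfl⟩
    have h3 := (growth hf (mem_ball_zero_iff.1 hz)).1.1.trans_lt (mem_ball_zero_iff.1 h)
    exact mem_closedBall_zero_iff.2 (strictMono_neg_neHat_neg.lt_iff_lt.1 h3).le
  exact image_mono (closedBall_subset_ball hr1)
    (closure_minimal h2 (isClosed_image_closedBall hf hr1) h1)

theorem injOn_neHat : InjOn neHat (closedBall 0 1) :=
  injOn_of_deriv_re_pos (convex_closedBall _ _) (fun z _ => hasDerivAt_neHat z)
    (fun _ hz => exp_neExp_re_pos (mem_closedBall_zero_iff.1 hz))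

theorem norm_neHat_neg_one : ‖neHat (-1)‖ = (-neHat (-1)).re := by
  have him := neHat_ofReal_im (-1)
  rw [Complex.ofReal_neg, Complex.ofReal_one] at him
  have hr : neHat (-1) = ((neHat (-1)).re : ℂ) := Complex.ext (by simp) (by simp [him])
  have hpos := neg_neHat_neg_one_pos
  rw [Complex.neg_re] at hpos ⊢
  rw [hr, Complex.norm_real, Real.norm_eq_abs, abs_of_neg (by simpa using hpos), Complex.ofReal_re]

/-- The point x⁻¹ `neHat`(-1) lies on the bounding circle and is omitted by f, because `neHat` is
injective on the closed disk and |xz| < 1. -/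
theorem isGreatest_of_rotation {f : ℂ → ℂ} (hf : f ∈ ClassCNe) (hrot : IsRotationOf f neHat) :
    IsGreatest {ρ : ℝ | ball (0 : ℂ) ρ ⊆ f '' ball 0 1} (-neHat (-1)).re := by
  refine ⟨covering hf, fun ρ hρ => ?_⟩
  by_contra! hlt
  obtain ⟨x, hx, h⟩ := hrot
  have hx0 : x ≠ 0 := fun h => by simp [h] at hx
  have hmem : x⁻¹ * neHat (-1) ∈ ball (0 : ℂ) ρ := by
    rw [mem_ball_zero_iff, norm_mul, norm_inv, hx, inv_one, one_mul, norm_neHat_neg_one]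
    exact hlt
  obtain ⟨z, hz, hfz⟩ := hρ hmem
  rw [h z hz] at hfz
  have hz1 : ‖x * z‖ < 1 := norm_mul_lt_one hx (mem_ball_zero_iff.1 hz)
  have := injOn_neHat (by simpa using hz1.le : x * z ∈ closedBall (0 : ℂ) 1) (by simp)
    (mul_left_cancel₀ (inv_ne_zero hx0) hfz)
  rw [this] at hz1
  simp at hz1

theorem hasDerivAt_norm_comp {F : ℝ → ℂ} {F' : ℂ} {s : ℝ} (hF : HasDerivAt F F' s)
    (h0 : F s ≠ 0) : ∃ d : ℝ, d ≤ ‖F'‖ ∧ HasDerivAt (fun s => ‖F s‖) d s := by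
  have hn : 0 < ‖F s‖ := norm_pos_iff.2 h0
  have h := hF.norm_sq.sqrt (pow_ne_zero 2 hn.ne')
  refine ⟨_, ?_, h.congr_of_eventuallyEq (.of_forall fun t => ?_)⟩
  · rw [Real.sqrt_sq hn.le, mul_div_mul_left _ _ two_ne_zero, div_le_iff₀ hn, mul_comm]
    exact real_inner_le_norm _ _
  · simp only [Real.sqrt_sq (norm_nonneg _)]

/-- Unless `f` is a rotation of the extremal function, its image contains the closed disk. -/
theorem sphere_subset_image {f : ℂ → ℂ} (hf : f ∈ ClassCNe) (hnot : ¬ IsRotationOf f neHat)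
    {v : ℂ} (hv : ‖v‖ = (-neHat (-1)).re) : v ∈ f '' ball 0 1 := by
  have hρ := neg_neHat_neg_one_pos
  set ρ := (-neHat (-1)).re with hρd
  obtain ⟨γ, hγ, hγ'⟩ := exists_hasDerivAt_inverse isOpen_ball hf.1.1 (injOn_of_mem hf)
    (fun z hz => deriv_ne_zero_of_mem hf hz)
  set a : ℝ → ℝ := fun r => (-neHat (-(r : ℂ))).re with ha
  have hv0 : v ≠ 0 := fun h => by rw [h, norm_zero] at hv; linarith
  have hnorm : ∀ {s : ℝ}, 0 < s → ‖(s : ℂ) * v‖ = s * ρ := fun hs => by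
    rw [norm_mul, Complex.norm_real, Real.norm_eq_abs, abs_of_pos hs, hv]
  -- along the radius of `v`, the inverse function is defined
  have hpre : ∀ s ∈ Ico (1 / 2 : ℝ) 1, ∃ ζ ∈ ball (0 : ℂ) 1, ζ ≠ 0 ∧ f ζ = s * v ∧ γ (s * v) = ζ :=
    fun s hs => by
    have hs0 : 0 < s := by linarith [hs.1]
    obtain ⟨ζ, hζ, hfζ⟩ := covering hf (show (s : ℂ) * v ∈ ball (0 : ℂ) ρ by
      rw [mem_ball_zero_iff, hnorm hs0]; nlinarith [hs.2])
    refine ⟨ζ, hζ, ?_, hfζ, by rw [← hfζ, hγ ζ hζ]⟩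
    rintro rfl
    rw [hf.1.2.1] at hfζ
    exact mul_ne_zero (by exact_mod_cast hs0.ne') hv0 hfζ.symm
  -- With ζ = γ(sv), |ζ| grows at a rate at most ρ/|f'(ζ)|, and a'(|ζ|) is the lower distortion
  -- bound for |f'(ζ)|; hence a(|ζ|) grows at a rate at most ρ. Starting at s = 1/2 avoids ζ = 0,
  -- where the modulus is not differentiable.
  have hder : ∀ s ∈ Ico (1 / 2 : ℝ) 1, ∃ d ≤ 0,
      HasDerivAt (fun s : ℝ => a ‖γ (s * v)‖ - s * ρ) d s := fun s hs => by
    obtain ⟨ζ, hζ, hζ0, hfζ, hγζ⟩ := hpre s hs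
    have h1 := hγ' ζ hζ
    rw [hfζ] at h1
    obtain ⟨d, hd, hd'⟩ := hasDerivAt_norm_comp (hasDerivAt_comp_ray h1) (by rwa [hγζ])
    have h2 := ((hasDerivAt_neg_neHat_neg ‖γ (s * v)‖).comp s hd').sub
      ((hasDerivAt_id' s).mul_const ρ)
    refine ⟨_, ?_, h2⟩
    have h3 := (distortion hf (mem_ball_zero_iff.1 hζ)).1.1
    rw [deriv_neHat_neg_ofReal_re] at h3
    have h4 : 0 < ‖deriv f ζ‖ := norm_pos_iff.2 (deriv_ne_zero_of_mem hf hζ)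
    rw [norm_mul, norm_inv, hv] at hd
    rw [hγζ, one_mul]
    have h5 := Real.exp_pos (-(‖ζ‖ - ‖ζ‖ ^ 3 / 9))
    have h6 : Real.exp (-(‖ζ‖ - ‖ζ‖ ^ 3 / 9)) * d ≤
        ‖deriv f ζ‖ * (‖deriv f ζ‖⁻¹ * ρ) := by
      calc _ ≤ Real.exp (-(‖ζ‖ - ‖ζ‖ ^ 3 / 9)) * (‖deriv f ζ‖⁻¹ * ρ) := by gcongr
        _ ≤ _ := by gcongr
    rw [mul_inv_cancel_left₀ h4.ne'] at h6
    linarith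
  have hanti : AntitoneOn (fun s : ℝ => a ‖γ (s * v)‖ - s * ρ) (Ico (1 / 2) 1) := by
    apply antitoneOn_of_deriv_nonpos (convex_Ico _ _)
    · exact fun s hs => (hder s hs).choose_spec.2.continuousAt.continuousWithinAt
    · exact fun s hs =>
        (hder s (interior_subset hs)).choose_spec.2.differentiableAt.differentiableWithinAt
    · intro s hs
      obtain ⟨d, hd, hd'⟩ := hder s (interior_subset hs)
      rw [hd'.deriv]
      exact hd
  have hmem2 : (1 / 2 : ℝ) ∈ Ico (1 / 2 : ℝ) 1 := by norm_num
  -- at the start of the radius the growth estimate is strict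
  have hstrict : a ‖γ ((1 / 2 : ℝ) * v)‖ - 1 / 2 * ρ < 0 := by
    obtain ⟨ζ, hζ, hζ0, hfζ, hγζ⟩ := hpre _ hmem2
    obtain ⟨⟨h1, -⟩, h2, -⟩ := growth hf (mem_ball_zero_iff.1 hζ)
    have h3 := h1.lt_of_ne fun he => hnot (h2 hζ0 he.symm)
    rw [hfζ, hnorm (by norm_num)] at h3
    rw [hγζ]
    exact sub_neg.2 h3
  -- The deficit at s = 1/2 persists along the radius, so all preimages stay in one disk of radius r
  -- < 1, and the limit s → 1 can be taken inside its compact image.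
  obtain ⟨r, hr0, hr1, hrlt⟩ := exists_lt_neg_neHat_neg
    (a := ρ + (a ‖γ ((1 / 2 : ℝ) * v)‖ - 1 / 2 * ρ)) (by linarith)
  have hin : ∀ s ∈ Ico (1 / 2 : ℝ) 1, (s : ℂ) * v ∈ f '' closedBall 0 r := fun s hs => by
    obtain ⟨ζ, hζ, hζ0, hfζ, hγζ⟩ := hpre s hs
    refine ⟨ζ, mem_closedBall_zero_iff.2 (strictMono_neg_neHat_neg.lt_iff_lt.1 ?_).le, hfζ⟩
    have h1 := hanti hmem2 hs hs.1
    simp only [hγζ] at h1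
    refine lt_of_le_of_lt ?_ hrlt
    have : s * ρ ≤ ρ := by nlinarith [hs.2]
    change a ‖ζ‖ ≤ _
    linarith
  have hlim : Tendsto (fun s : ℝ => (s : ℂ) * v) (𝓝[<] 1) (𝓝 v) := by
    have : ContinuousAt (fun s : ℝ => (s : ℂ) * v) 1 := by fun_prop
    have h := this.tendsto
    rw [Complex.ofReal_one, one_mul] at h
    exact h.mono_left nhdsWithin_le_nhds
  refine image_mono (closedBall_subset_ball hr1)
    ((isClosed_image_closedBall hf hr1).mem_of_tendsto hlim ?_)
  filter_upwards [Ico_mem_nhdsLT (by norm_num : (1 / 2 : ℝ) < 1)] with s hs using hin s hs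

/-- If f is not a rotation, the compact closed disk lies in the open image, so a larger disk does as
well. -/
theorem isRotationOf_of_isGreatest {f : ℂ → ℂ} (hf : f ∈ ClassCNe)
    (h : IsGreatest {ρ : ℝ | ball (0 : ℂ) ρ ⊆ f '' ball 0 1} (-neHat (-1)).re) :
    IsRotationOf f neHat := by
  by_contra hnot
  have hρ := neg_neHat_neg_one_pos
  have hsub : closedBall (0 : ℂ) (-neHat (-1)).re ⊆ f '' ball 0 1 := fun v hv => by
    rcases (mem_closedBall_zero_iff.1 hv).eq_or_lt with he | hlt
    · exact sphere_subset_image hf hnot he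
    · exact covering hf (mem_ball_zero_iff.2 hlt)
  obtain ⟨δ, hδ, hδs⟩ := (isCompact_closedBall (0 : ℂ) _).exists_thickening_subset_open
    (isOpen_image_of_mem hf) hsub
  rw [thickening_closedBall hδ hρ.le] at hδs
  have : δ + (-neHat (-1)).re ≤ (-neHat (-1)).re := h.2 hδs
  linarith

/-- Values of `neHat` and of its derivative at real points are real; `.re` reads them as reals. -/
theorem mainTheorem4 (f : ℂ → ℂ) (hf : f ∈ ClassCNe) :
    -- subordination results
    (Subordinate (starQuot f) (starQuot neHat) ∧ Subordinate (idQuot f) (idQuot neHat)) ∧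
    -- distortion theorem
    (∀ z : ℂ, ‖z‖ < 1 →
      (deriv neHat (-(‖z‖ : ℂ))).re ≤ ‖deriv f z‖ ∧ ‖deriv f z‖ ≤ (deriv neHat (‖z‖ : ℂ)).re) ∧
    -- growth theorem
    (∀ z : ℂ, ‖z‖ < 1 →
      (-neHat (-(‖z‖ : ℂ))).re ≤ ‖f z‖ ∧ ‖f z‖ ≤ (neHat (‖z‖ : ℂ)).re) ∧
    -- covering theorem
    ((IsRotationOf f neHat ∨ ball (0 : ℂ) (-neHat (-1)).re ⊆ f '' ball 0 1) ∧
      |(-neHat (-1)).re - 0.645159| < 0.0000005) ∧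
    -- rotation theorem
    (∀ z : ℂ, ‖z‖ < 1 → ∃ M : ℝ,
      IsGreatest ((fun ζ => Complex.arg (idQuot neHat ζ)) '' sphere 0 ‖z‖) M ∧
        |Complex.arg (idQuot f z)| ≤ M) ∧
    -- equality in the lower and in the upper distortion bound
    ((∃ z : ℂ, z ≠ 0 ∧ ‖z‖ < 1 ∧ ‖deriv f z‖ = (deriv neHat (-(‖z‖ : ℂ))).re) ↔
      IsRotationOf f neHat) ∧
    ((∃ z : ℂ, z ≠ 0 ∧ ‖z‖ < 1 ∧ ‖deriv f z‖ = (deriv neHat (‖z‖ : ℂ)).re) ↔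
      IsRotationOf f neHat) ∧
    -- equality in the lower and in the upper growth bound
    ((∃ z : ℂ, z ≠ 0 ∧ ‖z‖ < 1 ∧ ‖f z‖ = (-neHat (-(‖z‖ : ℂ))).re) ↔ IsRotationOf f neHat) ∧
    ((∃ z : ℂ, z ≠ 0 ∧ ‖z‖ < 1 ∧ ‖f z‖ = (neHat (‖z‖ : ℂ)).re) ↔ IsRotationOf f neHat) ∧
    -- equality in the covering theorem: the disk is the largest one about `0` that is covered
    (IsGreatest {ρ : ℝ | ball (0 : ℂ) ρ ⊆ f '' ball 0 1} (-neHat (-1)).re ↔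
      IsRotationOf f neHat) ∧
    -- equality in the rotation theorem
    ((∃ z : ℂ, z ≠ 0 ∧ ‖z‖ < 1 ∧
        IsGreatest ((fun ζ => Complex.arg (idQuot neHat ζ)) '' sphere 0 ‖z‖)
          |Complex.arg (idQuot f z)|) ↔
      IsRotationOf f neHat) := by
  have hreal : ∀ r : ℝ, 0 < r → ‖(r : ℂ)‖ = r := fun r hr => by
    rw [Complex.norm_real, Real.norm_eq_abs, abs_of_pos hr]
  -- For a rotation by x, equality in distortion and growth is exhibited where xz = 1/2 (upper
  -- bounds) or xz = -1/2 (lower bounds); the radius 1/2 is arbitrary.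
  have hhalf : ‖((1 / 2 : ℝ) : ℂ)‖ = 1 / 2 := hreal _ (by norm_num)
  have hhalf' : ‖-((1 / 2 : ℝ) : ℂ)‖ = 1 / 2 := by rw [norm_neg, hhalf]
  have hne : ((1 / 2 : ℝ) : ℂ) ≠ 0 := by simp
  refine ⟨⟨subordinate_starQuot hf, subordinate_idQuot hf⟩, fun z hz => (distortion hf hz).1,
    fun z hz => (growth hf hz).1, ⟨Or.inr (covering hf), neg_neHat_neg_one_re⟩, fun z hz => ?_,
    ⟨fun ⟨z, hz0, hz, h⟩ => (distortion hf hz).2.1 hz0 h, fun ⟨x, hx, h⟩ => ?_⟩,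
    ⟨fun ⟨z, hz0, hz, h⟩ => (distortion hf hz).2.2 hz0 h, fun ⟨x, hx, h⟩ => ?_⟩,
    ⟨fun ⟨z, hz0, hz, h⟩ => (growth hf hz).2.1 hz0 h, fun ⟨x, hx, h⟩ => ?_⟩,
    ⟨fun ⟨z, hz0, hz, h⟩ => (growth hf hz).2.2 hz0 h, fun ⟨x, hx, h⟩ => ?_⟩,
    ⟨isRotationOf_of_isGreatest hf, isGreatest_of_rotation hf⟩,
    ⟨fun ⟨z, hz0, hz, h⟩ => (rotation_bound hf hz h).2 hz0 rfl, exists_arg_eq_of_rotation hf⟩⟩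
  · obtain ⟨M, hM⟩ := exists_isGreatest_arg_neK (norm_nonneg z) hz.le
    rw [← idQuot_neHat] at hM
    exact ⟨M, hM, (rotation_bound hf hz hM).1⟩
  · obtain ⟨z, hz0, hz1, hzn, hxz⟩ := exists_preimage_rotation hx (neg_ne_zero.2 hne)
      (by rw [hhalf']; norm_num)
    refine ⟨z, hz0, hz1, ?_⟩
    rw [deriv_of_rotation hx h (by simpa using hz1), hxz, hzn, hhalf', deriv_neHat_neg_ofReal_re,
      ← Complex.ofReal_neg, deriv_neHat, neExp_ofReal, Complex.norm_exp, Complex.ofReal_re]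
    norm_num
  · obtain ⟨z, hz0, hz1, hzn, hxz⟩ := exists_preimage_rotation hx hne
      (by rw [hhalf]; norm_num)
    refine ⟨z, hz0, hz1, ?_⟩
    rw [deriv_of_rotation hx h (by simpa using hz1), hxz, hzn, hhalf, deriv_neHat_ofReal_re,
      deriv_neHat, neExp_ofReal, Complex.norm_exp, Complex.ofReal_re]
  · obtain ⟨z, hz0, hz1, hzn, hxz⟩ := exists_preimage_rotation hx (neg_ne_zero.2 hne)
      (by rw [hhalf']; norm_num)
    refine ⟨z, hz0, hz1, ?_⟩
    have hK := neK_ofReal (-(1 / 2))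
    have hpos := neK_re_pos (z := ((-(1 / 2) : ℝ) : ℂ)) (by rw [Complex.ofReal_neg, hhalf']; norm_num)
    rw [← mul_dslope_zero hf.1.2.1, dslope_of_rotation hf.1.2.2 hx h (by simpa using hz1), hxz, hzn,
      hhalf', neg_neHat_neg_ofReal_re, norm_mul, hzn, hhalf', ← Complex.ofReal_neg, hK,
      Complex.norm_real, Real.norm_eq_abs, abs_of_pos hpos, Complex.ofReal_re]
  · obtain ⟨z, hz0, hz1, hzn, hxz⟩ := exists_preimage_rotation hx hne
      (by rw [hhalf]; norm_num)
    refine ⟨z, hz0, hz1, ?_⟩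
    have hK := neK_ofReal (1 / 2)
    have hpos := neK_re_pos (z := ((1 / 2 : ℝ) : ℂ)) (by rw [hhalf]; norm_num)
    rw [← mul_dslope_zero hf.1.2.1, dslope_of_rotation hf.1.2.2 hx h (by simpa using hz1), hxz, hzn,
      hhalf, neHat_ofReal_re, norm_mul, hzn, hhalf, hK,
      Complex.norm_real, Real.norm_eq_abs, abs_of_pos hpos, Complex.ofReal_re]
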